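/- For each $n\ge 1$ let $Y_i=\mu_i+\varepsilon_i$, $i=1,\dots,n$, where $\mu_1,\dots,\mu_n$ are arbitrary real random variables and $\varepsilon_1,\dots,\varepsilon_n$ are i.i.d. $N(0,1)$, independent of $(\mu_1,\dots,\mu_n)$ (all objects may depend on $n$). Let $\tilde\mu_i$ and $\hat\mu_i$ be measurable functions of the data $Y_1,\dots,Y_n$ and put $Z_i=Y_i-\tilde\mu_i$, $\nu_i=\mu_i-\tilde\mu_i$. Assume: 1. $\tilde\mu_i$ is a function of $(Y_j)_{j\ne i}$ only, and for $j\neq i$ replacing $Y_j$ by $Y_j+d$ changes $\tilde\mu_i$ by at most $\rho_{|i-j|}|d|$, where $(\rho_M)$ is a sequence not depending on $n$ with $\limsup_{M\to\infty}M^2\rho_M<1$. 2. There is a random variable $\alpha_n$, a measurable function of $(Y_j)_{j\neq n}$, with $0<\alpha_n<1$ almost surely, such that $\hat\mu_i=\alpha_n\tilde\mu_i+(1-\alpha_n)Y_i+\zeta_i$, where $E\zeta_i^2\to0$ as $n\to\infty$, $0<\liminf i/n\le\limsup i/n<1$; that is, for every $c>0$, $\sup\{E\zeta_i^2:\ cn\le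 i\le(1-c)n\}\to0$ as $n\to\infty$. 3. For all sufficiently large $n$, $\frac1n\sum_{i=1}^nP(|Y_i-\tilde\mu_i|>\log n)\le(\log n)^{-8}$. Let $\varphi$ be the standard normal density, $f_Z(z)=\frac1n\sum_{i=1}^n\varphi(z-\nu_i)$, $\delta^n(z)=z+f_Z'(z)/f_Z(z)$, and let $\mu^I_i=\tilde\mu_i+\delta^n(Z_i)$ be the oracle improved estimator. Let $F^n_\nu=\frac1n\sum_{i=1}^n\delta_{\nu_i}$ be the (random) empirical distribution of $\nu_1,\dots,\nu_n$. If $n^{-1}E\sum_{i=1}^n(\mu^I_i-\hat\mu_i)^2\to0$, then the random signed measures $F^n_\nu-N\bigl(0,(1-\alpha_n)/\alpha_n\bigr)$ converge to the zero measure, in the following sense. (a) If $\alpha_n$ is bounded away from $0$ in probability (for every $e>0$ there is $c>0$ with $P(\alpha_n<c)\le e$ for all large $n$), the convergence is weak, in probability: for every bounded continuous $g:\mathbb R\to\mathbb R$, $$\int g\,dF^n_\nu-\int g\,dN\bigl(0,(1-\alpha_n)/\alpha_n\bigr)\to0\quad\text{in probability.}$$ (b) With no condition on $\alpha_n$ beyond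 2, the same holds for every continuous $g:\mathbb R\to\mathbb R$ with $g(x)\to 0$ as $|x|\to\infty$. -/

import Mathlib

open MeasureTheory ProbabilityTheory Filter Topology
open scoped ENNReal NNReal

noncomputable section

namespace KalmanEB

/-- The observation model at sample size `n`: the noises `ε 1, …, ε n` are i.i.d. `N(0,1)` and
independent of the (arbitrary) random signal `(μ 1, …, μ n)`. -/
structure IsSignalPlusNoise {Ω : Type*} [MeasurableSpace Ω] (P : Measure Ω) {n : ℕ}
    (μ ε : Fin n → Ω → ℝ) : Prop where
  measurable_signal : ∀ i, Measurable (μ i)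
  measurable_noise : ∀ i, Measurable (ε i)
  noise_gaussian : ∀ i, P.map (ε i) = gaussianReal 0 1
  noise_indep : iIndepFun ε P
  indep : IndepFun (fun ω i => μ i ω) (fun ω i => ε i ω) P

/-- The data vector `Y = μ + ε`. -/
def obs {Ω : Type*} {n : ℕ} (μ ε : Fin n → Ω → ℝ) (ω : Ω) : Fin n → ℝ :=
  fun i => μ i ω + ε i ω

/-- The residuals `Z i = Y i - μ̃ i`, where `mt i` computes `μ̃ i` from the data. -/
def resid {Ω : Type*} {n : ℕ} (μ ε : Fin n → Ω → ℝ) (mt : Fin n → (Fin n → ℝ) → ℝ) (ω : Ω) :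
    Fin n → ℝ :=
  fun i => obs μ ε ω i - mt i (obs μ ε ω)

/-- The centred signal `ν i = μ i - μ̃ i`. -/
def centred {Ω : Type*} {n : ℕ} (μ ε : Fin n → Ω → ℝ) (mt : Fin n → (Fin n → ℝ) → ℝ) (ω : Ω) :
    Fin n → ℝ :=
  fun i => μ i ω - mt i (obs μ ε ω)

/-- The mixture density `f_Z(z) = n⁻¹ ∑ᵢ φ(z - νᵢ)`, `φ` the standard normal density. -/
def mixDensity {n : ℕ} (v : Fin n → ℝ) (z : ℝ) : ℝ :=
  (n : ℝ)⁻¹ * ∑ i, gaussianPDFReal 0 1 (z - v i)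

/-- The oracle decision function `δⁿ(z) = z + f_Z'(z) / f_Z(z)`. -/
def oracle {n : ℕ} (v : Fin n → ℝ) (z : ℝ) : ℝ :=
  z + deriv (mixDensity v) z / mixDensity v z

/-- The oracle improved estimator `μᴵ i = μ̃ i + δⁿ(Z i)`; `δⁿ` is the random function built from
the realized `ν 1, …, ν n`. -/
def improved {Ω : Type*} {n : ℕ} (μ ε : Fin n → Ω → ℝ) (mt : Fin n → (Fin n → ℝ) → ℝ) (ω : Ω) :
    Fin n → ℝ :=
  fun i => mt i (obs μ ε ω) + oracle (centred μ ε mt ω) (resid μ ε mt ω i)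

/-- The empirical distribution of the points `v 1, …, v n`. -/
def empirical {n : ℕ} (v : Fin n → ℝ) : Measure ℝ :=
  (n : ℝ≥0∞)⁻¹ • ∑ i, Measure.dirac (v i)

/-- Each `μ̃ i` is a measurable function of the observations `Y j`, `j ≠ i`, and is Lipschitz in
`Y j` with a constant `ρ |i - j|`, where `limsup M² ρ M < 1`. -/
structure IsLocalPredictor (mt : ∀ n, Fin n → (Fin n → ℝ) → ℝ) (ρ : ℕ → ℝ) : Prop where
  measurable : ∀ n i, Measurable (mt n i)
  dependsOn : ∀ n i, DependsOn (mt n i) {j | j ≠ i}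
  lipschitz : ∀ (n : ℕ) (i j : Fin n), j ≠ i → ∀ (y : Fin n → ℝ) (d : ℝ),
    |mt n i (Function.update y j (y j + d)) - mt n i y| ≤ ρ (Nat.dist i j) * |d|
  limsup_lt : limsup (fun M : ℕ => (((M : ℝ) ^ 2 * ρ M : ℝ) : EReal)) atTop < 1

/-- `μ̂ i = α μ̃ i + (1 - α) Y i + ζ i` with `α = α n` a function of `Y j`, `j ≠ n`, with values in
`(0,1)`, and `E ζ i ² → 0` as `n → ∞`, uniformly in `c n ≤ i ≤ (1 - c) n`, for every `c > 0`.
(The index `i : Fin n` stands for the time `i + 1`.) -/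
structure IsAsymptoticAverage {Ω : ℕ → Type*} [∀ n, MeasurableSpace (Ω n)]
    (P : ∀ n, Measure (Ω n)) (μ ε : ∀ n, Fin n → Ω n → ℝ)
    (mt mh : ∀ n, Fin n → (Fin n → ℝ) → ℝ) (α : ∀ n, (Fin n → ℝ) → ℝ) : Prop where
  measurable : ∀ n, Measurable (α n)
  dependsOn : ∀ n, DependsOn (α n) {j | (j : ℕ) + 1 ≠ n}
  mem_Ioo : ∀ n, ∀ᵐ ω ∂P n, α n (obs (μ n) (ε n) ω) ∈ Set.Ioo (0 : ℝ) 1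
  remainder : ∀ c : ℝ, 0 < c →
    Tendsto (fun n : ℕ => ⨆ (i : Fin n)
        (_ : c * (n : ℝ) ≤ ((i : ℕ) : ℝ) + 1 ∧ ((i : ℕ) : ℝ) + 1 ≤ (1 - c) * (n : ℝ)),
        ∫⁻ ω, ENNReal.ofReal
          ((mh n i (obs (μ n) (ε n) ω)
            - (α n (obs (μ n) (ε n) ω) * mt n i (obs (μ n) (ε n) ω)
              + (1 - α n (obs (μ n) (ε n) ω)) * obs (μ n) (ε n) ω i)) ^ 2) ∂P n)
      atTop (𝓝 0)

/-- For all large `n`, `n⁻¹ ∑ᵢ P(|Y i - μ̃ i| > log n) ≤ (log n)⁻⁸`. -/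
def HasLogTails {Ω : ℕ → Type*} [∀ n, MeasurableSpace (Ω n)]
    (P : ∀ n, Measure (Ω n)) (μ ε : ∀ n, Fin n → Ω n → ℝ)
    (mt : ∀ n, Fin n → (Fin n → ℝ) → ℝ) : Prop :=
  ∀ᶠ n : ℕ in atTop,
    (1 / (n : ℝ)) * ∑ i, (P n).real {ω | Real.log n < |resid (μ n) (ε n) (mt n) ω i|}
      ≤ 1 / (Real.log n) ^ 8

/-- Integral of `g` against the random signed measure `F_νⁿ - N(0, (1 - αₙ)/αₙ)`. -/
def discrepancy {Ω : Type*} {n : ℕ} (μ ε : Fin n → Ω → ℝ) (mt : Fin n → (Fin n → ℝ) → ℝ)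
    (α : (Fin n → ℝ) → ℝ) (g : ℝ → ℝ) (ω : Ω) : ℝ :=
  (∫ x, g x ∂(empirical (centred μ ε mt ω)))
    - ∫ x, g x ∂(gaussianReal 0
        (Real.toNNReal ((1 - α (obs μ ε ω)) / α (obs μ ε ω))))

/-- Convergence to `0` in probability of random variables living on varying probability spaces. -/
def TendstoZeroInProb {Ω : ℕ → Type*} [∀ n, MeasurableSpace (Ω n)]
    (P : ∀ n, Measure (Ω n)) (X : ∀ n, Ω n → ℝ) : Prop :=
  ∀ e : ℝ, 0 < e → Tendsto (fun n => P n {ω | e ≤ |X n ω|}) atTop (𝓝 0)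

/-- The variables `A n` are bounded away from `0` in probability. -/
def BoundedBelowInProb {Ω : ℕ → Type*} [∀ n, MeasurableSpace (Ω n)]
    (P : ∀ n, Measure (Ω n)) (A : ∀ n, Ω n → ℝ) : Prop :=
  ∀ e : ℝ, 0 < e → ∃ c : ℝ, 0 < c ∧ ∀ᶠ n in atTop, (P n).real {ω | A n ω < c} ≤ e

end KalmanEB

end

/-!
Let `f` be the mixture density of `φ (z - νᵢ)`. Tweedie's formula turns `μᴵᵢ ≈ μ̂ᵢ` into
`f' / f + α z ≈ 0` at the residuals `z = Zᵢ = νᵢ + εᵢ`, an equation whose solution is the density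
of `N(0, 1 / α) = N(0, (1 - α) / α) * N(0, 1)`.

Each `νᵢ` does not involve `εᵢ` and, the constants `ρ` being summable, every `εⱼ` has bounded total
influence on `ν`. Hence, for a Lipschitz functional `G`, the averages of `G ν` over the `Zᵢ` and
over the density `f` differ by `O(n^(-1/2))` in mean. After truncation at `|z| ≤ log n` and
regularization of `f' / f` where `f` is small, which cost only powers of `log n`, the equation
therefore holds in `L²(f)`. For the Fourier transform `u` of `f` it reads `t u + α u' ≈ 0`, so `u`
is close to `exp (-t² / 2 α)`, and dividing by the characteristic function of `N(0, 1)` shows that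
the characteristic function of the empirical measure of `ν` is close to that of
`N(0, (1 - α) / α)`.
Closeness of characteristic functions is convergence in the vague sense, and in the weak sense when
the variances `(1 - α) / α` are bounded.
-/

namespace KalmanEB

local notation "φ" => gaussianPDFReal 0 1
local notation "γ" => gaussianReal 0 1

lemma stdPDF_eq (x : ℝ) : φ x = (√(2 * Real.pi))⁻¹ * Real.exp (-x ^ 2 / 2) := by
  simp [gaussianPDFReal]

lemma stdPDF_pos (x : ℝ) : 0 < φ x := gaussianPDFReal_pos 0 1 x one_ne_zero

lemma stdPDF_nonneg (x : ℝ) : 0 ≤ φ x := (stdPDF_pos x).le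

lemma inv_sqrt_two_pi_le : (√(2 * Real.pi))⁻¹ ≤ 1 / 2 := by
  rw [inv_eq_one_div]
  exact one_div_le_one_div_of_le two_pos
    (Real.le_sqrt_of_sq_le (by nlinarith [Real.pi_gt_three]))

lemma stdPDF_le_one (x : ℝ) : φ x ≤ 1 := by
  have h1 : Real.exp (-x ^ 2 / 2) ≤ 1 := Real.exp_le_one_iff.2 (by nlinarith [sq_nonneg x])
  rw [stdPDF_eq]
  nlinarith [inv_sqrt_two_pi_le, Real.exp_pos (-x ^ 2 / 2)]

lemma sq_mul_stdPDF_le_one (x : ℝ) : x ^ 2 * φ x ≤ 1 := by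
  have h1 : x ^ 2 / 2 * Real.exp (-x ^ 2 / 2) ≤ 1 := by
    have h : Real.exp (x ^ 2 / 2) * Real.exp (-x ^ 2 / 2) = 1 := by
      rw [← Real.exp_add]; simp [neg_div]
    nlinarith [Real.add_one_le_exp (x ^ 2 / 2), Real.exp_pos (-x ^ 2 / 2)]
  have h2 : 0 ≤ x ^ 2 / 2 * Real.exp (-x ^ 2 / 2) := by positivity
  rw [stdPDF_eq]
  nlinarith [inv_sqrt_two_pi_le]

lemma abs_mul_stdPDF_le_one (x : ℝ) : |x| * φ x ≤ 1 := by
  have h : |x| ≤ (x ^ 2 + 1) / 2 := by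
    rw [← sq_abs]; nlinarith [sq_nonneg (|x| - 1)]
  nlinarith [stdPDF_nonneg x, sq_mul_stdPDF_le_one x, stdPDF_le_one x]

lemma hasDerivAt_stdPDF (x : ℝ) : HasDerivAt φ (-(x * φ x)) x := by
  rw [funext stdPDF_eq]
  convert! (((hasDerivAt_pow 2 x).neg.div_const 2).exp).const_mul (√(2 * Real.pi))⁻¹ using 1
  simp only [Nat.cast_ofNat, Pi.neg_apply]
  ring

lemma continuous_stdPDF : Continuous φ :=
  continuous_iff_continuousAt.2 fun x => (hasDerivAt_stdPDF x).continuousAt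

lemma hasDerivAt_mul_stdPDF (x : ℝ) : HasDerivAt (fun x => x * φ x) ((1 - x ^ 2) * φ x) x := by
  convert! (hasDerivAt_id x).mul (hasDerivAt_stdPDF x) using 1
  simp only [id]; ring

lemma abs_stdPDF_sub_le (x y : ℝ) : |φ x - φ y| ≤ |x - y| := by
  have h := convex_univ.norm_image_sub_le_of_norm_hasDerivWithin_le (C := 1)
    (fun x _ => (hasDerivAt_stdPDF x).hasDerivWithinAt)
    (fun x _ => by
      rw [norm_neg, Real.norm_eq_abs, abs_mul, abs_of_nonneg (stdPDF_nonneg x)]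
      exact abs_mul_stdPDF_le_one x) (Set.mem_univ y) (Set.mem_univ x)
  simpa using h

lemma abs_mul_stdPDF_sub_le (x y : ℝ) : |x * φ x - y * φ y| ≤ |x - y| := by
  have h := convex_univ.norm_image_sub_le_of_norm_hasDerivWithin_le (C := 1)
    (fun x _ => (hasDerivAt_mul_stdPDF x).hasDerivWithinAt)
    (fun x _ => by
      rw [Real.norm_eq_abs, abs_le]
      constructor <;> nlinarith [stdPDF_nonneg x, stdPDF_le_one x, sq_mul_stdPDF_le_one x,
        mul_nonneg (sq_nonneg x) (stdPDF_nonneg x)]) (Set.mem_univ y) (Set.mem_univ x)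
  simpa using h

lemma integrable_stdPDF : Integrable φ := integrable_gaussianPDFReal 0 1

lemma integral_stdPDF : ∫ x, φ x = 1 := integral_gaussianPDFReal_eq_one 0 one_ne_zero

lemma integral_stdGaussian (w : ℝ → ℝ) : ∫ x, w x ∂γ = ∫ x, w x * φ x := by
  rw [integral_gaussianReal_eq_integral_smul one_ne_zero]
  simp only [smul_eq_mul, mul_comm]

lemma integrable_stdGaussian_iff {w : ℝ → ℝ} :
    Integrable w γ ↔ Integrable fun x => w x * φ x := by
  rw [gaussianReal_of_var_ne_zero 0 one_ne_zero,
    integrable_withDensity_iff_integrable_smul' (measurable_gaussianPDF 0 1)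
      (by simp [gaussianPDF])]
  simp only [toReal_gaussianPDF, smul_eq_mul, mul_comm]

lemma integrable_sq_stdGaussian : Integrable (fun x : ℝ => x ^ 2) γ := by
  have h : MemLp (fun x : ℝ => x) 2 γ := by
    exact_mod_cast memLp_id_gaussianReal (μ := 0) (v := 1) 2
  exact (memLp_two_iff_integrable_sq (by fun_prop)).1 h

lemma integral_sq_stdGaussian : ∫ x : ℝ, x ^ 2 ∂γ = 1 := by
  have h := variance_fun_id_gaussianReal (μ := 0) (v := 1)
  rw [variance_eq_integral (by fun_prop)] at h
  simpa using h

lemma integrable_id_stdGaussian : Integrable (fun x : ℝ => x) γ :=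
  (memLp_id_gaussianReal (μ := 0) (v := 1) 1).integrable (by simp)

lemma integral_abs_stdGaussian_le : ∫ x : ℝ, |x| ∂γ ≤ 1 := by
  have h : ∫ x : ℝ, |x| ∂γ ≤ ∫ x : ℝ, (x ^ 2 + 1) / 2 ∂γ :=
    integral_mono integrable_id_stdGaussian.abs
      ((integrable_sq_stdGaussian.add (integrable_const 1)).div_const 2) fun x => by
        beta_reduce
        rw [← sq_abs]; nlinarith [sq_nonneg (|x| - 1)]
  refine h.trans ?_
  rw [integral_div, integral_add integrable_sq_stdGaussian (integrable_const 1),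
    integral_sq_stdGaussian]
  simp

lemma integrable_mul_stdPDF : Integrable fun x : ℝ => x * φ x :=
  integrable_stdGaussian_iff.1 integrable_id_stdGaussian

lemma integrable_sq_mul_stdPDF : Integrable fun x : ℝ => x ^ 2 * φ x :=
  integrable_stdGaussian_iff.1 integrable_sq_stdGaussian

lemma integral_sq_mul_stdPDF : ∫ x : ℝ, x ^ 2 * φ x = 1 := by
  rw [← integral_stdGaussian, integral_sq_stdGaussian]

/-- The part of the mixture density carried by the components in `S`. -/
noncomputable def mixOn {n : ℕ} (S : Finset (Fin n)) (v : Fin n → ℝ) (z : ℝ) : ℝ :=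
  (n : ℝ)⁻¹ * ∑ i ∈ S, φ (z - v i)

/-- The derivative of the mixture density. -/
noncomputable def mixSlope {n : ℕ} (v : Fin n → ℝ) (z : ℝ) : ℝ :=
  (n : ℝ)⁻¹ * ∑ i, -((z - v i) * φ (z - v i))

/-- The mixture of the normalized second moment densities `x² φ(x)` centred at the points `v i`;
it measures the Fisher information of the mixture. -/
noncomputable def mixSq {n : ℕ} (v : Fin n → ℝ) (z : ℝ) : ℝ :=
  (n : ℝ)⁻¹ * ∑ i, (z - v i) ^ 2 * φ (z - v i)

section Mixture

variable {n : ℕ} (S : Finset (Fin n)) (v : Fin n → ℝ)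

lemma abs_average_le {C : ℝ} (hC : 0 ≤ C) {x : Fin n → ℝ} (hx : ∀ i ∈ S, |x i| ≤ C) :
    |(n : ℝ)⁻¹ * ∑ i ∈ S, x i| ≤ C := by
  have hcard : (n : ℝ)⁻¹ * S.card ≤ 1 := by
    rw [← div_eq_inv_mul]
    exact div_le_one_of_le₀ (by exact_mod_cast card_finset_fin_le S) (Nat.cast_nonneg n)
  calc |(n : ℝ)⁻¹ * ∑ i ∈ S, x i| ≤ (n : ℝ)⁻¹ * ∑ i ∈ S, |x i| := by
        rw [abs_mul, abs_of_nonneg (by positivity : 0 ≤ (n : ℝ)⁻¹)]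
        gcongr
        exact Finset.abs_sum_le_sum_abs _ _
    _ ≤ (n : ℝ)⁻¹ * (S.card * C) := by
        gcongr
        simpa using Finset.sum_le_card_nsmul _ _ _ hx
    _ = (n : ℝ)⁻¹ * S.card * C := by ring
    _ ≤ C := mul_le_of_le_one_left hC hcard

lemma hasDerivAt_mixDensity (z : ℝ) : HasDerivAt (mixDensity v) (mixSlope v z) z := by
  refine HasDerivAt.const_mul _ (HasDerivAt.fun_sum fun i _ => ?_)
  convert! (hasDerivAt_stdPDF (z - v i)).comp z ((hasDerivAt_id z).sub_const (v i)) using 1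
  simp

lemma oracle_eq (z : ℝ) : oracle v z = z + mixSlope v z / mixDensity v z := by
  rw [oracle, (hasDerivAt_mixDensity v z).deriv]

lemma continuous_mixOn_uncurry :
    Continuous fun p : (Fin n → ℝ) × ℝ => mixOn S p.1 p.2 := by
  unfold mixOn
  have := continuous_stdPDF
  fun_prop

lemma continuous_mixSlope_uncurry :
    Continuous fun p : (Fin n → ℝ) × ℝ => mixSlope p.1 p.2 := by
  unfold mixSlope
  have := continuous_stdPDF
  fun_prop

lemma continuous_mixOn : Continuous (mixOn S v) :=
  (continuous_mixOn_uncurry S).along_snd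

lemma continuous_mixDensity : Continuous (mixDensity v) := continuous_mixOn Finset.univ v

lemma continuous_mixSlope : Continuous (mixSlope v) :=
  continuous_mixSlope_uncurry.along_snd

lemma mixOn_nonneg (z : ℝ) : 0 ≤ mixOn S v z :=
  mul_nonneg (by positivity) (Finset.sum_nonneg fun _ _ => stdPDF_nonneg _)

lemma mixOn_le_mixDensity (z : ℝ) : mixOn S v z ≤ mixDensity v z :=
  mul_le_mul_of_nonneg_left (Finset.sum_le_sum_of_subset_of_nonneg (Finset.subset_univ S)
    fun _ _ _ => stdPDF_nonneg _) (by positivity)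

lemma mixDensity_nonneg (z : ℝ) : 0 ≤ mixDensity v z := mixOn_nonneg Finset.univ v z

lemma mixDensity_pos (hn : 0 < n) (z : ℝ) : 0 < mixDensity v z := by
  have : Nonempty (Fin n) := ⟨⟨0, hn⟩⟩
  exact mul_pos (by positivity) (Finset.sum_pos (fun _ _ => stdPDF_pos _) Finset.univ_nonempty)

lemma mixSq_nonneg (z : ℝ) : 0 ≤ mixSq v z :=
  mul_nonneg (by positivity) (Finset.sum_nonneg fun _ _ =>
    mul_nonneg (sq_nonneg _) (stdPDF_nonneg _))

lemma sq_mixSlope_le (z : ℝ) : mixSlope v z ^ 2 ≤ mixDensity v z * mixSq v z := by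
  have h := Finset.sum_sq_le_sum_mul_sum_of_sq_le_mul (Finset.univ : Finset (Fin n))
    (r := fun i => -((z - v i) * φ (z - v i))) (f := fun i => φ (z - v i))
    (g := fun i => (z - v i) ^ 2 * φ (z - v i)) (fun i _ => stdPDF_nonneg _)
    (fun i _ => mul_nonneg (sq_nonneg _) (stdPDF_nonneg _)) (fun i _ => le_of_eq (by ring))
  rw [mixSlope, mixDensity, mixSq, mul_pow, mul_mul_mul_comm, ← sq]
  gcongr

lemma integrable_mixOn : Integrable (mixOn S v) :=
  (integrable_finsetSum _ fun i _ => integrable_stdPDF.comp_sub_right (v i)).const_mul _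

lemma integrable_mixDensity : Integrable (mixDensity v) := integrable_mixOn Finset.univ v

lemma integrable_mixSlope : Integrable (mixSlope v) :=
  (integrable_finsetSum _ fun i _ =>
    (integrable_mul_stdPDF.comp_sub_right (v i)).neg).const_mul _

lemma integrable_mixSq : Integrable (mixSq v) :=
  (integrable_finsetSum _ fun i _ => integrable_sq_mul_stdPDF.comp_sub_right (v i)).const_mul _

lemma integrable_mul_mixDensity : Integrable fun z => z * mixDensity v z := by
  have h : (fun z => z * mixDensity v z) = fun z => (n : ℝ)⁻¹ *
      ∑ i, ((z - v i) * φ (z - v i) + v i * φ (z - v i)) := by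
    ext z
    rw [mixDensity, mul_left_comm, Finset.mul_sum]
    simp only [← add_mul, sub_add_cancel]
  rw [h]
  exact (integrable_finsetSum _ fun i _ => (integrable_mul_stdPDF.comp_sub_right (v i)).add
    ((integrable_stdPDF.comp_sub_right (v i)).const_mul _)).const_mul _

lemma integral_mixDensity (hn : 0 < n) : ∫ z, mixDensity v z = 1 := by
  unfold mixDensity
  rw [integral_const_mul, integral_finsetSum _ fun i _ => integrable_stdPDF.comp_sub_right (v i)]
  simp_rw [integral_sub_right_eq_self φ, integral_stdPDF]
  simp [hn.ne']

lemma integral_mixSq_le : ∫ z, mixSq v z ≤ 1 := by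
  unfold mixSq
  rw [integral_const_mul,
    integral_finsetSum _ fun i _ => integrable_sq_mul_stdPDF.comp_sub_right (v i)]
  simp_rw [integral_sub_right_eq_self fun x : ℝ => x ^ 2 * φ x, integral_sq_mul_stdPDF]
  simpa using mul_le_of_le_one_left zero_le_one (inv_mul_le_one (a := (n : ℝ)))

end Mixture

lemma integrable_sqrt_mul_sqrt {X : Type*} [MeasurableSpace X] {m : Measure X} {f g : X → ℝ}
    (hf : ∀ x, 0 ≤ f x) (hg : ∀ x, 0 ≤ g x) (hfi : Integrable f m) (hgi : Integrable g m) :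
    Integrable (fun x => √(f x) * √(g x)) m :=
  (hfi.add hgi).mono' (hfi.1.aemeasurable.sqrt.mul hgi.1.aemeasurable.sqrt).aestronglyMeasurable
    (ae_of_all _ fun x => by
      rw [Real.norm_of_nonneg (by positivity), Pi.add_apply]
      nlinarith [sq_nonneg (√(f x) - √(g x)), Real.sq_sqrt (hf x), Real.sq_sqrt (hg x), hf x, hg x])

lemma integral_sqrt_mul_sqrt_le {X : Type*} [MeasurableSpace X] {m : Measure X} {f g : X → ℝ}
    (hf : ∀ x, 0 ≤ f x) (hg : ∀ x, 0 ≤ g x) (hfi : Integrable f m) (hgi : Integrable g m) :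
    ∫ x, √(f x) * √(g x) ∂m ≤ √(∫ x, f x ∂m) * √(∫ x, g x ∂m) := by
  have memLp_sqrt : ∀ {h : X → ℝ}, (∀ x, 0 ≤ h x) → Integrable h m →
      MemLp (fun x => √(h x)) (ENNReal.ofReal 2) m := fun hh hhi => by
    rw [ENNReal.ofReal_ofNat,
      memLp_two_iff_integrable_sq hhi.1.aemeasurable.sqrt.aestronglyMeasurable]
    simpa only [Real.sq_sqrt (hh _)] using hhi
  have h := integral_mul_le_Lp_mul_Lq_of_nonneg Real.HolderConjugate.two_two
    (ae_of_all _ fun x => Real.sqrt_nonneg (f x)) (ae_of_all _ fun x => Real.sqrt_nonneg (g x))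
    (memLp_sqrt hf hfi) (memLp_sqrt hg hgi)
  simpa only [Real.rpow_two, Real.sq_sqrt (hf _), Real.sq_sqrt (hg _), ← Real.sqrt_eq_rpow] using h

/-- The Fourier transform of a real function, normalized like a characteristic function. -/
noncomputable def fourierInt (h : ℝ → ℝ) (t : ℝ) : ℂ :=
  ∫ z, (h z : ℂ) * Complex.exp (t * z * Complex.I)

lemma norm_exp_mul_mul_I (t z : ℝ) : ‖Complex.exp (t * z * Complex.I)‖ = 1 := by
  exact_mod_cast Complex.norm_exp_ofReal_mul_I (t * z)

lemma norm_fourierInt_le (h : ℝ → ℝ) (t : ℝ) : ‖fourierInt h t‖ ≤ ∫ z, |h z| := by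
  refine (norm_integral_le_integral_norm _).trans_eq (integral_congr_ae (ae_of_all _ fun z => ?_))
  simp [norm_exp_mul_mul_I]

lemma integrable_mul_exp {h : ℝ → ℝ} (hh : Integrable h) (t : ℝ) :
    Integrable fun z => (h z : ℂ) * Complex.exp (t * z * Complex.I) :=
  hh.ofReal.mul_bdd (c := 1) (Continuous.aestronglyMeasurable (by fun_prop))
    (ae_of_all _ fun z => (norm_exp_mul_mul_I t z).le)

lemma fourierInt_add {h k : ℝ → ℝ} (hh : Integrable h) (hk : Integrable k) (t : ℝ) :
    fourierInt (fun z => h z + k z) t = fourierInt h t + fourierInt k t := by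
  simp only [fourierInt, Complex.ofReal_add, add_mul]
  exact integral_add (integrable_mul_exp hh t) (integrable_mul_exp hk t)

lemma fourierInt_sub {h k : ℝ → ℝ} (hh : Integrable h) (hk : Integrable k) (t : ℝ) :
    fourierInt (fun z => h z - k z) t = fourierInt h t - fourierInt k t := by
  simp only [fourierInt, Complex.ofReal_sub, sub_mul]
  exact integral_sub (integrable_mul_exp hh t) (integrable_mul_exp hk t)

lemma fourierInt_const_mul (c : ℝ) (h : ℝ → ℝ) (t : ℝ) :
    fourierInt (fun z => c * h z) t = c * fourierInt h t := by
  simp only [fourierInt, Complex.ofReal_mul, mul_assoc]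
  exact integral_const_mul _ _

lemma fourierInt_zero (h : ℝ → ℝ) : fourierInt h 0 = ((∫ z, h z : ℝ) : ℂ) := by
  simp [fourierInt, integral_complex_ofReal]

lemma hasDerivAt_fourierInt {h : ℝ → ℝ} (hh : Integrable h) (hz : Integrable fun z => z * h z)
    (t : ℝ) :
    HasDerivAt (fourierInt h) (Complex.I * fourierInt (fun z => z * h z) t) t := by
  have hderiv : ∀ z s : ℝ, HasDerivAt (fun s : ℝ => (h z : ℂ) * Complex.exp (s * z * Complex.I))
      (Complex.I * (((z * h z : ℝ) : ℂ) * Complex.exp (s * z * Complex.I))) s := fun z s => by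
    have hlin : HasDerivAt (fun s : ℝ => (s : ℂ) * z * Complex.I) (z * Complex.I) s := by
      simpa using (Complex.ofRealCLM.hasDerivAt (x := s)).mul_const (z * Complex.I : ℂ)
        |>.congr_of_eventuallyEq (Eventually.of_forall fun s => by simp [mul_assoc])
    convert! hlin.cexp.const_mul (h z : ℂ) using 1
    push_cast; ring
  have := (hasDerivAt_integral_of_dominated_loc_of_deriv_le (x₀ := t) univ_mem
    (Eventually.of_forall fun s => (integrable_mul_exp hh s).1) (integrable_mul_exp hh t)
    ((integrable_mul_exp hz t).const_mul Complex.I).1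
    (ae_of_all _ fun z s _ => by simp [norm_exp_mul_mul_I]) hz.norm
    (ae_of_all _ fun z s _ => hderiv z s)).2
  rwa [integral_const_mul] at this

lemma fourierInt_of_hasDerivAt {h h' : ℝ → ℝ} (hderiv : ∀ z, HasDerivAt h (h' z) z)
    (hh : Integrable h) (hh' : Integrable h') (t : ℝ) :
    fourierInt h' t = -(Complex.I * t * fourierInt h t) := by
  have hexp : ∀ z : ℝ, HasDerivAt (fun z : ℝ => Complex.exp (t * z * Complex.I))
      (Complex.exp (t * z * Complex.I) * (Complex.I * t)) z := fun z => by
    have hlin : HasDerivAt (fun z : ℝ => (t : ℂ) * z * Complex.I) (Complex.I * t) z := by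
      simpa [mul_comm] using (Complex.ofRealCLM.hasDerivAt (x := z)).const_mul (Complex.I * t : ℂ)
        |>.congr_of_eventuallyEq (Eventually.of_forall fun z => by simp; ring)
    exact hlin.cexp
  have hparts := integral_mul_deriv_eq_deriv_mul_of_integrable
    (fun z _ => hexp z) (fun z _ => (hderiv z).ofReal_comp)
    (by simpa only [Pi.mul_def, mul_comm] using integrable_mul_exp hh' t)
    (by simpa only [Pi.mul_def, mul_comm, mul_left_comm, mul_assoc] using
      (integrable_mul_exp hh t).const_mul (Complex.I * t))
    (by simpa only [Pi.mul_def, mul_comm] using integrable_mul_exp hh t)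
  rw [fourierInt, fourierInt, ← integral_const_mul]
  simpa only [mul_comm, mul_left_comm, mul_assoc] using hparts

/-- The comparison function of Grönwall type is `B s = (2 r / t) (exp (s t / 2 a) - 1)`: it
dominates `exp (s² / 2 a) u s - u 0` because `s² ≤ s t`. -/
lemma norm_sub_mul_exp_le {u u' : ℝ → ℂ} {a r t : ℝ} (ha : 0 < a) (ht : 0 < t)
    (hderiv : ∀ s, HasDerivAt u (u' s) s)
    (hbound : ∀ s ∈ Set.Icc 0 t, ‖s * u s + a * u' s‖ ≤ r) :
    ‖u t - u 0 * Real.exp (-t ^ 2 / (2 * a))‖ ≤ 2 * r / t := by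
  let w : ℝ → ℂ := fun s => Real.exp (s ^ 2 / (2 * a)) * u s - u 0
  let w' : ℝ → ℂ := fun s => Real.exp (s ^ 2 / (2 * a)) / a * (s * u s + a * u' s)
  let B : ℝ → ℝ := fun s => 2 * r / t * (Real.exp (s * t / (2 * a)) - 1)
  have hr : 0 ≤ r := (norm_nonneg _).trans (hbound 0 ⟨le_rfl, ht.le⟩)
  have hw : ∀ s, HasDerivAt w (w' s) s := fun s => by
    have hexp := (((hasDerivAt_pow 2 s).div_const (2 * a)).exp).ofReal_comp
    convert! (hexp.mul (hderiv s)).sub_const (u 0) using 1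
    have : (a : ℂ) ≠ 0 := by exact_mod_cast ha.ne'
    simp only [w']
    push_cast
    field_simp
  have hB : ∀ s, HasDerivAt B (r / a * Real.exp (s * t / (2 * a))) s := fun s => by
    have hlin := ((hasDerivAt_id s).mul_const t).div_const (2 * a)
    convert! (hlin.exp.sub_const 1).const_mul (2 * r / t) using 1
    simp only [id]
    field_simp
  have hw' : ∀ s ∈ Set.Ico 0 t, ‖w' s‖ ≤ r / a * Real.exp (s * t / (2 * a)) := fun s hs => by
    rw [norm_mul, norm_div, Complex.norm_real, Complex.norm_real, Real.norm_of_nonneg ha.le,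
      Real.norm_of_nonneg (Real.exp_pos _).le, div_mul_eq_mul_div, mul_comm, div_mul_eq_mul_div]
    gcongr
    · exact hbound s ⟨hs.1, hs.2.le⟩
    · nlinarith [hs.1, hs.2]
  have hwB : ‖w t‖ ≤ B t := image_norm_le_of_norm_deriv_right_le_deriv_boundary
    (fun s _ => (hw s).continuousAt.continuousWithinAt) (fun s _ => (hw s).hasDerivWithinAt)
    (by simp [w, B]) hB hw' (Set.right_mem_Icc.2 ht.le)
  have hcancel : Real.exp (-t ^ 2 / (2 * a)) * Real.exp (t ^ 2 / (2 * a)) = 1 := by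
    rw [← Real.exp_add]; simp [neg_div]
  have hu : u t - u 0 * Real.exp (-t ^ 2 / (2 * a)) = Real.exp (-t ^ 2 / (2 * a)) * w t := by
    simp only [w, mul_sub, ← mul_assoc, ← Complex.ofReal_mul, hcancel]
    push_cast; ring
  calc ‖u t - u 0 * Real.exp (-t ^ 2 / (2 * a))‖ = Real.exp (-t ^ 2 / (2 * a)) * ‖w t‖ := by
        rw [hu, norm_mul, Complex.norm_real, Real.norm_of_nonneg (Real.exp_pos _).le]
    _ ≤ Real.exp (-t ^ 2 / (2 * a)) * (2 * r / t * Real.exp (t ^ 2 / (2 * a))) := by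
        gcongr
        refine hwB.trans (mul_le_mul_of_nonneg_left ?_ (by positivity))
        rw [sq]; linarith
    _ = 2 * r / t := by rw [mul_left_comm, hcancel, mul_one]

lemma isProbabilityMeasure_empirical {n : ℕ} (hn : 0 < n) (v : Fin n → ℝ) :
    IsProbabilityMeasure (empirical v) :=
  ⟨by simp [empirical, ENNReal.inv_mul_cancel, hn.ne']⟩

lemma integral_empirical {n : ℕ} {E : Type*} [NormedAddCommGroup E] [NormedSpace ℝ E]
    [CompleteSpace E] (v : Fin n → ℝ) (g : ℝ → E) :
    ∫ x, g x ∂(empirical v) = (n : ℝ)⁻¹ • ∑ i, g (v i) := by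
  rw [empirical, integral_smul_measure,
    integral_finsetSum_measure fun i _ => integrable_dirac (by simp)]
  simp

lemma charFun_stdGaussian (t : ℝ) : charFun γ t = Real.exp (-t ^ 2 / 2) := by
  rw [charFun_gaussianReal]
  push_cast
  congr 1
  simp
  ring

lemma fourierInt_stdPDF (t : ℝ) : fourierInt φ t = Real.exp (-t ^ 2 / 2) := by
  rw [← charFun_stdGaussian, charFun_apply_real,
    integral_gaussianReal_eq_integral_smul one_ne_zero]
  simp only [fourierInt, Complex.real_smul]

lemma fourierInt_comp_sub (h : ℝ → ℝ) (x t : ℝ) :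
    fourierInt (fun z => h (z - x)) t = Complex.exp (t * x * Complex.I) * fourierInt h t := by
  rw [fourierInt, fourierInt, ← integral_const_mul,
    ← integral_sub_right_eq_self (fun z : ℝ => _ * ((h z : ℂ) * _)) x]
  congr 1 with z
  rw [mul_left_comm, ← Complex.exp_add]
  congr 2
  push_cast; ring

section Minorant

variable {n : ℕ} {v : Fin n → ℝ} {θ : ℝ → ℝ} {a : ℝ}

lemma fourierInt_mixDensity (v : Fin n → ℝ) (t : ℝ) :
    fourierInt (mixDensity v) t = charFun (empirical v) t * Real.exp (-t ^ 2 / 2) := by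
  have hint := fun i => integrable_mul_exp (integrable_stdPDF.comp_sub_right (v i)) t
  have hsum : fourierInt (mixDensity v) t
      = (n : ℝ)⁻¹ * ∑ i, fourierInt (fun z => φ (z - v i)) t := by
    unfold mixDensity
    rw [fourierInt_const_mul]
    simp only [fourierInt, Complex.ofReal_sum, Finset.sum_mul]
    rw [integral_finsetSum _ fun i _ => hint i]
  rw [hsum, charFun_apply_real, integral_empirical]
  simp only [fourierInt_comp_sub, fourierInt_stdPDF, ← Finset.sum_mul, Complex.real_smul, mul_assoc]

/-- The defect `f' / f + a z` of the logarithmic derivative of the mixture density `f` from that of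
`N(0, 1 / a)`, whose Fourier transform solves the equation `t u + a u' = 0`. -/
noncomputable def scoreDefect (v : Fin n → ℝ) (a z : ℝ) : ℝ :=
  mixSlope v z / mixDensity v z + a * z

/-- A measurable function between `0` and the mixture density: the part of the mixture on which the
score defect is under control. -/
structure IsMinorant (v : Fin n → ℝ) (θ : ℝ → ℝ) : Prop where
  measurable : Measurable θ
  nonneg : ∀ z, 0 ≤ θ z
  le : ∀ z, θ z ≤ mixDensity v z

namespace IsMinorant

lemma integrable (hθ : IsMinorant v θ) : Integrable θ :=
  (integrable_mixDensity v).mono' hθ.measurable.aestronglyMeasurable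
    (ae_of_all _ fun z => by rw [Real.norm_of_nonneg (hθ.nonneg z)]; exact hθ.le z)

lemma integrable_mul (hθ : IsMinorant v θ) : Integrable fun z => z * θ z :=
  (integrable_mul_mixDensity v).mono (measurable_id.mul hθ.measurable).aestronglyMeasurable
    (ae_of_all _ fun z => by
      rw [norm_mul, norm_mul, Real.norm_of_nonneg (hθ.nonneg z),
        Real.norm_of_nonneg (mixDensity_nonneg v z)]
      exact mul_le_mul_of_nonneg_left (hθ.le z) (norm_nonneg _))

lemma integral_le_one (hn : 0 < n) (hθ : IsMinorant v θ) : ∫ z, θ z ≤ 1 :=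
  integral_mixDensity v hn ▸ integral_mono hθ.integrable (integrable_mixDensity v) hθ.le

lemma mixDensity_sub (hθ : IsMinorant v θ) : IsMinorant v fun z => mixDensity v z - θ z where
  measurable := (continuous_mixDensity v).measurable.sub hθ.measurable
  nonneg z := sub_nonneg.2 (hθ.le z)
  le z := sub_le_self _ (hθ.nonneg z)

lemma integral_mixDensity_sub (hn : 0 < n) (hθ : IsMinorant v θ) :
    ∫ z, (mixDensity v z - θ z) = 1 - ∫ z, θ z := by
  rw [integral_sub (integrable_mixDensity v) hθ.integrable, integral_mixDensity v hn]

lemma abs_mixSlope_div_mul_le (hn : 0 < n) (hθ : IsMinorant v θ) (z : ℝ) :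
    |mixSlope v z / mixDensity v z * θ z| ≤ √(mixSq v z) * √(θ z) := by
  have hf := mixDensity_pos v hn z
  rw [← Real.sqrt_mul (mixSq_nonneg v z)]
  refine Real.abs_le_sqrt ?_
  have h0 := hθ.nonneg z
  calc (mixSlope v z / mixDensity v z * θ z) ^ 2
      = mixSlope v z ^ 2 * θ z * (θ z / mixDensity v z ^ 2) := by ring
    _ ≤ mixDensity v z * mixSq v z * θ z * (mixDensity v z / mixDensity v z ^ 2) := by
        have := mixSq_nonneg v z
        gcongr
        exacts [sq_mixSlope_le v z, hθ.le z]
    _ = mixSq v z * θ z := by field_simp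

lemma integrable_mixSlope_div_mul (hn : 0 < n) (hθ : IsMinorant v θ) :
    Integrable fun z => mixSlope v z / mixDensity v z * θ z :=
  (integrable_sqrt_mul_sqrt (mixSq_nonneg v) hθ.nonneg (integrable_mixSq v) hθ.integrable).mono'
    (((continuous_mixSlope v).measurable.div (continuous_mixDensity v).measurable).mul
      hθ.measurable).aestronglyMeasurable
    (ae_of_all _ (hθ.abs_mixSlope_div_mul_le hn))

/-- This is where the Fisher information of the mixture being at most `1` enters. -/
lemma integral_abs_mixSlope_div_mul_le (hn : 0 < n) (hθ : IsMinorant v θ) :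
    ∫ z, |mixSlope v z / mixDensity v z * θ z| ≤ √(∫ z, θ z) :=
  calc ∫ z, |mixSlope v z / mixDensity v z * θ z| ≤ ∫ z, √(mixSq v z) * √(θ z) :=
        integral_mono (hθ.integrable_mixSlope_div_mul hn).abs
          (integrable_sqrt_mul_sqrt (mixSq_nonneg v) hθ.nonneg (integrable_mixSq v) hθ.integrable)
          (hθ.abs_mixSlope_div_mul_le hn)
    _ ≤ √(∫ z, mixSq v z) * √(∫ z, θ z) :=
        integral_sqrt_mul_sqrt_le (mixSq_nonneg v) hθ.nonneg (integrable_mixSq v) hθ.integrable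
    _ ≤ √(∫ z, θ z) :=
        mul_le_of_le_one_left (Real.sqrt_nonneg _) (Real.sqrt_le_one.2 (integral_mixSq_le v))

lemma integrable_scoreDefect_mul (hn : 0 < n) (hθ : IsMinorant v θ) :
    Integrable fun z => scoreDefect v a z * θ z := by
  simp only [scoreDefect, add_mul, mul_assoc]
  exact (hθ.integrable_mixSlope_div_mul hn).add (hθ.integrable_mul.const_mul a)

lemma norm_fourierInt_mixDensity_sub_le (hn : 0 < n) (hθ : IsMinorant v θ) (t : ℝ) :
    ‖fourierInt (mixDensity v) t - fourierInt θ t‖ ≤ 1 - ∫ z, θ z := by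
  rw [← fourierInt_sub (integrable_mixDensity v) hθ.integrable,
    ← hθ.integral_mixDensity_sub hn]
  refine (norm_fourierInt_le _ t).trans_eq ?_
  simp only [abs_of_nonneg (hθ.mixDensity_sub.nonneg _)]

lemma norm_mul_fourierInt_add_le (hn : 0 < n) (hθ : IsMinorant v θ) (t : ℝ) :
    ‖t * fourierInt θ t + a * (Complex.I * fourierInt (fun z => z * θ z) t)‖
      ≤ ((∫ z, |scoreDefect v a z * θ z|) + √(1 - ∫ z, θ z)) + |t| * (1 - ∫ z, θ z) := by
  set h : ℝ → ℝ := fun z => scoreDefect v a z * θ z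
  set k : ℝ → ℝ := fun z => mixSlope v z / mixDensity v z * (mixDensity v z - θ z)
  have hh : Integrable h := hθ.integrable_scoreDefect_mul hn
  have hk : Integrable k := hθ.mixDensity_sub.integrable_mixSlope_div_mul hn
  have hsplit : (fun z => mixSlope v z + a * (z * θ z)) = fun z => h z + k z := by
    ext z
    have := (mixDensity_pos v hn z).ne'
    simp only [h, k, scoreDefect]
    field_simp
    ring
  have hfour : -(Complex.I * t * fourierInt (mixDensity v) t) + a * fourierInt (fun z => z * θ z) t
      = fourierInt h t + fourierInt k t := by
    rw [← fourierInt_add hh hk, ← hsplit, fourierInt_add (integrable_mixSlope v)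
      (hθ.integrable_mul.const_mul a), fourierInt_const_mul,
      fourierInt_of_hasDerivAt (hasDerivAt_mixDensity v) (integrable_mixDensity v)
        (integrable_mixSlope v)]
  have hrepr : t * fourierInt θ t + a * (Complex.I * fourierInt (fun z => z * θ z) t)
      = Complex.I * (fourierInt h t + fourierInt k t)
        - t * (fourierInt (mixDensity v) t - fourierInt θ t) := by
    rw [← hfour]
    linear_combination ((t : ℂ) * fourierInt (mixDensity v) t) * Complex.I_mul_I
  rw [hrepr]
  refine (norm_sub_le _ _).trans (add_le_add ?_ ?_)
  · rw [norm_mul, Complex.norm_I, one_mul]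
    refine (norm_add_le _ _).trans (add_le_add (norm_fourierInt_le h t)
      ((norm_fourierInt_le k t).trans ?_))
    rw [← hθ.integral_mixDensity_sub hn]
    exact hθ.mixDensity_sub.integral_abs_mixSlope_div_mul_le hn
  · rw [norm_mul, Complex.norm_real, Real.norm_eq_abs]
    exact mul_le_mul_of_nonneg_left (hθ.norm_fourierInt_mixDensity_sub_le hn t) (abs_nonneg t)

lemma norm_fourierInt_mixDensity_sub_exp_le (hn : 0 < n) (hθ : IsMinorant v θ) (ha : 0 < a)
    {t : ℝ} (ht : 0 < t) :
    ‖fourierInt (mixDensity v) t - Real.exp (-t ^ 2 / (2 * a))‖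
      ≤ 2 / t * ((∫ z, |scoreDefect v a z * θ z|) + √(1 - ∫ z, θ z)) + 4 * (1 - ∫ z, θ z) := by
  set m := 1 - ∫ z, θ z
  set r := (∫ z, |scoreDefect v a z * θ z|) + √m
  set E := Real.exp (-t ^ 2 / (2 * a))
  have hm : 0 ≤ m := sub_nonneg.2 (hθ.integral_le_one hn)
  have hode : ‖fourierInt θ t - fourierInt θ 0 * E‖ ≤ 2 * (r + t * m) / t :=
    norm_sub_mul_exp_le ha ht
      (fun s => hasDerivAt_fourierInt hθ.integrable hθ.integrable_mul s) fun s hs =>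
        (hθ.norm_mul_fourierInt_add_le hn s).trans (by
          rw [abs_of_nonneg hs.1]
          gcongr
          exact hs.2)
  have hinit : ‖(fourierInt θ 0 - 1) * (E : ℂ)‖ ≤ m := by
    rw [norm_mul, fourierInt_zero, ← Complex.ofReal_one, ← Complex.ofReal_sub, Complex.norm_real,
      Complex.norm_real, Real.norm_of_nonneg (Real.exp_pos _).le, ← neg_sub, norm_neg,
      Real.norm_of_nonneg hm]
    exact mul_le_of_le_one_right hm (Real.exp_le_one_iff.2
      (div_nonpos_of_nonpos_of_nonneg (by nlinarith) (by positivity)))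
  calc ‖fourierInt (mixDensity v) t - E‖
      = ‖(fourierInt (mixDensity v) t - fourierInt θ t) + (fourierInt θ t - fourierInt θ 0 * E)
          + (fourierInt θ 0 - 1) * E‖ := by congr 1; ring
    _ ≤ m + 2 * (r + t * m) / t + m := by
        refine (norm_add₃_le).trans ?_
        gcongr
        exact hθ.norm_fourierInt_mixDensity_sub_le hn t
    _ = 2 / t * r + 4 * m := by field_simp; ring

lemma norm_charFun_empirical_sub_le_of_pos (hn : 0 < n) (hθ : IsMinorant v θ)
    (ha : a ∈ Set.Ioo 0 1) {t : ℝ} (ht : 0 < t) :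
    ‖charFun (empirical v) t - charFun (gaussianReal 0 (Real.toNNReal ((1 - a) / a))) t‖
      ≤ Real.exp (t ^ 2 / 2) *
        (2 / t * ((∫ z, |scoreDefect v a z * θ z|) + √(1 - ∫ z, θ z)) + 4 * (1 - ∫ z, θ z)) := by
  set D := charFun (empirical v) t - charFun (gaussianReal 0 (Real.toNNReal ((1 - a) / a))) t
  have ha0 : (a : ℂ) ≠ 0 := by exact_mod_cast ha.1.ne'
  have hvar : ((Real.toNNReal ((1 - a) / a) : ℝ) : ℂ) = ((1 - a) / a : ℝ) := by
    rw [Real.coe_toNNReal _ (div_nonneg (sub_nonneg.2 ha.2.le) ha.1.le)]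
  have hgauss : charFun (gaussianReal 0 (Real.toNNReal ((1 - a) / a))) t * Real.exp (-t ^ 2 / 2)
      = Real.exp (-t ^ 2 / (2 * a)) := by
    rw [charFun_gaussianReal, hvar]
    push_cast
    rw [← Complex.exp_add]
    congr 1
    field_simp
    ring
  have hcancel : Real.exp (t ^ 2 / 2) * Real.exp (-t ^ 2 / 2) = 1 := by
    rw [← Real.exp_add]; simp [neg_div]
  have hD : fourierInt (mixDensity v) t - Real.exp (-t ^ 2 / (2 * a))
      = D * Real.exp (-t ^ 2 / 2) := by
    rw [fourierInt_mixDensity, ← hgauss, ← sub_mul]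
  have hnorm := hθ.norm_fourierInt_mixDensity_sub_exp_le hn ha.1 ht
  rw [hD, norm_mul, Complex.norm_real, Real.norm_of_nonneg (Real.exp_pos _).le] at hnorm
  calc ‖D‖ = Real.exp (t ^ 2 / 2) * (‖D‖ * Real.exp (-t ^ 2 / 2)) := by
        rw [mul_left_comm, hcancel, mul_one]
    _ ≤ _ := by gcongr

lemma norm_charFun_empirical_sub_le (hn : 0 < n) (hθ : IsMinorant v θ)
    (ha : a ∈ Set.Ioo 0 1) {t : ℝ} (ht : t ≠ 0) :
    ‖charFun (empirical v) t - charFun (gaussianReal 0 (Real.toNNReal ((1 - a) / a))) t‖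
      ≤ Real.exp (t ^ 2 / 2) *
        (2 / |t| * ((∫ z, |scoreDefect v a z * θ z|) + √(1 - ∫ z, θ z)) + 4 * (1 - ∫ z, θ z)) := by
  rcases ht.lt_or_gt with h | h
  · have := hθ.norm_charFun_empirical_sub_le_of_pos hn ha (neg_pos.2 h)
    rwa [charFun_neg, charFun_neg, ← map_sub, RCLike.norm_conj, neg_sq, ← abs_of_neg h] at this
  · simpa only [abs_of_pos h] using hθ.norm_charFun_empirical_sub_le_of_pos hn ha h

end IsMinorant

end Minorant

open FourierTransform SchwartzMap in
lemma integral_schwartzMap_eq {E : Type*} [NormedAddCommGroup E] [InnerProductSpace ℝ E]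
    [FiniteDimensional ℝ E] [MeasurableSpace E] [BorelSpace E] (g : 𝓢(E, ℂ)) (p : Measure E)
    [IsProbabilityMeasure p] :
    ∫ x, g x ∂p = ∫ ξ, charFun p (-(2 * Real.pi) • ξ) * 𝓕⁻ g ξ := by
  have hchar : ∀ ξ : E, charFun p (-(2 * Real.pi) • ξ)
      = VectorFourier.fourierIntegral Real.fourierChar p (innerₗ E) 1 ξ := fun ξ => by
    rw [charFun_eq_fourierIntegral', smul_smul, neg_mul_neg,
      inv_mul_cancel₀ (by positivity), one_smul]
  have hg : ∀ x, VectorFourier.fourierIntegral Real.fourierChar volume (innerₗ E).flip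
      (𝓕⁻ g : 𝓢(E, ℂ)) x = g x := fun x => by
    rw [flip_innerₗ]
    exact congr_fun ((fourier_coe _).symm.trans (congr_arg (⇑) (fourier_fourierInv_eq g))) x
  have hone : Integrable (1 : E → ℂ) p := integrable_const 1
  have hfubini := VectorFourier.integral_fourierIntegral_smul_eq_flip (L := innerₗ E)
    Real.continuous_fourierChar (by exact continuous_inner) hone
    ((𝓕⁻ g : 𝓢(E, ℂ)).integrable (μ := volume))
  simpa only [hg, ← hchar, Pi.one_apply, smul_eq_mul, one_mul] using hfubini.symm

section WeakConvergence

variable {ι : Type*} {l : Filter ι} {p q : ι → Measure ℝ}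

lemma tendsto_integral_sub_of_forall_approx {g : ℝ → ℝ}
    (happrox : ∀ e > 0, ∃ h : ℝ → ℝ,
      (∀ᶠ i in l, |∫ x, g x ∂(p i) - ∫ x, h x ∂(p i)| ≤ e) ∧
      (∀ᶠ i in l, |∫ x, g x ∂(q i) - ∫ x, h x ∂(q i)| ≤ e) ∧
      Tendsto (fun i => ∫ x, h x ∂(p i) - ∫ x, h x ∂(q i)) l (𝓝 0)) :
    Tendsto (fun i => ∫ x, g x ∂(p i) - ∫ x, g x ∂(q i)) l (𝓝 0) := by
  refine Metric.tendsto_nhds.2 fun e he => ?_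
  obtain ⟨h, hp, hq, hlim⟩ := happrox (e / 3) (by positivity)
  filter_upwards [hp, hq, Metric.tendsto_nhds.1 hlim (e / 3) (by positivity)] with i hpi hqi hi
  rw [Real.dist_0_eq_abs] at hi ⊢
  rw [abs_le] at hpi hqi
  rw [abs_lt] at hi ⊢
  constructor <;> linarith [hpi.1, hpi.2, hqi.1, hqi.2, hi.1, hi.2]

variable [∀ i, IsProbabilityMeasure (p i)] [∀ i, IsProbabilityMeasure (q i)]

open FourierTransform SchwartzMap in
lemma tendsto_integral_schwartzMap_sub {E : Type*} [NormedAddCommGroup E] [InnerProductSpace ℝ E]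
    [FiniteDimensional ℝ E] [MeasurableSpace E] [BorelSpace E] [l.IsCountablyGenerated]
    {p q : ι → Measure E} [∀ i, IsProbabilityMeasure (p i)] [∀ i, IsProbabilityMeasure (q i)]
    (h : ∀ t, Tendsto (fun i => charFun (p i) t - charFun (q i) t) l (𝓝 0)) (g : 𝓢(E, ℂ)) :
    Tendsto (fun i => ∫ x, g x ∂(p i) - ∫ x, g x ∂(q i)) l (𝓝 0) := by
  have hmeas : ∀ (m : Measure E) [IsProbabilityMeasure m],
      Measurable fun ξ => charFun m (-(2 * Real.pi) • ξ) := fun m _ =>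
    measurable_charFun.comp (measurable_const_smul _)
  have hint : ∀ (m : Measure E) [IsProbabilityMeasure m],
      Integrable fun ξ => charFun m (-(2 * Real.pi) • ξ) * 𝓕⁻ g ξ := fun m _ =>
    (𝓕⁻ g).integrable.bdd_mul (c := 1) (hmeas m).aestronglyMeasurable
      (ae_of_all _ fun _ => norm_charFun_le_one _)
  simp only [integral_schwartzMap_eq]
  simp only [← integral_sub (hint _) (hint _), ← sub_mul]
  rw [← integral_zero E ℂ (μ := volume)]
  refine tendsto_integral_filter_of_dominated_convergence (fun ξ => 2 * ‖𝓕⁻ g ξ‖)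
    (Eventually.of_forall fun i => (((hmeas (p i)).sub (hmeas (q i))).mul
      (𝓕⁻ g).continuous.measurable).aestronglyMeasurable)
    (Eventually.of_forall fun i => ae_of_all _ fun ξ => ?_)
    ((𝓕⁻ g).integrable.norm.const_mul 2) (ae_of_all _ fun ξ => ?_)
  · rw [norm_mul, ← one_add_one_eq_two]
    gcongr
    exact (norm_sub_le _ _).trans (add_le_add (norm_charFun_le_one _) (norm_charFun_le_one _))
  · simpa using (h (-(2 * Real.pi) • ξ)).mul_const (𝓕⁻ g ξ)

lemma abs_integral_sub_le {m : Measure ℝ} [IsProbabilityMeasure m] {g h : ℝ → ℝ} {e : ℝ}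
    (hg : Integrable g m) (hh : Integrable h m) (hgh : ∀ x, |g x - h x| ≤ e) :
    |∫ x, g x ∂m - ∫ x, h x ∂m| ≤ e := by
  rw [← integral_sub hg hh]
  simpa using norm_integral_le_of_norm_le_const (μ := m) (f := fun x => g x - h x)
    (ae_of_all _ hgh)

lemma integrable_of_continuous_of_abs_le {m : Measure ℝ} [IsProbabilityMeasure m] {g : ℝ → ℝ}
    {C : ℝ} (hg : Continuous g) (hC : ∀ x, |g x| ≤ C) : Integrable g m :=
  Integrable.of_bound hg.aestronglyMeasurable C (ae_of_all _ hC)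

lemma tendsto_integral_sub_of_hasCompactSupport [l.IsCountablyGenerated]
    (h : ∀ t, Tendsto (fun i => charFun (p i) t - charFun (q i) t) l (𝓝 0)) {g : ℝ → ℝ}
    (hg : Continuous g) (hsupp : HasCompactSupport g) :
    Tendsto (fun i => ∫ x, g x ∂(p i) - ∫ x, g x ∂(q i)) l (𝓝 0) := by
  refine tendsto_integral_sub_of_forall_approx fun e he => ?_
  obtain ⟨k, hk, hkg, hks⟩ := hg.exists_contDiff_approx ⊤ continuous_const fun _ => he
  have hk_supp : HasCompactSupport k := hsupp.mono hks
  have hclose : ∀ m : Measure ℝ, IsProbabilityMeasure m →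
      |∫ x, g x ∂m - ∫ x, k x ∂m| ≤ e := fun m _ =>
    abs_integral_sub_le (hg.integrable_of_hasCompactSupport hsupp)
      (hk.continuous.integrable_of_hasCompactSupport hk_supp) fun x => by
        rw [abs_sub_comm]; exact (hkg x).le
  refine ⟨k, Eventually.of_forall fun i => hclose _ inferInstance,
    Eventually.of_forall fun i => hclose _ inferInstance, ?_⟩
  have hkC : HasCompactSupport fun x => (k x : ℂ) := hk_supp.comp_left Complex.ofReal_zero
  have hlim := tendsto_integral_schwartzMap_sub h
    (hkC.toSchwartzMap (Complex.ofRealCLM.contDiff.comp hk))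
  have hcast : ∀ m : Measure ℝ, ∫ x, (hkC.toSchwartzMap (Complex.ofRealCLM.contDiff.comp hk)) x ∂m
      = ((∫ x, k x ∂m : ℝ) : ℂ) := fun m => integral_complex_ofReal
  simp only [hcast] at hlim
  simpa using! (Complex.continuous_re.tendsto 0).comp hlim

/-- A continuous cutoff, equal to `1` on `[-K, K]` and to `0` outside `[-K - 1, K + 1]`. -/
noncomputable def cutoff (K z : ℝ) : ℝ := max 0 (min 1 (K + 1 - |z|))

lemma cutoff_nonneg (K z : ℝ) : 0 ≤ cutoff K z := le_max_left _ _

lemma cutoff_le_one (K z : ℝ) : cutoff K z ≤ 1 := max_le zero_le_one (min_le_left _ _)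

lemma abs_cutoff_le_one (K z : ℝ) : |cutoff K z| ≤ 1 := by
  rw [abs_of_nonneg (cutoff_nonneg K z)]
  exact cutoff_le_one K z

lemma cutoff_eq_one {K z : ℝ} (h : |z| ≤ K) : cutoff K z = 1 := by
  rw [cutoff, min_eq_left (by linarith), max_eq_right zero_le_one]

lemma cutoff_eq_zero {K z : ℝ} (h : K + 1 ≤ |z|) : cutoff K z = 0 := by
  rw [cutoff, max_eq_left]
  exact (min_le_right _ _).trans (by linarith)

lemma continuous_cutoff (K : ℝ) : Continuous (cutoff K) := by unfold cutoff; fun_prop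

lemma hasCompactSupport_cutoff (K : ℝ) : HasCompactSupport (cutoff K) :=
  HasCompactSupport.intro (isCompact_closedBall 0 (K + 1)) fun x hx =>
    by
    rw [mem_closedBall_zero_iff, not_le] at hx
    exact cutoff_eq_zero hx.le

lemma tendsto_integral_sub_of_tendsto_cocompact [l.IsCountablyGenerated]
    (h : ∀ t, Tendsto (fun i => charFun (p i) t - charFun (q i) t) l (𝓝 0)) {g : ℝ → ℝ}
    (hg : Continuous g) (hg0 : Tendsto g (cocompact ℝ) (𝓝 0)) :
    Tendsto (fun i => ∫ x, g x ∂(p i) - ∫ x, g x ∂(q i)) l (𝓝 0) := by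
  refine tendsto_integral_sub_of_forall_approx fun e he => ?_
  obtain ⟨K, hK⟩ : ∃ K, ∀ x, K < |x| → |g x| ≤ e := by
    obtain ⟨K, hK⟩ := (Metric.hasBasis_cobounded_compl_closedBall (0 : ℝ)).eventually_iff.1
      (Metric.cobounded_eq_cocompact (α := ℝ) ▸ Metric.tendsto_nhds.1 hg0 e he)
    exact ⟨K, fun x hx => by simpa using (hK.2 (by simpa using hx)).le⟩
  have hsupp : HasCompactSupport fun x => cutoff K x * g x := (hasCompactSupport_cutoff K).mul_right
  have hcont : Continuous fun x => cutoff K x * g x := (continuous_cutoff K).mul hg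
  have hdiff : ∀ x, |g x - cutoff K x * g x| ≤ e := fun x => by
    rcases le_or_gt |x| K with hx | hx
    · simpa [cutoff_eq_one hx] using he.le
    · rw [← one_sub_mul, abs_mul, abs_of_nonneg (sub_nonneg.2 (cutoff_le_one K x))]
      exact (mul_le_of_le_one_left (abs_nonneg _) (sub_le_self _ (cutoff_nonneg K x))).trans
        (hK x hx)
  have hclose : ∀ m : Measure ℝ, IsProbabilityMeasure m →
      |∫ x, g x ∂m - ∫ x, cutoff K x * g x ∂m| ≤ e := fun m _ => by
    have hint : Integrable (fun x => cutoff K x * g x) m :=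
      hcont.integrable_of_hasCompactSupport hsupp
    have hgint : Integrable g m := by
      simpa using! (Integrable.of_bound (hg.sub hcont).aestronglyMeasurable e
        (ae_of_all m hdiff)).add hint
    exact abs_integral_sub_le hgint hint hdiff
  exact ⟨fun x => cutoff K x * g x, Eventually.of_forall fun i => hclose _ inferInstance,
    Eventually.of_forall fun i => hclose _ inferInstance,
    tendsto_integral_sub_of_hasCompactSupport h hcont hsupp⟩

lemma abs_integral_sub_cutoff_mul_le {m : Measure ℝ} [IsProbabilityMeasure m] {g : ℝ → ℝ} {C : ℝ}
    (hg : Continuous g) (hC : ∀ x, |g x| ≤ C) (K : ℝ) :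
    |∫ x, g x ∂m - ∫ x, cutoff K x * g x ∂m| ≤ C * (1 - ∫ x, cutoff K x ∂m) := by
  have hcut : Integrable (cutoff K) m :=
    integrable_of_continuous_of_abs_le (continuous_cutoff K) (abs_cutoff_le_one K)
  have hgint : Integrable g m := integrable_of_continuous_of_abs_le hg hC
  have hprod : Integrable (fun x => cutoff K x * g x) m :=
    hgint.bdd_mul (c := 1) (continuous_cutoff K).aestronglyMeasurable
      (ae_of_all _ (abs_cutoff_le_one K))
  rw [← integral_sub hgint hprod]
  calc |∫ x, (g x - cutoff K x * g x) ∂m| ≤ ∫ x, C * (1 - cutoff K x) ∂m := by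
        rw [← Real.norm_eq_abs]
        refine norm_integral_le_of_norm_le (((integrable_const 1).sub hcut).const_mul C)
          (ae_of_all _ fun x => ?_)
        rw [← one_sub_mul, norm_mul, mul_comm,
          Real.norm_of_nonneg (sub_nonneg.2 (cutoff_le_one K x))]
        exact mul_le_mul_of_nonneg_right (hC x) (sub_nonneg.2 (cutoff_le_one K x))
    _ = C * (1 - ∫ x, cutoff K x ∂m) := by
        rw [integral_const_mul, integral_sub (integrable_const 1) hcut]
        simp

lemma tendsto_integral_sub_of_tight [l.IsCountablyGenerated]
    (h : ∀ t, Tendsto (fun i => charFun (p i) t - charFun (q i) t) l (𝓝 0))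
    (htight : ∀ e > 0, ∃ K, ∀ i, 1 - ∫ x, cutoff K x ∂(q i) ≤ e) {g : ℝ → ℝ} {C : ℝ}
    (hg : Continuous g) (hC : ∀ x, |g x| ≤ C) :
    Tendsto (fun i => ∫ x, g x ∂(p i) - ∫ x, g x ∂(q i)) l (𝓝 0) := by
  refine tendsto_integral_sub_of_forall_approx fun e he => ?_
  have hC0 : 0 ≤ C := (abs_nonneg _).trans (hC 0)
  have hscale : C * (e / (C + 1)) ≤ e := by
    rw [mul_div_assoc', div_le_iff₀ (by positivity)]; nlinarith
  obtain ⟨K, hK⟩ := htight (e / (C + 1) / 2) (by positivity)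
  have hp : ∀ᶠ i in l, 1 - ∫ x, cutoff K x ∂(p i) ≤ e / (C + 1) := by
    filter_upwards [Metric.tendsto_nhds.1 (tendsto_integral_sub_of_hasCompactSupport h
      (continuous_cutoff K) (hasCompactSupport_cutoff K)) (e / (C + 1) / 2)
      (by positivity)] with i hi
    rw [Real.dist_0_eq_abs, abs_lt] at hi
    linarith [hK i, hi.1]
  have hq : ∀ i, 1 - ∫ x, cutoff K x ∂(q i) ≤ e / (C + 1) := fun i =>
    (hK i).trans (half_le_self (by positivity))
  refine ⟨fun x => cutoff K x * g x, ?_, Eventually.of_forall fun i => ?_,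
    tendsto_integral_sub_of_hasCompactSupport h ((continuous_cutoff K).mul hg)
      (hasCompactSupport_cutoff K).mul_right⟩
  · filter_upwards [hp] with i hi
    exact (abs_integral_sub_cutoff_mul_le hg hC K).trans
      ((mul_le_mul_of_nonneg_left hi hC0).trans hscale)
  · exact (abs_integral_sub_cutoff_mul_le hg hC K).trans
      ((mul_le_mul_of_nonneg_left (hq i) hC0).trans hscale)

end WeakConvergence

lemma tendsto_charFun_empirical_sub {ι : Type*} {l : Filter ι} {n : ι → ℕ}
    {v : ∀ k, Fin (n k) → ℝ} {a : ι → ℝ} {θ : ι → ℝ → ℝ} (hn : ∀ k, 0 < n k)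
    (ha : ∀ k, a k ∈ Set.Ioo (0 : ℝ) 1) (hθ : ∀ k, IsMinorant (v k) (θ k))
    (hscore : Tendsto (fun k => ∫ z, |scoreDefect (v k) (a k) z * θ k z|) l (𝓝 0))
    (hmass : Tendsto (fun k => 1 - ∫ z, θ k z) l (𝓝 0)) (t : ℝ) :
    Tendsto (fun k => charFun (empirical (v k)) t
      - charFun (gaussianReal 0 (Real.toNNReal ((1 - a k) / a k))) t) l (𝓝 0) := by
  have := fun k => isProbabilityMeasure_empirical (hn k) (v k)
  rcases eq_or_ne t 0 with rfl | ht
  · simpa using tendsto_const_nhds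
  · refine squeeze_zero_norm
      (fun k => (hθ k).norm_charFun_empirical_sub_le (hn k) (ha k) ht) ?_
    simpa using ((((hscore.add ((Real.continuous_sqrt.tendsto 0).comp hmass)).const_mul
      (2 / |t|)).add (hmass.const_mul 4)).const_mul (Real.exp (t ^ 2 / 2)))

/-- `δ` is a margin for the test function `g`, the range `I` of the parameter `a` and the error `e`:
if the score defect has mean less than `δ` on a minorant of the mixture density missing less than
`δ` of its mass, then `∫ g` distinguishes the mixing distribution from `N(0, (1 - a) / a)` by less
than `e`. -/
def IsScoreMargin (g : ℝ → ℝ) (I : Set ℝ) (e δ : ℝ) : Prop :=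
  ∀ ⦃n : ℕ⦄ (v : Fin n → ℝ) (a : ℝ) (θ : ℝ → ℝ), 0 < n → a ∈ I → IsMinorant v θ →
    ∫ z, |scoreDefect v a z * θ z| < δ → 1 - ∫ z, θ z < δ →
    |∫ x, g x ∂(empirical v) - ∫ x, g x ∂(gaussianReal 0 (Real.toNNReal ((1 - a) / a)))| < e

lemma exists_isScoreMargin {g : ℝ → ℝ} {I : Set ℝ} (hI : I ⊆ Set.Ioo 0 1)
    (hg : ∀ (p : ℕ → Measure ℝ) (a : ℕ → ℝ), (∀ k, IsProbabilityMeasure (p k)) →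
      (∀ k, a k ∈ I) →
      (∀ t, Tendsto (fun k => charFun (p k) t
        - charFun (gaussianReal 0 (Real.toNNReal ((1 - a k) / a k))) t) atTop (𝓝 0)) →
      Tendsto (fun k => ∫ x, g x ∂(p k)
        - ∫ x, g x ∂(gaussianReal 0 (Real.toNNReal ((1 - a k) / a k)))) atTop (𝓝 0))
    {e : ℝ} (he : 0 < e) :
    ∃ δ > 0, IsScoreMargin g I e δ := by
  by_contra! hfail
  simp only [IsScoreMargin, not_forall, not_lt] at hfail
  choose n v a θ hn ha hθ hscore hmass hge using
    fun k : ℕ => hfail (1 / ((k : ℝ) + 1)) (by positivity)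
  have hzero := tendsto_one_div_add_atTop_nhds_zero_nat (𝕜 := ℝ)
  have hlim := hg (fun k => empirical (v k)) a
    (fun k => isProbabilityMeasure_empirical (hn k) (v k)) ha
    (tendsto_charFun_empirical_sub hn (fun k => hI (ha k)) hθ
      (squeeze_zero (fun k => integral_nonneg fun _ => abs_nonneg _)
        (fun k => (hscore k).le) hzero)
      (squeeze_zero (fun k => sub_nonneg.2 ((hθ k).integral_le_one (hn k)))
        (fun k => (hmass k).le) hzero))
  obtain ⟨k, hk⟩ := (Metric.tendsto_nhds.1 hlim e he).exists
  exact (hge k).not_gt (by simpa using hk)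

lemma one_sub_integral_cutoff_gaussianReal_le (s : ℝ≥0) {K : ℝ} (hK : 0 < K) :
    1 - ∫ x, cutoff K x ∂(gaussianReal 0 s) ≤ s / K ^ 2 := by
  have hsq : Integrable (fun x => x ^ 2) (gaussianReal 0 s) :=
    (memLp_id_gaussianReal 2).integrable_sq
  have hvar : ∫ x, x ^ 2 ∂(gaussianReal 0 s) = s := by
    have hv := variance_of_integral_eq_zero (X := fun x : ℝ => x) (μ := gaussianReal 0 s)
      aemeasurable_id (by simp)
    simpa [variance_fun_id_gaussianReal] using hv.symm
  have hcut : Integrable (cutoff K) (gaussianReal 0 s) :=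
    integrable_of_continuous_of_abs_le (continuous_cutoff K) (abs_cutoff_le_one K)
  calc 1 - ∫ x, cutoff K x ∂(gaussianReal 0 s)
      = ∫ x, (1 - cutoff K x) ∂(gaussianReal 0 s) := by
        rw [integral_sub (integrable_const 1) hcut]; simp
    _ ≤ ∫ x, x ^ 2 / K ^ 2 ∂(gaussianReal 0 s) := by
        refine integral_mono ((integrable_const 1).sub hcut) (hsq.div_const _) fun x => ?_
        rcases le_or_gt |x| K with hx | hx
        · simpa [cutoff_eq_one hx] using by positivity
        · have : (1 : ℝ) ≤ x ^ 2 / K ^ 2 := by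
            rw [one_le_div (by positivity), ← sq_abs x]
            gcongr
          linarith [cutoff_nonneg K x]
    _ = s / K ^ 2 := by rw [integral_div, hvar]

lemma exists_isScoreMargin_Ico {g : ℝ → ℝ} {C A : ℝ} (hg : Continuous g)
    (hC : ∀ x, |g x| ≤ C) (hA : 0 < A) {e : ℝ} (he : 0 < e) :
    ∃ δ > 0, IsScoreMargin g (Set.Ico A 1) e δ := by
  refine exists_isScoreMargin (fun a ha => ⟨hA.trans_le ha.1, ha.2⟩) (fun p a _ ha hchar => ?_) he
  refine tendsto_integral_sub_of_tight hchar (fun e he => ?_) hg hC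
  have hK : 0 < √(1 / (A * e)) := Real.sqrt_pos.2 (by positivity)
  refine ⟨√(1 / (A * e)), fun k => (one_sub_integral_cutoff_gaussianReal_le _ hK).trans ?_⟩
  have hak : 0 < a k := hA.trans_le (ha k).1
  have hvar : (1 - a k) / a k ≤ 1 / A := by
    gcongr
    · linarith
    · exact (ha k).1
  rw [Real.sq_sqrt (by positivity), Real.coe_toNNReal _
    (div_nonneg (sub_nonneg.2 (ha k).2.le) hak.le), div_le_iff₀ (by positivity)]
  exact hvar.trans_eq (by field_simp)

lemma exists_isScoreMargin_Ioo {g : ℝ → ℝ} (hg : Continuous g)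
    (hg0 : Tendsto g (cocompact ℝ) (𝓝 0)) {e : ℝ} (he : 0 < e) :
    ∃ δ > 0, IsScoreMargin g (Set.Ioo 0 1) e δ :=
  exists_isScoreMargin subset_rfl
    (fun _ _ _ _ hchar => tendsto_integral_sub_of_tendsto_cocompact hchar hg hg0) he

lemma abs_cutoff_sub_le (K x y : ℝ) : |cutoff K x - cutoff K y| ≤ |x - y| := by
  unfold cutoff
  rw [max_comm 0, max_comm 0]
  refine (abs_max_sub_max_le_abs _ _ _).trans ((abs_min_sub_min_le_max _ _ _ _).trans ?_)
  rw [sub_self, abs_zero, max_eq_right (abs_nonneg _)]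
  calc |K + 1 - |x| - (K + 1 - |y|)| = |(|y| - |x|)| := by congr 1; ring
    _ ≤ |y - x| := abs_abs_sub_abs_le _ _
    _ = |x - y| := abs_sub_comm _ _

lemma abs_cutoff_mul_le {K : ℝ} (hK : 0 ≤ K) (x : ℝ) : |cutoff K x * x| ≤ K + 1 := by
  rcases le_total (K + 1) |x| with h | h
  · rw [cutoff_eq_zero h, zero_mul, abs_zero]
    positivity
  · rw [abs_mul, abs_of_nonneg (cutoff_nonneg _ _)]
    exact (mul_le_of_le_one_left (abs_nonneg _) (cutoff_le_one _ _)).trans h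

lemma abs_cutoff_mul_sub_le {K : ℝ} (hK : 0 ≤ K) (x y : ℝ) :
    |cutoff K x * x - cutoff K y * y| ≤ (K + 2) * |x - y| := by
  wlog hy : |y| ≤ K + 1 generalizing x y
  · rcases le_total |x| (K + 1) with hx | hx
    · rw [abs_sub_comm, abs_sub_comm x]
      exact this y x hx
    · rw [cutoff_eq_zero hx, cutoff_eq_zero (not_le.1 hy).le, zero_mul, zero_mul, sub_zero,
        abs_zero]
      positivity
  · calc |cutoff K x * x - cutoff K y * y|
        = |(cutoff K x - cutoff K y) * y + cutoff K x * (x - y)| := by congr 1; ring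
      _ ≤ |cutoff K x - cutoff K y| * |y| + |cutoff K x| * |x - y| := by
        rw [← abs_mul, ← abs_mul]; exact abs_add_le _ _
      _ ≤ |x - y| * (K + 1) + 1 * |x - y| :=
        add_le_add (mul_le_mul (abs_cutoff_sub_le K x y) hy (abs_nonneg y) (abs_nonneg _))
          (mul_le_mul_of_nonneg_right (abs_cutoff_le_one K x) (abs_nonneg _))
      _ = (K + 2) * |x - y| := by ring

lemma integral_cutoff_le {K : ℝ} (hK : 0 ≤ K) : ∫ z, cutoff K z ≤ 2 * (K + 1) := by
  have hle : cutoff K ≤ (Set.Icc (-(K + 1)) (K + 1)).indicator 1 := fun z => by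
    by_cases hz : |z| ≤ K + 1
    · rw [Set.indicator_of_mem (Set.mem_Icc.2 (abs_le.1 hz))]
      exact cutoff_le_one K z
    · rw [cutoff_eq_zero (not_le.1 hz).le]
      exact Set.indicator_nonneg (fun _ _ => zero_le_one) z
  calc ∫ z, cutoff K z ≤ ∫ z, (Set.Icc (-(K + 1)) (K + 1)).indicator 1 z :=
        integral_mono
          ((continuous_cutoff K).integrable_of_hasCompactSupport (hasCompactSupport_cutoff K))
          (IntegrableOn.integrable_indicator (integrableOn_const (by simp)) measurableSet_Icc) hle
    _ = 2 * (K + 1) := by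
        rw [integral_indicator_one measurableSet_Icc, Real.volume_real_Icc_of_le (by linarith)]
        ring

/-- The truncated mixture `χ_K · f_S · f / (f + η)`: it ignores the components outside `S`, the
points outside `[-K - 1, K + 1]`, and those where the density `f` is small compared to `η`. -/
noncomputable def truncMixture {n : ℕ} (S : Finset (Fin n)) (K η : ℝ) (v : Fin n → ℝ) (z : ℝ) : ℝ :=
  cutoff K z * (mixDensity v z * (mixDensity v z + η)⁻¹) * mixOn S v z

/-- The truncated and regularized score `χ_K f' / (f + η)`. -/
noncomputable def regScore {n : ℕ} (K η : ℝ) (v : Fin n → ℝ) (z : ℝ) : ℝ :=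
  cutoff K z * mixSlope v z * (mixDensity v z + η)⁻¹

/-- The truncated and regularized identity `χ_K z f / (f + η)`. -/
noncomputable def regId {n : ℕ} (K η : ℝ) (v : Fin n → ℝ) (z : ℝ) : ℝ :=
  cutoff K z * z * mixDensity v z * (mixDensity v z + η)⁻¹

section Truncation

variable {n : ℕ} (S : Finset (Fin n)) {K η : ℝ} (v : Fin n → ℝ)

lemma mixDensity_mul_inv_add_mem_Icc (hη : 0 ≤ η) (z : ℝ) :
    mixDensity v z * (mixDensity v z + η)⁻¹ ∈ Set.Icc (0 : ℝ) 1 := by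
  have hf := mixDensity_nonneg v z
  rw [← div_eq_mul_inv]
  exact ⟨by positivity, div_le_one_of_le₀ (by linarith) (by positivity)⟩

lemma isMinorant_truncMixture (hη : 0 ≤ η) : IsMinorant v (truncMixture S K η v) where
  measurable := by
    have hf := (continuous_mixDensity v).measurable
    exact ((continuous_cutoff K).measurable.mul (hf.mul (hf.add_const η).inv)).mul
      (continuous_mixOn S v).measurable
  nonneg z := mul_nonneg
    (mul_nonneg (cutoff_nonneg K z) (mixDensity_mul_inv_add_mem_Icc v hη z).1)
    (mixOn_nonneg S v z)
  le z := (mul_le_of_le_one_left (mixOn_nonneg S v z)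
    (mul_le_one₀ (cutoff_le_one K z) (mixDensity_mul_inv_add_mem_Icc v hη z).1
      (mixDensity_mul_inv_add_mem_Icc v hη z).2)).trans (mixOn_le_mixDensity S v z)

lemma mixDensity_sub_truncMixture_le (hη : 0 < η) (z : ℝ) :
    mixDensity v z - truncMixture S K η v z ≤
      (mixDensity v z - mixOn S v z) + (1 - cutoff K z) * mixDensity v z + cutoff K z * η := by
  have hf := mixDensity_nonneg v z
  have hS := mixOn_le_mixDensity S v z
  have hχ := sub_nonneg.2 (cutoff_le_one K z)
  have hratio : mixOn S v z - mixDensity v z * (mixDensity v z + η)⁻¹ * mixOn S v z ≤ η := by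
    calc mixOn S v z - mixDensity v z * (mixDensity v z + η)⁻¹ * mixOn S v z
        = η * (mixOn S v z / (mixDensity v z + η)) := by field_simp; ring
      _ ≤ η := mul_le_of_le_one_right hη.le (div_le_one_of_le₀ (by linarith) (by linarith))
  have h1 := mul_le_mul_of_nonneg_left hratio (cutoff_nonneg K z)
  have h2 := mul_le_mul_of_nonneg_left hS hχ
  rw [truncMixture]
  linarith

lemma integral_mixOn : ∫ z, mixOn S v z = (n : ℝ)⁻¹ * S.card := by
  unfold mixOn
  rw [integral_const_mul, integral_finsetSum _ fun i _ => integrable_stdPDF.comp_sub_right (v i)]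
  simp_rw [integral_sub_right_eq_self φ, integral_stdPDF]
  simp

lemma one_sub_integral_truncMixture_le (hn : 0 < n) (hK : 0 ≤ K) (hη : 0 < η) :
    1 - ∫ z, truncMixture S K η v z ≤
      (n : ℝ)⁻¹ * Sᶜ.card + (∫ z, (1 - cutoff K z) * mixDensity v z) + 2 * (K + 1) * η := by
  have hcut := ((continuous_cutoff K).integrable_of_hasCompactSupport
    (μ := volume) (hasCompactSupport_cutoff K)).mul_const η
  have htail : Integrable fun z => (1 - cutoff K z) * mixDensity v z :=
    (integrable_mixDensity v).bdd_mul (c := 1)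
      (continuous_const.sub (continuous_cutoff K)).aestronglyMeasurable (ae_of_all _ fun z => by
        rw [Real.norm_of_nonneg (sub_nonneg.2 (cutoff_le_one K z))]
        exact sub_le_self _ (cutoff_nonneg K z))
  have hdiff : Integrable fun z => mixDensity v z - mixOn S v z :=
    (integrable_mixDensity v).sub (integrable_mixOn S v)
  have hθ := isMinorant_truncMixture S (K := K) v hη.le
  have hcard : ∫ z, (mixDensity v z - mixOn S v z) = (n : ℝ)⁻¹ * Sᶜ.card := by
    rw [integral_sub (integrable_mixDensity v) (integrable_mixOn S v), integral_mixDensity v hn,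
      integral_mixOn, Finset.card_compl, Fintype.card_fin,
      Nat.cast_sub (card_finset_fin_le S)]
    field_simp
  calc 1 - ∫ z, truncMixture S K η v z
      = ∫ z, (mixDensity v z - truncMixture S K η v z) := (hθ.integral_mixDensity_sub hn).symm
    _ ≤ ∫ z, ((mixDensity v z - mixOn S v z) + (1 - cutoff K z) * mixDensity v z
          + cutoff K z * η) :=
        integral_mono hθ.mixDensity_sub.integrable ((hdiff.add htail).add hcut)
          (mixDensity_sub_truncMixture_le S v hη)
    _ = (n : ℝ)⁻¹ * Sᶜ.card + (∫ z, (1 - cutoff K z) * mixDensity v z)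
          + (∫ z, cutoff K z) * η := by
        rw [integral_add (by exact hdiff.add htail) hcut, integral_add hdiff htail, hcard,
          integral_mul_const]
    _ ≤ _ := by
        gcongr
        exact integral_cutoff_le hK

lemma regScore_add_mul_regId_eq (hn : 0 < n) (a z : ℝ) :
    regScore K η v z + a * regId K η v z =
      cutoff K z * (mixDensity v z * (mixDensity v z + η)⁻¹) * scoreDefect v a z := by
  have hf := (mixDensity_pos v hn z).ne'
  rw [regScore, regId, scoreDefect]
  field_simp

lemma sq_regScore_add_mul_regId_le (hn : 0 < n) (hη : 0 ≤ η) (a z : ℝ) :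
    (regScore K η v z + a * regId K η v z) ^ 2 ≤ scoreDefect v a z ^ 2 := by
  rw [regScore_add_mul_regId_eq v hn, mul_pow]
  obtain ⟨h0, h1⟩ := mixDensity_mul_inv_add_mem_Icc v hη z
  exact mul_le_of_le_one_left (sq_nonneg _) (pow_le_one₀ (mul_nonneg (cutoff_nonneg K z) h0)
    (mul_le_one₀ (cutoff_le_one K z) h0 h1))

lemma integral_abs_scoreDefect_mul_truncMixture_le (hn : 0 < n) (a : ℝ)
    (hint : Integrable fun z => (regScore K η v z + a * regId K η v z) ^ 2 * mixOn S v z) :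
    ∫ z, |scoreDefect v a z * truncMixture S K η v z| ≤
      √(∫ z, (regScore K η v z + a * regId K η v z) ^ 2 * mixOn S v z) := by
  have heq : ∀ z, |scoreDefect v a z * truncMixture S K η v z| =
      √((regScore K η v z + a * regId K η v z) ^ 2 * mixOn S v z) * √(mixOn S v z) := fun z => by
    rw [Real.sqrt_mul (sq_nonneg _), Real.sqrt_sq_eq_abs, mul_assoc,
      Real.mul_self_sqrt (mixOn_nonneg S v z), regScore_add_mul_regId_eq v hn, truncMixture,
      ← abs_of_nonneg (mixOn_nonneg S v z), ← abs_mul, abs_of_nonneg (mixOn_nonneg S v z)]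
    congr 1
    ring
  have hmass : ∫ z, mixOn S v z ≤ 1 := integral_mixDensity v hn ▸
    integral_mono (integrable_mixOn S v) (integrable_mixDensity v) (mixOn_le_mixDensity S v)
  simp only [heq]
  exact (integral_sqrt_mul_sqrt_le (fun z => mul_nonneg (sq_nonneg _) (mixOn_nonneg S v z))
    (mixOn_nonneg S v) hint (integrable_mixOn S v)).trans
    (mul_le_of_le_one_right (Real.sqrt_nonneg _) (Real.sqrt_le_one.2 hmass))

end Truncation

/-- `G v z` is bounded by `b` and `b`-Lipschitz for the distance
`|z - z'| + n⁻¹ ∑ₖ |v k - w k|`, so that moving a single `v k` changes it by `O(1 / n)`. -/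
structure IsMeanFieldLipschitz {n : ℕ} (b : ℝ) (G : (Fin n → ℝ) → ℝ → ℝ) : Prop where
  abs_le : ∀ v z, |G v z| ≤ b
  abs_sub_le : ∀ v w z z', |G v z - G w z'| ≤ b * (|z - z'| + (n : ℝ)⁻¹ * ∑ k, |v k - w k|)

namespace IsMeanFieldLipschitz

variable {n : ℕ} {b c : ℝ} {G H : (Fin n → ℝ) → ℝ → ℝ}

lemma nonneg (hG : IsMeanFieldLipschitz b G) : 0 ≤ b := (abs_nonneg _).trans (hG.abs_le 0 0)

lemma mono (hG : IsMeanFieldLipschitz b G) (hbc : b ≤ c) : IsMeanFieldLipschitz c G where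
  abs_le v z := (hG.abs_le v z).trans hbc
  abs_sub_le v w z z' := (hG.abs_sub_le v w z z').trans (by gcongr)

lemma mul (hG : IsMeanFieldLipschitz b G) (hH : IsMeanFieldLipschitz c H) :
    IsMeanFieldLipschitz (2 * (b * c)) fun v z => G v z * H v z where
  abs_le v z := by
    have hb := hG.nonneg
    have hc := hH.nonneg
    rw [abs_mul]
    have := mul_le_mul (hG.abs_le v z) (hH.abs_le v z) (abs_nonneg _) hb
    linarith [mul_nonneg hb hc]
  abs_sub_le v w z z' := by
    have hb := hG.nonneg
    set d := |z - z'| + (n : ℝ)⁻¹ * ∑ k, |v k - w k|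
    calc |G v z * H v z - G w z' * H w z'|
        = |G v z * (H v z - H w z') + (G v z - G w z') * H w z'| := by congr 1; ring
      _ ≤ |G v z| * |H v z - H w z'| + |G v z - G w z'| * |H w z'| := by
          rw [← abs_mul, ← abs_mul]; exact abs_add_le _ _
      _ ≤ b * (c * d) + b * d * c :=
          add_le_add (mul_le_mul (hG.abs_le v z) (hH.abs_sub_le v w z z') (abs_nonneg _) hb)
            (mul_le_mul (hG.abs_sub_le v w z z') (hH.abs_le w z') (abs_nonneg _) (by positivity))
      _ = 2 * (b * c) * d := by ring

lemma continuous_uncurry (hG : IsMeanFieldLipschitz b G) :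
    Continuous fun p : (Fin n → ℝ) × ℝ => G p.1 p.2 := by
  refine continuous_iff_continuousAt.2 fun p => tendsto_iff_norm_sub_tendsto_zero.2 ?_
  have hlim : Tendsto (fun q : (Fin n → ℝ) × ℝ =>
      b * (|q.2 - p.2| + (n : ℝ)⁻¹ * ∑ k, |q.1 k - p.1 k|)) (𝓝 p) (𝓝 0) := by
    refine Continuous.tendsto' (by fun_prop) _ _ (by simp)
  exact squeeze_zero (fun _ => norm_nonneg _) (fun q => hG.abs_sub_le q.1 p.1 q.2 p.2) hlim

lemma integrable_mul_mixOn (hG : IsMeanFieldLipschitz b G) (S : Finset (Fin n)) (v : Fin n → ℝ) :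
    Integrable fun z => G v z * mixOn S v z :=
  (integrable_mixOn S v).bdd_mul (c := b) hG.continuous_uncurry.along_snd.aestronglyMeasurable
    (ae_of_all _ (hG.abs_le v))

end IsMeanFieldLipschitz

section MeanFieldLipschitz

variable {n : ℕ} {K η : ℝ}

lemma isMeanFieldLipschitz_average {h : ℝ → ℝ} (hbdd : ∀ x, |h x| ≤ 1)
    (hlip : ∀ x y, |h x - h y| ≤ |x - y|) :
    IsMeanFieldLipschitz 1 fun (v : Fin n → ℝ) z => (n : ℝ)⁻¹ * ∑ i, h (z - v i) where
  abs_le v z := abs_average_le _ zero_le_one fun i _ => hbdd _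
  abs_sub_le v w z z' := by
    have hterm : ∀ i, |h (z - v i) - h (z' - w i)| ≤ |z - z'| + |v i - w i| := fun i => by
      refine (hlip _ _).trans ?_
      rw [sub_sub_sub_comm]
      exact abs_sub _ _
    rw [← mul_sub, ← Finset.sum_sub_distrib, one_mul, abs_mul, abs_of_nonneg (by positivity)]
    calc (n : ℝ)⁻¹ * |∑ i, (h (z - v i) - h (z' - w i))|
        ≤ (n : ℝ)⁻¹ * ∑ i, (|z - z'| + |v i - w i|) := by
          gcongr
          exact (Finset.abs_sum_le_sum_abs _ _).trans (Finset.sum_le_sum fun i _ => hterm i)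
      _ = (n : ℝ)⁻¹ * n * |z - z'| + (n : ℝ)⁻¹ * ∑ i, |v i - w i| := by
          rw [Finset.sum_add_distrib, Finset.sum_const, Finset.card_fin, nsmul_eq_mul]
          ring
      _ ≤ |z - z'| + (n : ℝ)⁻¹ * ∑ i, |v i - w i| := by
          gcongr
          exact mul_le_of_le_one_left (abs_nonneg _) inv_mul_le_one

lemma isMeanFieldLipschitz_mixDensity : IsMeanFieldLipschitz 1 (mixDensity (n := n)) :=
  isMeanFieldLipschitz_average
    (fun x => by rw [abs_of_nonneg (stdPDF_nonneg x)]; exact stdPDF_le_one x) abs_stdPDF_sub_le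

lemma isMeanFieldLipschitz_mixSlope : IsMeanFieldLipschitz 1 (mixSlope (n := n)) :=
  isMeanFieldLipschitz_average (h := fun x => -(x * φ x))
    (fun x => by
      rw [abs_neg, abs_mul, abs_of_nonneg (stdPDF_nonneg x)]; exact abs_mul_stdPDF_le_one x)
    (fun x y => by rw [neg_sub_neg, abs_sub_comm]; exact abs_mul_stdPDF_sub_le x y)

lemma isMeanFieldLipschitz_of_lipschitz {b : ℝ} {h : ℝ → ℝ} (hbdd : ∀ x, |h x| ≤ b)
    (hlip : ∀ x y, |h x - h y| ≤ b * |x - y|) :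
    IsMeanFieldLipschitz b fun (_ : Fin n → ℝ) z => h z where
  abs_le _ z := hbdd z
  abs_sub_le _ _ z z' := (hlip z z').trans (mul_le_mul_of_nonneg_left
    (le_add_of_nonneg_right (by positivity)) ((abs_nonneg _).trans (hbdd 0)))

lemma isMeanFieldLipschitz_inv_mixDensity_add (hη : 0 < η) (hη1 : η ≤ 1) :
    IsMeanFieldLipschitz (η⁻¹ ^ 2) fun (v : Fin n → ℝ) z => (mixDensity v z + η)⁻¹ := by
  have hpos : ∀ (v : Fin n → ℝ) z, 0 < mixDensity v z + η := fun v z =>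
    add_pos_of_nonneg_of_pos (mixDensity_nonneg v z) hη
  have hinv : ∀ (v : Fin n → ℝ) z, |(mixDensity v z + η)⁻¹| ≤ η⁻¹ := fun v z => by
    rw [abs_of_pos (inv_pos.2 (hpos v z))]
    exact inv_anti₀ hη (le_add_of_nonneg_left (mixDensity_nonneg v z))
  refine ⟨fun v z => (hinv v z).trans (le_self_pow₀ (one_le_inv_iff₀.2 ⟨hη, hη1⟩) two_ne_zero),
    fun v w z z' => ?_⟩
  have hlip := isMeanFieldLipschitz_mixDensity.abs_sub_le w v z' z
  calc |(mixDensity v z + η)⁻¹ - (mixDensity w z' + η)⁻¹|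
      = |(mixDensity v z + η)⁻¹| * |(mixDensity w z' + η)⁻¹|
          * |mixDensity w z' - mixDensity v z| := by
        rw [← abs_mul, ← abs_mul, inv_sub_inv (hpos v z).ne' (hpos w z').ne']
        congr 1
        field_simp
        ring
    _ ≤ η⁻¹ * η⁻¹ * (1 * (|z' - z| + (n : ℝ)⁻¹ * ∑ k, |w k - v k|)) := by
        gcongr <;> exact hinv _ _
    _ = η⁻¹ ^ 2 * (|z - z'| + (n : ℝ)⁻¹ * ∑ k, |v k - w k|) := by
        simp only [abs_sub_comm]
        ring

lemma isMeanFieldLipschitz_regScore (hK : 0 ≤ K) (hη : 0 < η) (hη1 : η ≤ 1) :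
    IsMeanFieldLipschitz (4 * (K + 2) * η⁻¹ ^ 2) (regScore (n := n) K η) :=
  (((isMeanFieldLipschitz_of_lipschitz (abs_cutoff_le_one K)
    fun x y => (abs_cutoff_sub_le K x y).trans_eq (one_mul _).symm).mul
      isMeanFieldLipschitz_mixSlope).mul
        (isMeanFieldLipschitz_inv_mixDensity_add hη hη1)).mono (by
          have : 0 ≤ K * η⁻¹ ^ 2 := by positivity
          have : 0 ≤ η⁻¹ ^ 2 := by positivity
          linarith)

lemma isMeanFieldLipschitz_regId (hK : 0 ≤ K) (hη : 0 < η) (hη1 : η ≤ 1) :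
    IsMeanFieldLipschitz (4 * (K + 2) * η⁻¹ ^ 2) (regId (n := n) K η) :=
  (((isMeanFieldLipschitz_of_lipschitz
    (fun x => (abs_cutoff_mul_le hK x).trans (by linarith)) (abs_cutoff_mul_sub_le hK)).mul
      isMeanFieldLipschitz_mixDensity).mul
        (isMeanFieldLipschitz_inv_mixDensity_add hη hη1)).mono (le_of_eq (by ring))

end MeanFieldLipschitz

lemma integrable_abs_eval {ι : Type*} [Fintype ι] {κ : ι → Measure ℝ}
    [∀ i, IsProbabilityMeasure (κ i)] {j : ι} (habs : Integrable (fun x => |x|) (κ j)) :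
    Integrable (fun e : ι → ℝ => |e j|) (Measure.pi κ) :=
  ((measurePreserving_eval κ j).integrable_comp habs.1).2 habs

lemma integral_abs_eval {ι : Type*} [Fintype ι] {κ : ι → Measure ℝ}
    [∀ i, IsProbabilityMeasure (κ i)] {j : ι} :
    ∫ e : ι → ℝ, |e j| ∂Measure.pi κ = ∫ x, |x| ∂κ j := by
  rw [← (measurePreserving_eval κ j).map_eq, integral_map (measurable_pi_apply j).aemeasurable
    (by fun_prop)]

section Resampling

variable {ι : Type*} [DecidableEq ι]

lemma measurable_update_uncurry (j : ι) :
    Measurable fun p : (ι → ℝ) × ℝ => Function.update p.1 j p.2 := by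
  refine measurable_pi_lambda _ fun i => ?_
  rcases eq_or_ne i j with rfl | h
  · simpa using measurable_snd
  · simp only [Function.update_of_ne h]
    fun_prop

variable (κ : ι → Measure ℝ)

/-- The mean of `F` over its `j`-th coordinate, the other coordinates being fixed. -/
noncomputable def coordMean (j : ι) (F : (ι → ℝ) → ℝ) (e : ι → ℝ) : ℝ :=
  ∫ x, F (Function.update e j x) ∂κ j

variable {κ} [∀ i, IsProbabilityMeasure (κ i)] {j : ι} {F D : (ι → ℝ) → ℝ} {b B M R : ℝ}

lemma measurable_coordMean (hF : Measurable F) : Measurable (coordMean κ j F) :=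
  ((hF.comp (measurable_update_uncurry j)).stronglyMeasurable.integral_prod_right'
    (ν := κ j)).measurable

lemma integrable_comp_update (hF : Measurable F) (hb : ∀ e, |F e| ≤ b) (e : ι → ℝ) :
    Integrable (fun x => F (Function.update e j x)) (κ j) :=
  Integrable.of_bound (hF.comp (measurable_update e)).aestronglyMeasurable b
    (ae_of_all _ fun _ => hb _)

lemma abs_coordMean_le (hb : ∀ e, |F e| ≤ b) (e : ι → ℝ) : |coordMean κ j F e| ≤ b := by
  simpa [coordMean] using norm_integral_le_of_norm_le_const (μ := κ j)
    (f := fun x => F (Function.update e j x)) (ae_of_all _ fun _ => hb _)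

lemma coordMean_sub_coordMean (hF : Measurable F) (hb : ∀ e, |F e| ≤ b) (e : ι → ℝ) :
    coordMean κ j (fun e => F e - coordMean κ j F e) e = 0 := by
  simp only [coordMean, Function.update_idem]
  rw [integral_sub (integrable_comp_update hF hb e) (integrable_const _)]
  simp

lemma abs_coordMean_update_sub_le {i : ι} (hij : i ≠ j) (hF : Measurable F)
    (hb : ∀ e, |F e| ≤ b)
    (hR : ∀ e y, |F (Function.update e i y) - F e| ≤ R * |y - e i|) (e : ι → ℝ) (y : ℝ) :
    |coordMean κ j F (Function.update e i y) - coordMean κ j F e| ≤ R * |y - e i| := by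
  refine (abs_integral_sub_le (integrable_comp_update hF hb _) (integrable_comp_update hF hb _)
    fun x => ?_)
  rw [Function.update_comm hij]
  simpa [hij] using hR (Function.update e j x) y

lemma abs_coordMean_mul_le (hF : Measurable F) (hb : ∀ e, |F e| ≤ b)
    (hR0 : 0 ≤ R) (hR : ∀ e y, |F (Function.update e j y) - F e| ≤ R * |y - e j|)
    (hD : Measurable D) (hB : ∀ e, |D e| ≤ B) (hzero : ∀ e, coordMean κ j D e = 0)
    (habs : Integrable (fun x => |x|) (κ j)) (hM : ∫ x, |x| ∂κ j ≤ M) (e : ι → ℝ) :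
    |coordMean κ j (fun e => F e * D e) e| ≤ R * B * (M + |e j|) := by
  have hB0 : 0 ≤ B := (abs_nonneg _).trans (hB 0)
  have hintD := integrable_comp_update (κ := κ) (j := j) hD hB e
  have hintFD : Integrable
      (fun y => F (Function.update e j y) * D (Function.update e j y)) (κ j) :=
    hintD.bdd_mul (c := b) (hF.comp (measurable_update e)).aestronglyMeasurable
      (ae_of_all _ fun _ => hb _)
  have hcentre : coordMean κ j (fun e => F e * D e) e
      = ∫ y, (F (Function.update e j y) - F e) * D (Function.update e j y) ∂κ j := by
    simp only [sub_mul]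
    rw [integral_sub hintFD (hintD.const_mul _), integral_const_mul]
    exact (sub_eq_self.2 (mul_eq_zero_of_right _ (hzero e))).symm
  calc |coordMean κ j (fun e => F e * D e) e|
      ≤ ∫ y, R * B * (|y| + |e j|) ∂κ j := by
        rw [hcentre, ← Real.norm_eq_abs]
        refine norm_integral_le_of_norm_le ((habs.add (integrable_const _)).const_mul _)
          (ae_of_all _ fun y => ?_)
        rw [norm_mul, mul_right_comm]
        exact mul_le_mul ((hR e y).trans (mul_le_mul_of_nonneg_left (abs_sub _ _) hR0)) (hB _)
          (norm_nonneg _) (by positivity)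
    _ = R * B * (∫ y, |y| ∂κ j + |e j|) := by
        rw [integral_const_mul, integral_add habs (integrable_const _)]
        simp
    _ ≤ R * B * (M + |e j|) := by gcongr

variable [Fintype ι]

variable (κ) in
lemma measurePreserving_update_uncurry (j : ι) :
    MeasurePreserving (fun p : (ι → ℝ) × ℝ => Function.update p.1 j p.2)
      ((Measure.pi κ).prod (κ j)) (Measure.pi κ) := by
  refine ⟨measurable_update_uncurry j, (Measure.pi_eq fun s hs => ?_).symm⟩
  have hpre : (fun p : (ι → ℝ) × ℝ => Function.update p.1 j p.2) ⁻¹' Set.univ.pi s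
      = Set.univ.pi (Function.update s j Set.univ) ×ˢ s j := by
    ext ⟨e, x⟩
    simp only [Set.mem_preimage, Set.mem_univ_pi, Set.mem_prod,
      Function.forall_update_iff e fun i y => y ∈ s i,
      Function.forall_update_iff s fun i t => e i ∈ t, Set.mem_univ, true_and]
    exact and_comm
  rw [Measure.map_apply (measurable_update_uncurry j) (MeasurableSet.univ_pi hs), hpre,
    Measure.prod_prod, Measure.pi_pi, ← Finset.prod_erase_mul _ _ (Finset.mem_univ j),
    ← Finset.prod_erase_mul Finset.univ (fun i => κ i (s i)) (Finset.mem_univ j),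
    Function.update_self, measure_univ, mul_one]
  congr 1
  refine Finset.prod_congr rfl fun i hi => ?_
  rw [Function.update_of_ne (Finset.ne_of_mem_erase hi)]

lemma integral_coordMean (hF : Integrable F (Measure.pi κ)) :
    ∫ e, coordMean κ j F e ∂Measure.pi κ = ∫ e, F e ∂Measure.pi κ := by
  have hmp := measurePreserving_update_uncurry κ j
  have hint := (hmp.integrable_comp hF.1).2 hF
  rw [← hmp.map_eq] at hF
  conv_rhs => rw [← hmp.map_eq, integral_map hmp.measurable.aemeasurable hF.1]
  exact (integral_prod _ hint).symm

lemma abs_integral_mul_le_of_coordMean_eq_zero (hF : Measurable F) (hb : ∀ e, |F e| ≤ b)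
    (hR0 : 0 ≤ R) (hR : ∀ e y, |F (Function.update e j y) - F e| ≤ R * |y - e j|)
    (hD : Measurable D) (hB : ∀ e, |D e| ≤ B) (hzero : ∀ e, coordMean κ j D e = 0)
    (habs : Integrable (fun x => |x|) (κ j)) (hM : ∫ x, |x| ∂κ j ≤ M) :
    |∫ e, F e * D e ∂Measure.pi κ| ≤ 2 * (R * B * M) := by
  have hB0 : 0 ≤ B := (abs_nonneg _).trans (hB 0)
  have hint : Integrable (fun e => F e * D e) (Measure.pi κ) :=
    Integrable.of_bound (hF.mul hD).aestronglyMeasurable (b * B) (ae_of_all _ fun e => by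
      rw [norm_mul]
      exact mul_le_mul (hb e) (hB e) (abs_nonneg _) ((abs_nonneg _).trans (hb e)))
  have hinner := abs_coordMean_mul_le hF hb hR0 hR hD hB hzero habs hM
  have hsum := (integrable_const M).add (integrable_abs_eval (κ := κ) habs)
  calc |∫ e, F e * D e ∂Measure.pi κ|
      = |∫ e, coordMean κ j (fun e => F e * D e) e ∂Measure.pi κ| := by
        rw [integral_coordMean hint]
    _ ≤ ∫ e, R * B * (M + |e j|) ∂Measure.pi κ := by
        rw [← Real.norm_eq_abs]
        exact norm_integral_le_of_norm_le (hsum.const_mul (R * B)) (ae_of_all _ hinner)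
    _ = R * B * (M + ∫ x, |x| ∂κ j) := by
        rw [integral_const_mul, integral_add (integrable_const M) (integrable_abs_eval habs),
          integral_abs_eval]
        simp
    _ ≤ R * B * (M + M) := by gcongr
    _ = 2 * (R * B * M) := by ring

lemma integral_sq_sum_le {D : ι → (ι → ℝ) → ℝ} {R : ι → ι → ℝ} (S : Finset ι)
    (hD : ∀ i, Measurable (D i)) (hB : ∀ i e, |D i e| ≤ B)
    (hzero : ∀ i e, coordMean κ i (D i) e = 0) (hR0 : ∀ i j, 0 ≤ R i j)
    (hR : ∀ i j, j ≠ i → ∀ e y, |D i (Function.update e j y) - D i e| ≤ R i j * |y - e j|)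
    (habs : ∀ j, Integrable (fun x => |x|) (κ j)) (hM : ∀ j, ∫ x, |x| ∂κ j ≤ M) :
    ∫ e, (∑ i ∈ S, D i e) ^ 2 ∂Measure.pi κ
      ≤ S.card * B ^ 2 + 2 * B * M * ∑ i ∈ S, ∑ j ∈ S, R i j := by
  have hint : ∀ i j, Integrable (fun e => D i e * D j e) (Measure.pi κ) := fun i j =>
    Integrable.of_bound ((hD i).mul (hD j)).aestronglyMeasurable (B * B)
      (ae_of_all _ fun e => by
        rw [norm_mul]
        exact mul_le_mul (hB i e) (hB j e) (abs_nonneg _) ((abs_nonneg _).trans (hB i e)))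
  have hpair : ∀ i j, ∫ e, D i e * D j e ∂Measure.pi κ
      ≤ (if i = j then B ^ 2 else 0) + 2 * B * M * R i j := fun i j => by
    have hB0 : 0 ≤ B := (abs_nonneg _).trans (hB i 0)
    have hM0 : 0 ≤ M := (integral_nonneg fun _ => abs_nonneg _).trans (hM i)
    have hRij := hR0 i j
    split_ifs with hij
    · subst hij
      refine le_add_of_le_of_nonneg ?_ (by positivity)
      simpa using integral_mono (hint i i) (integrable_const (B ^ 2)) fun e => by
        beta_reduce
        rw [← sq]
        exact sq_le_sq' (neg_le_of_abs_le (hB i e)) (le_of_abs_le (hB i e))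
    · have := abs_integral_mul_le_of_coordMean_eq_zero (hD i) (hB i) hRij
        (hR i j (Ne.symm hij)) (hD j) (hB j) (hzero j) (habs j) (hM j)
      linarith [le_abs_self (∫ e, D i e * D j e ∂Measure.pi κ)]
  simp only [sq (∑ i ∈ S, D i _), Finset.sum_mul_sum]
  rw [integral_finsetSum _ fun i _ => integrable_finsetSum _ fun j _ => hint i j]
  simp_rw [integral_finsetSum S fun j _ => hint _ j]
  refine (Finset.sum_le_sum fun i _ => Finset.sum_le_sum fun j _ => hpair i j).trans_eq ?_
  simp_rw [Finset.sum_add_distrib, Finset.mul_sum]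
  congr 1
  rw [Finset.sum_congr rfl fun _ hi => by rw [Finset.sum_ite_eq, if_pos hi], Finset.sum_const,
    nsmul_eq_mul]

lemma integral_sq_sum_sub_coordMean_le {J : ι → (ι → ℝ) → ℝ} {R : ι → ι → ℝ} (S : Finset ι)
    (hJ : ∀ i, Measurable (J i)) (hb : ∀ i e, |J i e| ≤ b) (hR0 : ∀ i j, 0 ≤ R i j)
    (hR : ∀ i j, j ≠ i → ∀ e y, |J i (Function.update e j y) - J i e| ≤ R i j * |y - e j|)
    (habs : ∀ j, Integrable (fun x => |x|) (κ j)) (hM : ∀ j, ∫ x, |x| ∂κ j ≤ M) :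
    ∫ e, (∑ i ∈ S, (J i e - coordMean κ i (J i) e)) ^ 2 ∂Measure.pi κ
      ≤ 4 * b ^ 2 * S.card + 8 * b * M * ∑ i ∈ S, ∑ j ∈ S, R i j := by
  refine (integral_sq_sum_le (D := fun i e => J i e - coordMean κ i (J i) e) (B := 2 * b)
    (R := fun i j => 2 * R i j) S
    (fun i => (hJ i).sub (measurable_coordMean (hJ i))) (fun i e => (abs_sub _ _).trans ?_)
    (fun i => coordMean_sub_coordMean (hJ i) (hb i)) (fun i j => by linarith [hR0 i j])
    (fun i j hij e y => ?_) habs hM).trans_eq ?_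
  · linarith [hb i e, abs_coordMean_le (κ := κ) (j := i) (hb i) e]
  · rw [sub_sub_sub_comm]
    refine (abs_sub _ _).trans ?_
    linarith [hR i j hij e y,
      abs_coordMean_update_sub_le (κ := κ) hij (hJ i) (hb i) (hR i j hij) e y]
  · simp_rw [← Finset.mul_sum]
    ring

end Resampling

lemma integral_abs_le_sqrt_integral_sq {X : Type*} [MeasurableSpace X] {m : Measure X}
    [IsProbabilityMeasure m] {f : X → ℝ} (hf : Integrable (fun x => f x ^ 2) m) :
    ∫ x, |f x| ∂m ≤ √(∫ x, f x ^ 2 ∂m) := by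
  simpa [Real.sqrt_sq_eq_abs] using integral_sqrt_mul_sqrt_le (m := m) (g := fun _ => 1)
    (fun x => sq_nonneg (f x)) (fun _ => zero_le_one) hf (integrable_const _)

lemma integral_mul_mixOn {n : ℕ} (S : Finset (Fin n)) (v : Fin n → ℝ) {b : ℝ} {h : ℝ → ℝ}
    (hh : Continuous h) (hb : ∀ z, |h z| ≤ b) :
    ∫ z, h z * mixOn S v z = (n : ℝ)⁻¹ * ∑ i ∈ S, ∫ x, h (v i + x) ∂γ := by
  have hint : ∀ i, Integrable fun z => h z * φ (z - v i) := fun i =>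
    (integrable_stdPDF.comp_sub_right (v i)).bdd_mul (c := b) hh.aestronglyMeasurable
      (ae_of_all _ hb)
  have hterm : ∀ i, ∫ x, h (v i + x) ∂γ = ∫ z, h z * φ (z - v i) := fun i => by
    rw [integral_stdGaussian, ← integral_sub_right_eq_self _ (v i)]
    simp
  simp only [mixOn, mul_left_comm _ (n : ℝ)⁻¹, hterm]
  rw [integral_const_mul, ← integral_finsetSum _ fun i _ => hint i]
  simp only [Finset.mul_sum]

/-- The points `V i` are functions of the noise `e` which do not involve the coordinate `e i` and
depend on `e j` with Lipschitz constant `r i j`, the total influence of each coordinate being at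
most `T`. -/
structure HasInfluence {n : ℕ} (V : (Fin n → ℝ) → Fin n → ℝ) (r : Fin n → Fin n → ℝ) (T : ℝ) :
    Prop where
  measurable : Measurable V
  nonneg : ∀ i j, 0 ≤ r i j
  self : ∀ i, r i i = 0
  abs_update_sub_le : ∀ i j e y, |V (Function.update e j y) i - V e i| ≤ r i j * |y - e j|
  sum_le : ∀ j, ∑ i, r i j ≤ T

/-- The functional `G` evaluated at the `i`-th residual `V e i + e i`. -/
noncomputable def evalResid {n : ℕ} (G : (Fin n → ℝ) → ℝ → ℝ) (V : (Fin n → ℝ) → Fin n → ℝ)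
    (i : Fin n) (e : Fin n → ℝ) : ℝ :=
  G (V e) (V e i + e i)

namespace HasInfluence

variable {n : ℕ} {V : (Fin n → ℝ) → Fin n → ℝ} {r : Fin n → Fin n → ℝ} {T b : ℝ}
  {G : (Fin n → ℝ) → ℝ → ℝ}

lemma update_self (hV : HasInfluence V r T) (e : Fin n → ℝ) (i : Fin n) (y : ℝ) :
    V (Function.update e i y) i = V e i := by
  have := hV.abs_update_sub_le i i e y
  rw [hV.self, zero_mul] at this
  exact sub_eq_zero.1 (abs_nonpos_iff.1 this)

lemma average_abs_update_sub_le (hV : HasInfluence V r T) (e : Fin n → ℝ) (j : Fin n) (y : ℝ) :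
    (n : ℝ)⁻¹ * ∑ k, |V (Function.update e j y) k - V e k| ≤ T / n * |y - e j| := by
  calc (n : ℝ)⁻¹ * ∑ k, |V (Function.update e j y) k - V e k|
      ≤ (n : ℝ)⁻¹ * ((∑ k, r k j) * |y - e j|) := by
        rw [Finset.sum_mul]
        gcongr with k
        exact hV.abs_update_sub_le k j e y
    _ ≤ (n : ℝ)⁻¹ * (T * |y - e j|) := by
        gcongr
        exact hV.sum_le j
    _ = T / n * |y - e j| := by ring

lemma measurable_evalResid (hV : HasInfluence V r T) (hG : IsMeanFieldLipschitz b G) (i : Fin n) :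
    Measurable (evalResid G V i) :=
  hG.continuous_uncurry.measurable.comp (hV.measurable.prodMk
    (((measurable_pi_apply i).comp hV.measurable).add (measurable_pi_apply i)))

lemma abs_evalResid_update_sub_le (hV : HasInfluence V r T) (hG : IsMeanFieldLipschitz b G)
    {i j : Fin n} (hij : j ≠ i) (e : Fin n → ℝ) (y : ℝ) :
    |evalResid G V i (Function.update e j y) - evalResid G V i e| ≤
      b * (r i j + T / n) * |y - e j| := by
  refine (hG.abs_sub_le _ _ _ _).trans ?_
  rw [mul_assoc, add_mul, Function.update_of_ne hij.symm, add_sub_add_right_eq_sub]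
  exact mul_le_mul_of_nonneg_left
    (add_le_add (hV.abs_update_sub_le i j e y) (hV.average_abs_update_sub_le e j y)) hG.nonneg

lemma nonneg_bound (hV : HasInfluence V r T) (j : Fin n) : 0 ≤ T :=
  (Finset.sum_nonneg fun i _ => hV.nonneg i j).trans (hV.sum_le j)

lemma sum_sum_le (hV : HasInfluence V r T) (S : Finset (Fin n)) :
    ∑ i ∈ S, ∑ j ∈ S, (r i j + T / n) ≤ 2 * n * T := by
  have hle : ∑ i ∈ S, ∑ j ∈ S, (r i j + T / n) ≤ ∑ i, ∑ j, (r i j + T / n) := by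
    have hterm : ∀ i j, 0 ≤ r i j + T / n := fun i j =>
      add_nonneg (hV.nonneg i j) (div_nonneg (hV.nonneg_bound j) (Nat.cast_nonneg n))
    exact (Finset.sum_le_sum fun i _ => Finset.sum_le_univ_sum_of_nonneg (hterm i)).trans
      (Finset.sum_le_univ_sum_of_nonneg fun i => Finset.sum_nonneg fun j _ => hterm i j)
  calc ∑ i ∈ S, ∑ j ∈ S, (r i j + T / n)
      ≤ ∑ j, ∑ i, (r i j + T / n) := hle.trans_eq Finset.sum_comm
    _ ≤ ∑ _j : Fin n, (T + T) := by
        refine Finset.sum_le_sum fun j _ => ?_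
        rw [Finset.sum_add_distrib, Finset.sum_const, Finset.card_fin, nsmul_eq_mul]
        have hn : (n : ℝ) ≠ 0 := by exact_mod_cast j.pos.ne'
        rw [mul_div_cancel₀ _ hn]
        gcongr
        exact hV.sum_le j
    _ = 2 * n * T := by simp; ring

lemma integral_sq_sum_evalResid_le (hV : HasInfluence V r T) (hG : IsMeanFieldLipschitz b G)
    (S : Finset (Fin n)) :
    ∫ e, (∑ i ∈ S, (evalResid G V i e - coordMean (fun _ => γ) i (evalResid G V i) e)) ^ 2
      ∂Measure.pi (fun _ => γ) ≤ 4 * b ^ 2 * (1 + 4 * T) * n := by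
  have hb := hG.nonneg
  calc _ ≤ 4 * b ^ 2 * S.card + 8 * b * 1 * ∑ i ∈ S, ∑ j ∈ S, b * (r i j + T / n) :=
        integral_sq_sum_sub_coordMean_le S (fun i => hV.measurable_evalResid hG i)
          (fun i e => hG.abs_le _ _)
          (fun i j => mul_nonneg hb (add_nonneg (hV.nonneg i j)
            (div_nonneg (hV.nonneg_bound j) (Nat.cast_nonneg n))))
          (fun i j hij => hV.abs_evalResid_update_sub_le hG hij)
          (fun _ => integrable_id_stdGaussian.abs) (fun _ => integral_abs_stdGaussian_le)
    _ = 4 * b ^ 2 * S.card + 8 * b ^ 2 * ∑ i ∈ S, ∑ j ∈ S, (r i j + T / n) := by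
        simp_rw [← Finset.mul_sum]
        ring
    _ ≤ 4 * b ^ 2 * n + 8 * b ^ 2 * (2 * n * T) := by
        gcongr
        · exact card_finset_fin_le S
        · exact hV.sum_sum_le S
    _ = 4 * b ^ 2 * (1 + 4 * T) * n := by ring

lemma abs_coordMean_evalResid_sub_le (hV : HasInfluence V r T) (hG : IsMeanFieldLipschitz b G)
    (i : Fin n) (e : Fin n → ℝ) :
    |coordMean (fun _ => γ) i (evalResid G V i) e - ∫ x, G (V e) (V e i + x) ∂γ| ≤
      b * (T / n) * (1 + |e i|) := by
  have hb := hG.nonneg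
  have hT : 0 ≤ T / n := div_nonneg (hV.nonneg_bound i) (Nat.cast_nonneg n)
  have hint : Integrable (fun x => G (V e) (V e i + x)) γ :=
    Integrable.of_bound (hG.continuous_uncurry.along_snd.comp
      (continuous_const.add continuous_id)).aestronglyMeasurable b
      (ae_of_all _ fun _ => hG.abs_le _ _)
  have habs : Integrable (fun x : ℝ => |x|) γ := integrable_id_stdGaussian.abs
  have hterm : ∀ x, |evalResid G V i (Function.update e i x) - G (V e) (V e i + x)| ≤
      b * (T / n) * (|x| + |e i|) := fun x => by
    refine (hG.abs_sub_le _ _ _ _).trans ?_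
    rw [hV.update_self, Function.update_self, sub_self, abs_zero, zero_add, mul_assoc]
    refine mul_le_mul_of_nonneg_left ((hV.average_abs_update_sub_le e i x).trans ?_) hb
    exact mul_le_mul_of_nonneg_left (abs_sub _ _) hT
  rw [coordMean, ← integral_sub (integrable_comp_update (κ := fun _ => γ)
    (hV.measurable_evalResid hG i) (fun _ => hG.abs_le _ _) e) hint, ← Real.norm_eq_abs]
  calc _ ≤ ∫ x, b * (T / n) * (|x| + |e i|) ∂γ :=
        norm_integral_le_of_norm_le ((habs.add (integrable_const _)).const_mul _)
          (ae_of_all _ hterm)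
    _ = b * (T / n) * (∫ x, |x| ∂γ + |e i|) := by
        rw [integral_const_mul, integral_add habs (integrable_const _)]
        simp
    _ ≤ b * (T / n) * (1 + |e i|) := by
        gcongr
        exact integral_abs_stdGaussian_le

lemma abs_average_evalResid_sub_le (hV : HasInfluence V r T) (hG : IsMeanFieldLipschitz b G)
    (S : Finset (Fin n)) (e : Fin n → ℝ) :
    |(n : ℝ)⁻¹ * ∑ i ∈ S, evalResid G V i e - ∫ z, G (V e) z * mixOn S (V e) z| ≤
      |(n : ℝ)⁻¹ *
        ∑ i ∈ S, (evalResid G V i e - coordMean (fun _ => γ) i (evalResid G V i) e)| +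
      (n : ℝ)⁻¹ * ∑ i ∈ S, b * (T / n) * (1 + |e i|) := by
  have hsplit : ∑ i ∈ S, evalResid G V i e - ∑ i ∈ S, ∫ x, G (V e) (V e i + x) ∂γ =
      ∑ i ∈ S, (evalResid G V i e - coordMean (fun _ => γ) i (evalResid G V i) e) +
        ∑ i ∈ S, (coordMean (fun _ => γ) i (evalResid G V i) e
          - ∫ x, G (V e) (V e i + x) ∂γ) := by
    rw [← Finset.sum_sub_distrib, ← Finset.sum_add_distrib]
    simp
  rw [integral_mul_mixOn S (V e) hG.continuous_uncurry.along_snd (hG.abs_le _), ← mul_sub, hsplit,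
    mul_add]
  refine (abs_add_le _ _).trans (add_le_add_right ?_ _)
  rw [abs_mul, abs_of_nonneg (by positivity)]
  gcongr
  refine (Finset.abs_sum_le_sum_abs _ _).trans ?_
  exact Finset.sum_le_sum fun i _ => hV.abs_coordMean_evalResid_sub_le hG i e

lemma integral_average_const_mul_one_add_abs_le {c : ℝ} (hc : 0 ≤ c) (S : Finset (Fin n)) :
    ∫ e : Fin n → ℝ, (n : ℝ)⁻¹ * ∑ i ∈ S, c * (1 + |e i|) ∂Measure.pi (fun _ => γ) ≤ 2 * c := by
  have habs : ∀ i : Fin n, Integrable (fun e : Fin n → ℝ => |e i|) (Measure.pi fun _ => γ) :=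
    fun i => integrable_abs_eval integrable_id_stdGaussian.abs
  have hint : ∀ i : Fin n, ∫ e : Fin n → ℝ, c * (1 + |e i|) ∂Measure.pi (fun _ => γ) ≤ 2 * c :=
    fun i => by
      rw [integral_const_mul, integral_add (integrable_const _) (habs i), integral_abs_eval,
        integral_const, probReal_univ, one_smul, mul_comm]
      gcongr
      linarith [integral_abs_stdGaussian_le]
  rw [integral_const_mul, integral_finsetSum S fun i _ =>
    (by exact ((integrable_const 1).add (habs i)).const_mul c)]
  refine (le_abs_self _).trans (abs_average_le S (by positivity) fun i _ => ?_)
  rw [abs_of_nonneg (integral_nonneg fun e => by positivity)]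
  exact hint i

lemma abs_evalResid_sub_coordMean_le (hG : IsMeanFieldLipschitz b G) (i : Fin n) (e : Fin n → ℝ) :
    |evalResid G V i e - coordMean (fun _ => γ) i (evalResid G V i) e| ≤ 2 * b :=
  (abs_sub _ _).trans ((add_le_add (hG.abs_le _ _)
    (abs_coordMean_le (fun _ => hG.abs_le _ _) e)).trans_eq (two_mul b).symm)

lemma integral_sq_average_evalResid_le (hV : HasInfluence V r T) (hG : IsMeanFieldLipschitz b G)
    (S : Finset (Fin n)) :
    ∫ e, ((n : ℝ)⁻¹ *
      ∑ i ∈ S, (evalResid G V i e - coordMean (fun _ => γ) i (evalResid G V i) e)) ^ 2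
      ∂Measure.pi (fun _ => γ) ≤ (2 * b) ^ 2 * ((1 + 4 * T) / n) := by
  rcases n.eq_zero_or_pos with rfl | hn
  · simp
  simp only [mul_pow]
  rw [integral_const_mul]
  refine (mul_le_mul_of_nonneg_left (hV.integral_sq_sum_evalResid_le hG S)
    (by positivity)).trans_eq ?_
  field_simp
  ring

lemma integral_abs_average_evalResid_sub_le (hV : HasInfluence V r T) (hT : 0 ≤ T)
    (hG : IsMeanFieldLipschitz b G) (S : Finset (Fin n)) :
    ∫ e, |(n : ℝ)⁻¹ * ∑ i ∈ S, evalResid G V i e - ∫ z, G (V e) z * mixOn S (V e) z|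
      ∂Measure.pi (fun _ => γ) ≤ 2 * b * (√((1 + 4 * T) / n) + T / n) := by
  have hb := hG.nonneg
  set A : (Fin n → ℝ) → ℝ := fun e => (n : ℝ)⁻¹ *
    ∑ i ∈ S, (evalResid G V i e - coordMean (fun _ => γ) i (evalResid G V i) e)
  have hAm : Measurable A := (Finset.measurable_sum S fun i _ =>
    (hV.measurable_evalResid hG i).sub (measurable_coordMean
      (hV.measurable_evalResid hG i))).const_mul _
  have hA : MemLp A ∞ (Measure.pi fun _ => γ) :=
    memLp_top_of_bound hAm.aestronglyMeasurable (2 * b) (ae_of_all _ fun e =>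
      abs_average_le S (by positivity) fun _ _ => abs_evalResid_sub_coordMean_le hG _ e)
  have hAi : Integrable (fun e => |A e|) (Measure.pi fun _ => γ) := (hA.integrable le_top).abs
  have hcorr : Integrable (fun e : Fin n → ℝ => (n : ℝ)⁻¹ * ∑ i ∈ S, b * (T / n) * (1 + |e i|))
      (Measure.pi fun _ => γ) :=
    (integrable_finsetSum S fun i _ => ((integrable_const 1).add (integrable_abs_eval
      (κ := fun _ : Fin n => γ) (j := i) integrable_id_stdGaussian.abs)).const_mul _).const_mul _
  calc _ ≤ ∫ e, |A e| + (n : ℝ)⁻¹ * ∑ i ∈ S, b * (T / n) * (1 + |e i|)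
          ∂Measure.pi (fun _ => γ) :=
        integral_mono_of_nonneg (ae_of_all _ fun _ => abs_nonneg _) (hAi.add hcorr)
          (ae_of_all _ (hV.abs_average_evalResid_sub_le hG S))
    _ ≤ √((2 * b) ^ 2 * ((1 + 4 * T) / n)) + 2 * (b * (T / n)) := by
        rw [integral_add hAi hcorr]
        gcongr
        · exact (integral_abs_le_sqrt_integral_sq (hA.mono_exponent le_top).integrable_sq).trans
            (Real.sqrt_le_sqrt (hV.integral_sq_average_evalResid_le hG S))
        · exact integral_average_const_mul_one_add_abs_le (by positivity) S
    _ = 2 * b * (√((1 + 4 * T) / n) + T / n) := by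
        rw [Real.sqrt_mul (sq_nonneg _), Real.sqrt_sq (by positivity)]
        ring

end HasInfluence

section ResidGap

variable {n : ℕ} {S : Finset (Fin n)} {G H : (Fin n → ℝ) → ℝ → ℝ} {a b c : ℝ}

/-- The deviation of the average of `G v` over the observed points `x i` from its average over the
mixture `mixOn S v`. -/
noncomputable def residGap (S : Finset (Fin n)) (G : (Fin n → ℝ) → ℝ → ℝ) (v x : Fin n → ℝ) : ℝ :=
  (n : ℝ)⁻¹ * ∑ i ∈ S, G v (x i) - ∫ z, G v z * mixOn S v z

/-- A bound, uniform over `a ∈ [0, 1]`, for the deviation `residGap` of the functional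
`(G + a H) ^ 2`. -/
noncomputable def quadGap (S : Finset (Fin n)) (G H : (Fin n → ℝ) → ℝ → ℝ) (v x : Fin n → ℝ) : ℝ :=
  |residGap S (fun v z => G v z * G v z) v x| + 2 * |residGap S (fun v z => G v z * H v z) v x| +
    |residGap S (fun v z => H v z * H v z) v x|

lemma quadGap_nonneg (v x : Fin n → ℝ) : 0 ≤ quadGap S G H v x := by
  unfold quadGap
  positivity

lemma IsMeanFieldLipschitz.abs_residGap_le (hG : IsMeanFieldLipschitz b G) (hn : 0 < n)
    (v x : Fin n → ℝ) : |residGap S G v x| ≤ 2 * b := by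
  have hsum := abs_average_le S (x := fun i => G v (x i)) hG.nonneg fun i _ => hG.abs_le v (x i)
  have hint : |∫ z, G v z * mixOn S v z| ≤ b := by
    calc |∫ z, G v z * mixOn S v z| ≤ ∫ z, b * mixDensity v z := by
          rw [← Real.norm_eq_abs]
          refine norm_integral_le_of_norm_le ((integrable_mixDensity v).const_mul b)
            (ae_of_all _ fun z => ?_)
          rw [Real.norm_eq_abs, abs_mul, abs_of_nonneg (mixOn_nonneg S v z)]
          exact mul_le_mul (hG.abs_le v z) (mixOn_le_mixDensity S v z) (mixOn_nonneg S v z)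
            hG.nonneg
      _ = b := by rw [integral_const_mul, integral_mixDensity v hn, mul_one]
  exact (abs_sub _ _).trans ((add_le_add hsum hint).trans_eq (two_mul b).symm)

lemma IsMeanFieldLipschitz.quadGap_le (hG : IsMeanFieldLipschitz b G)
    (hH : IsMeanFieldLipschitz b H) (hn : 0 < n) (v x : Fin n → ℝ) :
    quadGap S G H v x ≤ 16 * b ^ 2 := by
  have hGG := (hG.mul hG).abs_residGap_le (S := S) hn v x
  have hGH := (hG.mul hH).abs_residGap_le (S := S) hn v x
  have hHH := (hH.mul hH).abs_residGap_le (S := S) hn v x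
  rw [quadGap]
  linarith

lemma IsMeanFieldLipschitz.measurable_residGap (hG : IsMeanFieldLipschitz b G)
    (S : Finset (Fin n)) :
    Measurable fun p : (Fin n → ℝ) × (Fin n → ℝ) => residGap S G p.1 p.2 := by
  have hsum : Continuous fun p : (Fin n → ℝ) × (Fin n → ℝ) =>
      (n : ℝ)⁻¹ * ∑ i ∈ S, G p.1 (p.2 i) :=
    continuous_const.mul (continuous_finsetSum S fun i _ => hG.continuous_uncurry.comp
      (continuous_fst.prodMk ((continuous_apply i).comp continuous_snd)))
  have hint : Measurable fun v : Fin n → ℝ => ∫ z, G v z * mixOn S v z :=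
    (hG.continuous_uncurry.mul
      (continuous_mixOn_uncurry S)).stronglyMeasurable.integral_prod_right'.measurable
  exact hsum.measurable.sub (hint.comp measurable_fst)

lemma IsMeanFieldLipschitz.measurable_quadGap (hG : IsMeanFieldLipschitz b G)
    (hH : IsMeanFieldLipschitz c H) (S : Finset (Fin n)) :
    Measurable fun p : (Fin n → ℝ) × (Fin n → ℝ) => quadGap S G H p.1 p.2 :=
  (((hG.mul hG).measurable_residGap S).abs.add
    (((hG.mul hH).measurable_residGap S).abs.const_mul 2)).add
      ((hH.mul hH).measurable_residGap S).abs

lemma IsMeanFieldLipschitz.integrable_sq_add_mul_mixOn (hG : IsMeanFieldLipschitz b G)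
    (hH : IsMeanFieldLipschitz c H) (S : Finset (Fin n)) (v : Fin n → ℝ) (a : ℝ) :
    Integrable fun z => (G v z + a * H v z) ^ 2 * mixOn S v z := by
  refine ((((hG.mul hG).integrable_mul_mixOn S v).add
    (((hG.mul hH).integrable_mul_mixOn S v).const_mul (2 * a))).add
      (((hH.mul hH).integrable_mul_mixOn S v).const_mul (a ^ 2))).congr (ae_of_all _ fun z => ?_)
  simp only [Pi.add_apply]
  ring

lemma IsMeanFieldLipschitz.integral_sq_add_mul_mixOn_eq (hG : IsMeanFieldLipschitz b G)
    (hH : IsMeanFieldLipschitz c H) (v x : Fin n → ℝ) :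
    ∫ z, (G v z + a * H v z) ^ 2 * mixOn S v z =
      (n : ℝ)⁻¹ * ∑ i ∈ S, (G v (x i) + a * H v (x i)) ^ 2 -
        (residGap S (fun v z => G v z * G v z) v x +
          2 * a * residGap S (fun v z => G v z * H v z) v x +
          a ^ 2 * residGap S (fun v z => H v z * H v z) v x) := by
  have hGG := (hG.mul hG).integrable_mul_mixOn S v
  have hGH := ((hG.mul hH).integrable_mul_mixOn S v).const_mul (2 * a)
  have hHH := ((hH.mul hH).integrable_mul_mixOn S v).const_mul (a ^ 2)
  have hsq : ∀ z, (G v z + a * H v z) ^ 2 =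
      G v z * G v z + 2 * a * (G v z * H v z) + a ^ 2 * (H v z * H v z) := fun z => by ring
  have hint : ∫ z, (G v z + a * H v z) ^ 2 * mixOn S v z =
      (∫ z, G v z * G v z * mixOn S v z) + 2 * a * (∫ z, G v z * H v z * mixOn S v z) +
        a ^ 2 * ∫ z, H v z * H v z * mixOn S v z := by
    rw [← integral_const_mul, ← integral_const_mul, ← integral_add hGG hGH,
      ← integral_add (by exact hGG.add hGH) hHH]
    congr 1 with z
    rw [hsq]
    ring
  rw [hint]
  simp only [residGap, hsq, Finset.sum_add_distrib, ← Finset.mul_sum]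
  ring

lemma IsMeanFieldLipschitz.integral_sq_add_mul_mixOn_le (hG : IsMeanFieldLipschitz b G)
    (hH : IsMeanFieldLipschitz c H) (ha : a ∈ Set.Icc (0 : ℝ) 1) (v x : Fin n → ℝ) :
    ∫ z, (G v z + a * H v z) ^ 2 * mixOn S v z ≤
      (n : ℝ)⁻¹ * ∑ i ∈ S, (G v (x i) + a * H v (x i)) ^ 2 + quadGap S G H v x := by
  have hscale : ∀ {s : ℝ} (y : ℝ), 0 ≤ s → s ≤ 1 → -(s * y) ≤ |y| := fun {s} y h0 h1 =>
    (neg_le_abs _).trans (by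
      rw [abs_mul, abs_of_nonneg h0]
      exact mul_le_of_le_one_left (abs_nonneg y) h1)
  have h1 := neg_le_abs (residGap S (fun v z => G v z * G v z) v x)
  have h2 := hscale (residGap S (fun v z => G v z * H v z) v x) ha.1 ha.2
  have h3 := hscale (residGap S (fun v z => H v z * H v z) v x) (sq_nonneg a)
    (pow_le_one₀ ha.1 ha.2)
  rw [hG.integral_sq_add_mul_mixOn_eq hH v x, quadGap]
  linarith

end ResidGap

section StatErr

variable {n : ℕ} {S : Finset (Fin n)} {K η a : ℝ}

/-- The statistic which controls `∫ g d(F - N(0, (1 - a) / a))`: the score defect at the observed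
points, the error made in replacing them by the mixture, and the mass of the mixture in the
tails. -/
noncomputable def statErr (S : Finset (Fin n)) (K η : ℝ) (v : Fin n → ℝ) (a : ℝ)
    (x : Fin n → ℝ) : ℝ :=
  (n : ℝ)⁻¹ * ∑ i ∈ S, scoreDefect v a (x i) ^ 2 + quadGap S (regScore K η) (regId K η) v x +
    ∫ z, (1 - cutoff K z) * mixDensity v z

lemma measurable_integral_mul_mixOn {h : ℝ → ℝ} (hh : Continuous h) (S : Finset (Fin n)) :
    Measurable fun v : Fin n → ℝ => ∫ z, h z * mixOn S v z :=
  ((hh.comp continuous_snd).mul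
    (continuous_mixOn_uncurry S)).stronglyMeasurable.integral_prod_right'.measurable

lemma measurable_scoreDefect :
    Measurable fun p : (Fin n → ℝ) × ℝ × ℝ => scoreDefect p.1 p.2.1 p.2.2 := by
  have hvz : Measurable fun p : (Fin n → ℝ) × ℝ × ℝ => (p.1, p.2.2) := by fun_prop
  exact ((continuous_mixSlope_uncurry.measurable.comp hvz).div
    ((continuous_mixOn_uncurry Finset.univ).measurable.comp hvz)).add (by fun_prop)

lemma average_sq_scoreDefect_nonneg (v x : Fin n → ℝ) :
    0 ≤ (n : ℝ)⁻¹ * ∑ i ∈ S, scoreDefect v a (x i) ^ 2 :=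
  mul_nonneg (by positivity) (Finset.sum_nonneg fun _ _ => sq_nonneg _)

lemma integral_one_sub_cutoff_mul_mixDensity_nonneg (v : Fin n → ℝ) :
    0 ≤ ∫ z, (1 - cutoff K z) * mixDensity v z :=
  integral_nonneg fun z =>
    mul_nonneg (sub_nonneg.2 (cutoff_le_one K z)) (mixDensity_nonneg v z)

lemma integral_abs_scoreDefect_mul_truncMixture_le_sqrt_statErr (hn : 0 < n) (hK : 0 ≤ K)
    (hη : 0 < η) (hη1 : η ≤ 1) (ha : a ∈ Set.Icc (0 : ℝ) 1) (v x : Fin n → ℝ) :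
    ∫ z, |scoreDefect v a z * truncMixture S K η v z| ≤ √(statErr S K η v a x) := by
  have hG := isMeanFieldLipschitz_regScore (n := n) hK hη hη1
  have hH := isMeanFieldLipschitz_regId (n := n) hK hη hη1
  refine (integral_abs_scoreDefect_mul_truncMixture_le S v hn a
    (hG.integrable_sq_add_mul_mixOn hH S v a)).trans (Real.sqrt_le_sqrt ?_)
  calc ∫ z, (regScore K η v z + a * regId K η v z) ^ 2 * mixOn S v z
      ≤ (n : ℝ)⁻¹ * ∑ i ∈ S, (regScore K η v (x i) + a * regId K η v (x i)) ^ 2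
          + quadGap S (regScore K η) (regId K η) v x := hG.integral_sq_add_mul_mixOn_le hH ha v x
    _ ≤ (n : ℝ)⁻¹ * ∑ i ∈ S, scoreDefect v a (x i) ^ 2
          + quadGap S (regScore K η) (regId K η) v x := by
        refine add_le_add_left (mul_le_mul_of_nonneg_left ?_ (by positivity)) _
        exact Finset.sum_le_sum fun i _ => sq_regScore_add_mul_regId_le v hn hη.le a (x i)
    _ ≤ statErr S K η v a x :=
        le_add_of_nonneg_right (integral_one_sub_cutoff_mul_mixDensity_nonneg v)

lemma IsScoreMargin.abs_integral_sub_lt {g : ℝ → ℝ} {I : Set ℝ} {e δ : ℝ}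
    (h : IsScoreMargin g I e δ) (hδ : 0 < δ) (hI : I ⊆ Set.Icc 0 1) (hn : 0 < n) (hK : 0 ≤ K)
    (hη : 0 < η) (hη1 : η ≤ 1) (ha : a ∈ I) {v x : Fin n → ℝ}
    (hloss : (n : ℝ)⁻¹ * Sᶜ.card + 2 * (K + 1) * η ≤ δ / 2)
    (herr : statErr S K η v a x < min (δ ^ 2) (δ / 2)) :
    |∫ y, g y ∂(empirical v) - ∫ y, g y ∂(gaussianReal 0 (Real.toNNReal ((1 - a) / a)))| < e := by
  refine h v a (truncMixture S K η v) hn ha (isMinorant_truncMixture S v hη.le) ?_ ?_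
  · refine (integral_abs_scoreDefect_mul_truncMixture_le_sqrt_statErr hn hK hη hη1 (hI ha) v
      x).trans_lt ?_
    exact (Real.sqrt_lt' hδ).2 (herr.trans_le (min_le_left _ _))
  · have htail : ∫ z, (1 - cutoff K z) * mixDensity v z ≤ statErr S K η v a x :=
      le_add_of_nonneg_left (add_nonneg (average_sq_scoreDefect_nonneg v x) (quadGap_nonneg v x))
    have hmass := one_sub_integral_truncMixture_le S v hn hK hη
    linarith [herr.trans_le (min_le_right _ _)]

end StatErr

section Pointwise

variable {Ω : Type*} {n : ℕ} {μ ε : Fin n → Ω → ℝ} {mt : Fin n → (Fin n → ℝ) → ℝ}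

/-- The centred signal `ν` as a function of the realized signal `m` and noise `e`. -/
noncomputable def centredOf (mt : Fin n → (Fin n → ℝ) → ℝ) (m e : Fin n → ℝ) : Fin n → ℝ :=
  fun i => m i - mt i (m + e)

lemma centred_eq_centredOf (ω : Ω) :
    centred μ ε mt ω = centredOf mt (fun i => μ i ω) (fun i => ε i ω) := rfl

lemma resid_eq_centred_add (ω : Ω) (i : Fin n) :
    resid μ ε mt ω i = centred μ ε mt ω i + ε i ω := by
  simp only [resid, centred, obs]
  ring

lemma measurable_centredOf (hmt : ∀ i, Measurable (mt i)) :
    Measurable fun p : (Fin n → ℝ) × (Fin n → ℝ) => centredOf mt p.1 p.2 :=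
  measurable_pi_lambda _ fun i => ((measurable_pi_apply i).comp measurable_fst).sub
    ((hmt i).comp (measurable_fst.add measurable_snd))

lemma hasInfluence_centredOf {r : Fin n → Fin n → ℝ} {T : ℝ} (hmt : ∀ i, Measurable (mt i))
    (hdep : ∀ i, DependsOn (mt i) {j | j ≠ i})
    (hlip : ∀ i j, j ≠ i → ∀ y d, |mt i (Function.update y j (y j + d)) - mt i y| ≤ r i j * |d|)
    (hsum : ∀ j, ∑ i ∈ Finset.univ.erase j, r i j ≤ T) (m : Fin n → ℝ) :
    HasInfluence (centredOf mt m) (fun i j => if j = i then 0 else r i j) T where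
  measurable := (measurable_centredOf hmt).comp measurable_prodMk_left
  nonneg i j := by
    split_ifs with hji
    · exact le_rfl
    · simpa using (abs_nonneg _).trans (hlip i j hji 0 1)
  self i := if_pos rfl
  abs_update_sub_le i j e y := by
    have hupd : m + Function.update e j y =
        Function.update (m + e) j ((m + e) j + (y - e j)) := by
      ext k
      rcases eq_or_ne k j with rfl | hk
      · simp
      · simp [hk]
    simp only [centredOf, sub_sub_sub_cancel_left, abs_sub_comm (mt i (m + e)), hupd]
    split_ifs with hji
    · rw [hji, hdep i fun k hk => Function.update_of_ne hk _ _, sub_self, abs_zero, zero_mul]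
    · exact hlip i j hji _ _
  sum_le j := by
    refine (le_of_eq ?_).trans (hsum j)
    rw [← Finset.add_sum_erase _ _ (Finset.mem_univ j), if_pos rfl, zero_add]
    exact Finset.sum_congr rfl fun i hi => if_neg (Finset.ne_of_mem_erase hi).symm

end Pointwise

lemma HasInfluence.integral_integral_mul_mixOn {n : ℕ} {V : (Fin n → ℝ) → Fin n → ℝ}
    {r : Fin n → Fin n → ℝ} {T b : ℝ} {h : ℝ → ℝ} (hV : HasInfluence V r T) (hh : Continuous h)
    (hb : ∀ z, |h z| ≤ b) (S : Finset (Fin n)) :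
    ∫ e, (∫ z, h z * mixOn S (V e) z) ∂Measure.pi (fun _ => γ) =
      ∫ e, (n : ℝ)⁻¹ * ∑ i ∈ S, h (V e i + e i) ∂Measure.pi (fun _ => γ) := by
  have hres : ∀ i, Measurable fun e : Fin n → ℝ => h (V e i + e i) := fun i =>
    hh.measurable.comp (((measurable_pi_apply i).comp hV.measurable).add (measurable_pi_apply i))
  have hint : ∀ i, Integrable (fun e : Fin n → ℝ => h (V e i + e i)) (Measure.pi fun _ => γ) :=
    fun i => Integrable.of_bound (hres i).aestronglyMeasurable b (ae_of_all _ fun _ => hb _)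
  have hcoord : ∀ e, ∫ z, h z * mixOn S (V e) z =
      (n : ℝ)⁻¹ * ∑ i ∈ S, coordMean (fun _ => γ) i (fun e => h (V e i + e i)) e := fun e => by
    simp only [integral_mul_mixOn S (V e) hh hb, coordMean, hV.update_self, Function.update_self]
  simp only [hcoord]
  rw [integral_const_mul, integral_const_mul, integral_finsetSum S fun i _ => hint i,
    integral_finsetSum S fun i _ => Integrable.of_bound
      (measurable_coordMean (hres i)).aestronglyMeasurable b
        (ae_of_all _ (abs_coordMean_le fun _ => hb _))]
  simp only [integral_coordMean (hint _)]

section Model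

variable {Ω : Type*} [MeasurableSpace Ω] {P : Measure Ω} {n : ℕ} {μ ε : Fin n → Ω → ℝ}
  {mt mh : Fin n → (Fin n → ℝ) → ℝ} {α : (Fin n → ℝ) → ℝ} {S : Finset (Fin n)}

lemma measurable_obs (hm : IsSignalPlusNoise P μ ε) : Measurable fun ω => obs μ ε ω :=
  measurable_pi_lambda _ fun i => (hm.measurable_signal i).add (hm.measurable_noise i)

lemma measurable_centred (hm : IsSignalPlusNoise P μ ε) (hmt : ∀ i, Measurable (mt i)) :
    Measurable fun ω => centred μ ε mt ω :=
  measurable_pi_lambda _ fun i =>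
    (hm.measurable_signal i).sub ((hmt i).comp (measurable_obs hm))

lemma measurable_resid (hm : IsSignalPlusNoise P μ ε) (hmt : ∀ i, Measurable (mt i)) :
    Measurable fun ω => resid μ ε mt ω :=
  measurable_pi_lambda _ fun i =>
    ((measurable_pi_apply i).comp (measurable_obs hm)).sub ((hmt i).comp (measurable_obs hm))

section Average

variable [IsProbabilityMeasure P]

lemma IsSignalPlusNoise.lintegral_eq (hm : IsSignalPlusNoise P μ ε)
    {F : (Fin n → ℝ) × (Fin n → ℝ) → ℝ≥0∞} (hF : Measurable F) :
    ∫⁻ ω, F (fun i => μ i ω, fun i => ε i ω) ∂P =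
      ∫⁻ m, ∫⁻ e, F (m, e) ∂(Measure.pi fun _ => γ) ∂(P.map fun ω i => μ i ω) := by
  have hμ : Measurable fun ω i => μ i ω := measurable_pi_lambda _ hm.measurable_signal
  have hε : Measurable fun ω i => ε i ω := measurable_pi_lambda _ hm.measurable_noise
  have hjoint := (indepFun_iff_map_prod_eq_prod_map_map hμ.aemeasurable hε.aemeasurable).1 hm.indep
  have hnoise := (iIndepFun_iff_map_fun_eq_pi_map
    fun i => (hm.measurable_noise i).aemeasurable).1 hm.noise_indep
  simp_rw [hm.noise_gaussian] at hnoise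
  rw [hnoise] at hjoint
  rw [← lintegral_prod _ hF.aemeasurable, ← hjoint, lintegral_map hF (hμ.prodMk hε)]

lemma IsSignalPlusNoise.lintegral_ofReal_mono (hm : IsSignalPlusNoise P μ ε)
    {F F' : (Fin n → ℝ) × (Fin n → ℝ) → ℝ} {b b' : ℝ} (hF : Measurable F) (hF' : Measurable F')
    (hF0 : ∀ p, 0 ≤ F p) (hF0' : ∀ p, 0 ≤ F' p) (hFb : ∀ p, F p ≤ b) (hFb' : ∀ p, F' p ≤ b')
    (h : ∀ m, ∫ e, F (m, e) ∂(Measure.pi fun _ => γ) ≤ ∫ e, F' (m, e) ∂(Measure.pi fun _ => γ)) :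
    ∫⁻ ω, ENNReal.ofReal (F (fun i => μ i ω, fun i => ε i ω)) ∂P ≤
      ∫⁻ ω, ENNReal.ofReal (F' (fun i => μ i ω, fun i => ε i ω)) ∂P := by
  have hint : ∀ {H : (Fin n → ℝ) × (Fin n → ℝ) → ℝ} {c : ℝ} (m : Fin n → ℝ), Measurable H →
      (∀ p, 0 ≤ H p) → (∀ p, H p ≤ c) →
      Integrable (fun e => H (m, e)) (Measure.pi fun _ => γ) := fun {H c} m hH h0 hc =>
    Integrable.of_bound (hH.comp measurable_prodMk_left).aestronglyMeasurable c
      (ae_of_all _ fun e => by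
        rw [Real.norm_eq_abs, abs_of_nonneg (h0 _)]
        exact hc _)
  rw [hm.lintegral_eq hF.ennreal_ofReal, hm.lintegral_eq hF'.ennreal_ofReal]
  refine lintegral_mono fun m => ?_
  rw [← ofReal_integral_eq_lintegral_ofReal (hint m hF hF0 hFb) (ae_of_all _ fun _ => hF0 _),
    ← ofReal_integral_eq_lintegral_ofReal (hint m hF' hF0' hFb') (ae_of_all _ fun _ => hF0' _)]
  exact ENNReal.ofReal_le_ofReal (h m)

variable {r : Fin n → Fin n → ℝ} {T : ℝ}

lemma integral_quadGap_le {V : (Fin n → ℝ) → Fin n → ℝ} {G H : (Fin n → ℝ) → ℝ → ℝ} {b : ℝ}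
    (hV : HasInfluence V r T) (hT : 0 ≤ T) (hn : 0 < n) (hG : IsMeanFieldLipschitz b G)
    (hH : IsMeanFieldLipschitz b H) (S : Finset (Fin n)) :
    ∫ e, quadGap S G H (V e) (fun i => V e i + e i) ∂(Measure.pi fun _ => γ) ≤
      16 * b ^ 2 * (√((1 + 4 * T) / n) + T / n) := by
  have hres : Measurable fun e => (V e, fun i => V e i + e i) :=
    hV.measurable.prodMk (measurable_pi_lambda _ fun i =>
      ((measurable_pi_apply i).comp hV.measurable).add (measurable_pi_apply i))
  have hint : ∀ {J : (Fin n → ℝ) → ℝ → ℝ} {c : ℝ}, IsMeanFieldLipschitz c J →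
      Integrable (fun e => |residGap S J (V e) (fun i => V e i + e i)|)
        (Measure.pi fun _ => γ) := fun {J c} hJ =>
    (Integrable.of_bound ((hJ.measurable_residGap S).comp hres).aestronglyMeasurable (2 * c)
      (ae_of_all _ fun e => hJ.abs_residGap_le hn _ _)).abs
  have hgap : ∀ {J : (Fin n → ℝ) → ℝ → ℝ}, IsMeanFieldLipschitz (2 * (b * b)) J →
      ∫ e, |residGap S J (V e) (fun i => V e i + e i)| ∂(Measure.pi fun _ => γ) ≤
        2 * (2 * (b * b)) * (√((1 + 4 * T) / n) + T / n) := fun hJ =>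
    hV.integral_abs_average_evalResid_sub_le hT hJ S
  simp only [quadGap]
  rw [integral_add (by exact (hint (hG.mul hG)).add ((hint (hG.mul hH)).const_mul 2))
      (hint (hH.mul hH)),
    integral_add (hint (hG.mul hG)) ((hint (hG.mul hH)).const_mul 2), integral_const_mul]
  linarith [hgap (hG.mul hG), hgap (hG.mul hH), hgap (hH.mul hH)]

end Average

end Model

section Model

variable {Ω : Type*} [MeasurableSpace Ω] {P : Measure Ω} {n : ℕ} {μ ε : Fin n → Ω → ℝ}
  {mt mh : Fin n → (Fin n → ℝ) → ℝ} {α : (Fin n → ℝ) → ℝ} {S : Finset (Fin n)}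

section Average

variable [IsProbabilityMeasure P] {r : Fin n → Fin n → ℝ} {T : ℝ}

lemma lintegral_quadGap_le (hm : IsSignalPlusNoise P μ ε) (hn : 0 < n)
    (hmt : ∀ i, Measurable (mt i)) (hV : ∀ m, HasInfluence (centredOf mt m) r T) (hT : 0 ≤ T)
    {G H : (Fin n → ℝ) → ℝ → ℝ} {b : ℝ} (hG : IsMeanFieldLipschitz b G)
    (hH : IsMeanFieldLipschitz b H) :
    ∫⁻ ω, ENNReal.ofReal (quadGap S G H (centred μ ε mt ω) (resid μ ε mt ω)) ∂P ≤
      ENNReal.ofReal (16 * b ^ 2 * (√((1 + 4 * T) / n) + T / n)) := by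
  have hcen := measurable_centredOf hmt
  set B : ℝ := 16 * b ^ 2 * (√((1 + 4 * T) / n) + T / n)
  have hB : 0 ≤ B := by positivity
  have hres : Measurable fun p : (Fin n → ℝ) × (Fin n → ℝ) =>
      (centredOf mt p.1 p.2, fun i => centredOf mt p.1 p.2 i + p.2 i) :=
    hcen.prodMk (measurable_pi_lambda _ fun i =>
      ((measurable_pi_apply i).comp hcen).add ((measurable_pi_apply i).comp measurable_snd))
  have hmeas := (hG.measurable_quadGap hH S).comp hres
  have hmono := hm.lintegral_ofReal_mono (F' := fun _ => B) hmeas measurable_const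
    (fun _ => quadGap_nonneg _ _) (fun _ => hB) (fun _ => hG.quadGap_le hH hn _ _)
    (fun _ => le_rfl) (fun m => by simpa [B] using integral_quadGap_le (hV m) hT hn hG hH S)
  rw [lintegral_const, measure_univ, mul_one] at hmono
  simpa only [Function.comp_apply, ← centred_eq_centredOf, ← resid_eq_centred_add] using hmono

lemma lintegral_integral_mul_mixOn_le (hm : IsSignalPlusNoise P μ ε)
    (hmt : ∀ i, Measurable (mt i)) (hV : ∀ m, HasInfluence (centredOf mt m) r T) {h : ℝ → ℝ}
    (hh : Continuous h) (hn : 0 < n) (h0 : ∀ z, 0 ≤ h z) (h1 : ∀ z, h z ≤ 1) :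
    ∫⁻ ω, ENNReal.ofReal (∫ z, h z * mixOn S (centred μ ε mt ω) z) ∂P ≤
      ∫⁻ ω, ENNReal.ofReal ((n : ℝ)⁻¹ * ∑ i ∈ S, h (resid μ ε mt ω i)) ∂P := by
  have habs : ∀ z, |h z| ≤ 1 := fun z => (abs_of_nonneg (h0 z)).trans_le (h1 z)
  have hcen := measurable_centredOf hmt
  have hle : ∀ v : Fin n → ℝ, ∫ z, h z * mixOn S v z ≤ 1 := fun v => by
    rw [← integral_mixDensity v hn]
    refine integral_mono_of_nonneg (ae_of_all _ fun z => mul_nonneg (h0 z) (mixOn_nonneg S v z))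
      (integrable_mixDensity v) (ae_of_all _ fun z => ?_)
    exact (mul_le_of_le_one_left (mixOn_nonneg S v z) (h1 z)).trans (mixOn_le_mixDensity S v z)
  have hmono := hm.lintegral_ofReal_mono
    (F' := fun p => (n : ℝ)⁻¹ * ∑ i ∈ S, h (centredOf mt p.1 p.2 i + p.2 i))
    ((measurable_integral_mul_mixOn hh S).comp hcen)
    ((Finset.measurable_sum S fun i _ => hh.measurable.comp
      (((measurable_pi_apply i).comp hcen).add
        ((measurable_pi_apply i).comp measurable_snd))).const_mul _)
    (fun p => integral_nonneg fun z => mul_nonneg (h0 z) (mixOn_nonneg S _ z))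
    (fun p => mul_nonneg (by positivity) (Finset.sum_nonneg fun i _ => h0 _))
    (fun p => hle _)
    (fun p => (le_abs_self _).trans (abs_average_le S zero_le_one fun i _ => habs _))
    (fun m => ((hV m).integral_integral_mul_mixOn hh habs S).le)
  simpa [← centred_eq_centredOf, ← resid_eq_centred_add] using hmono

lemma lintegral_integral_one_sub_cutoff_mul_mixDensity_le (hm : IsSignalPlusNoise P μ ε)
    (hn : 0 < n) (hmt : ∀ i, Measurable (mt i))
    (hV : ∀ m, HasInfluence (centredOf mt m) r T) (K : ℝ) :
    ∫⁻ ω, ENNReal.ofReal (∫ z, (1 - cutoff K z) * mixDensity (centred μ ε mt ω) z) ∂P ≤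
      ENNReal.ofReal (1 / (n : ℝ) * ∑ i, P.real {ω | K < |resid μ ε mt ω i|}) := by
  have hset : ∀ i, MeasurableSet {ω | K < |resid μ ε mt ω i|} := fun i =>
    measurableSet_lt measurable_const ((measurable_pi_apply i).comp (measurable_resid hm hmt)).abs
  have hind : ∀ i ω, 1 - cutoff K (resid μ ε mt ω i) ≤
      {ω | K < |resid μ ε mt ω i|}.indicator 1 ω := fun i ω => by
    rcases le_or_gt |resid μ ε mt ω i| K with h | h
    · rw [cutoff_eq_one h, sub_self]
      exact Set.indicator_nonneg (fun _ _ => zero_le_one) _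
    · rw [Set.indicator_of_mem (by exact h)]
      exact sub_le_self _ (cutoff_nonneg K _)
  have hint : ∀ i, Integrable ({ω | K < |resid μ ε mt ω i|}.indicator (1 : Ω → ℝ)) P := fun i =>
    (integrable_const 1).indicator (hset i)
  calc ∫⁻ ω, ENNReal.ofReal (∫ z, (1 - cutoff K z) * mixDensity (centred μ ε mt ω) z) ∂P
      ≤ ∫⁻ ω, ENNReal.ofReal ((n : ℝ)⁻¹ * ∑ i, (1 - cutoff K (resid μ ε mt ω i))) ∂P :=
        lintegral_integral_mul_mixOn_le hm hmt hV (continuous_const.sub (continuous_cutoff K)) hn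
          (fun z => sub_nonneg.2 (cutoff_le_one K z)) (fun z => sub_le_self _ (cutoff_nonneg K z))
    _ ≤ ∫⁻ ω, ENNReal.ofReal ((n : ℝ)⁻¹ *
          ∑ i, {ω | K < |resid μ ε mt ω i|}.indicator 1 ω) ∂P := by
        gcongr with ω i
        exact hind i ω
    _ = ENNReal.ofReal (1 / (n : ℝ) * ∑ i, P.real {ω | K < |resid μ ε mt ω i|}) := by
        rw [← ofReal_integral_eq_lintegral_ofReal
            ((integrable_finsetSum _ fun i _ => hint i).const_mul _)
            (ae_of_all _ fun ω => mul_nonneg (by positivity) (Finset.sum_nonneg fun i _ =>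
              Set.indicator_nonneg (fun _ _ => zero_le_one) _)),
          integral_const_mul, integral_finsetSum _ fun i _ => hint i]
        simp only [integral_indicator_one (hset _), one_div]

end Average

section Score

lemma scoreDefect_resid_eq {Ω : Type*} {n : ℕ} {μ ε : Fin n → Ω → ℝ}
    {mt : Fin n → (Fin n → ℝ) → ℝ} (a : ℝ) (ω : Ω) (i : Fin n) :
    scoreDefect (centred μ ε mt ω) a (resid μ ε mt ω i) =
      improved μ ε mt ω i - (a * mt i (obs μ ε ω) + (1 - a) * obs μ ε ω i) := by
  rw [improved, oracle_eq]
  simp only [scoreDefect, resid]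
  ring

lemma average_sq_scoreDefect_resid_le {Ω : Type*} {n : ℕ} {μ ε : Fin n → Ω → ℝ}
    {mt : Fin n → (Fin n → ℝ) → ℝ} (S : Finset (Fin n)) (a : ℝ) (b : Fin n → ℝ) (ω : Ω) :
    (n : ℝ)⁻¹ * ∑ i ∈ S, scoreDefect (centred μ ε mt ω) a (resid μ ε mt ω i) ^ 2 ≤
      2 * ((n : ℝ)⁻¹ * ∑ i, (improved μ ε mt ω i - b i) ^ 2) +
        2 * ((n : ℝ)⁻¹ * ∑ i ∈ S,
          (b i - (a * mt i (obs μ ε ω) + (1 - a) * obs μ ε ω i)) ^ 2) := by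
  have hterm : ∀ i, scoreDefect (centred μ ε mt ω) a (resid μ ε mt ω i) ^ 2 ≤
      2 * (improved μ ε mt ω i - b i) ^ 2 +
        2 * (b i - (a * mt i (obs μ ε ω) + (1 - a) * obs μ ε ω i)) ^ 2 := fun i => by
    rw [scoreDefect_resid_eq, ← sub_add_sub_cancel _ (b i), ← mul_add]
    exact add_sq_le
  have hsub : ∑ i ∈ S, (improved μ ε mt ω i - b i) ^ 2 ≤
      ∑ i, (improved μ ε mt ω i - b i) ^ 2 :=
    Finset.sum_le_univ_sum_of_nonneg fun _ => sq_nonneg _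
  rw [mul_left_comm 2, mul_left_comm 2, ← mul_add]
  refine mul_le_mul_of_nonneg_left ((Finset.sum_le_sum fun i _ => hterm i).trans ?_)
    (by positivity)
  rw [Finset.sum_add_distrib, ← Finset.mul_sum, ← Finset.mul_sum]
  linarith

lemma lintegral_average_le {X : Type*} [MeasurableSpace X] {P : Measure X} {n : ℕ}
    {f : Fin n → X → ℝ} (hf : ∀ i, Measurable (f i)) (hf0 : ∀ i x, 0 ≤ f i x)
    {S : Finset (Fin n)} {B : ℝ≥0∞}
    (hB : ∀ i ∈ S, ∫⁻ x, ENNReal.ofReal (f i x) ∂P ≤ B) :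
    ∫⁻ x, ENNReal.ofReal ((n : ℝ)⁻¹ * ∑ i ∈ S, f i x) ∂P ≤ B := by
  rcases n.eq_zero_or_pos with rfl | hn
  · simp
  have hn0 : (n : ℝ≥0∞) ≠ 0 := by exact_mod_cast hn.ne'
  have hcard : (S.card : ℝ≥0∞) ≤ n := by exact_mod_cast card_finset_fin_le S
  simp only [ENNReal.ofReal_mul (inv_nonneg.2 (Nat.cast_nonneg n)),
    ENNReal.ofReal_sum_of_nonneg fun i _ => hf0 i _]
  rw [lintegral_const_mul' _ _ ENNReal.ofReal_ne_top,
    lintegral_finsetSum _ fun i _ => (hf i).ennreal_ofReal,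
    ENNReal.ofReal_inv_of_pos (by positivity), ENNReal.ofReal_natCast]
  calc (n : ℝ≥0∞)⁻¹ * ∑ i ∈ S, ∫⁻ x, ENNReal.ofReal (f i x) ∂P
      ≤ (n : ℝ≥0∞)⁻¹ * (n * B) := by
        gcongr
        refine (Finset.sum_le_card_nsmul _ _ _ hB).trans ?_
        rw [nsmul_eq_mul]
        gcongr
    _ = B := by rw [← mul_assoc, ENNReal.inv_mul_cancel hn0 (by simp), one_mul]

lemma lintegral_average_sq_scoreDefect_le (hm : IsSignalPlusNoise P μ ε)
    (hmt : ∀ i, Measurable (mt i)) (hmh : ∀ i, Measurable (mh i)) (hα : Measurable α)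
    {B : ℝ≥0∞} (hB : ∀ i ∈ S, ∫⁻ ω, ENNReal.ofReal ((mh i (obs μ ε ω) -
      (α (obs μ ε ω) * mt i (obs μ ε ω) + (1 - α (obs μ ε ω)) * obs μ ε ω i)) ^ 2) ∂P ≤ B) :
    ∫⁻ ω, ENNReal.ofReal ((n : ℝ)⁻¹ * ∑ i ∈ S,
        scoreDefect (centred μ ε mt ω) (α (obs μ ε ω)) (resid μ ε mt ω i) ^ 2) ∂P ≤
      2 * ((n : ℝ≥0∞)⁻¹ * ∫⁻ ω, ENNReal.ofReal
        (∑ i, (improved μ ε mt ω i - mh i (obs μ ε ω)) ^ 2) ∂P) + 2 * B := by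
  rcases n.eq_zero_or_pos with rfl | hn
  · simp
  have hobs := measurable_obs hm
  set R : Fin n → Ω → ℝ := fun i ω => (mh i (obs μ ε ω) -
    (α (obs μ ε ω) * mt i (obs μ ε ω) + (1 - α (obs μ ε ω)) * obs μ ε ω i)) ^ 2
  have hR : ∀ i, Measurable (R i) := fun i => by
    have hαobs := hα.comp hobs
    exact (((hmh i).comp hobs).sub ((hαobs.mul ((hmt i).comp hobs)).add
      ((measurable_const.sub hαobs).mul ((measurable_pi_apply i).comp hobs)))).pow_const 2
  have hR0 : ∀ i ω, 0 ≤ R i ω := fun i ω => sq_nonneg _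
  have hinv : (n : ℝ≥0∞)⁻¹ = ENNReal.ofReal (n : ℝ)⁻¹ := by
    rw [ENNReal.ofReal_inv_of_pos (by positivity), ENNReal.ofReal_natCast]
  calc _ ≤ ∫⁻ ω, (2 * ((n : ℝ≥0∞)⁻¹ * ENNReal.ofReal
          (∑ i, (improved μ ε mt ω i - mh i (obs μ ε ω)) ^ 2)) +
          2 * ENNReal.ofReal ((n : ℝ)⁻¹ * ∑ i ∈ S, R i ω)) ∂P := by
        refine lintegral_mono fun ω => (ENNReal.ofReal_le_ofReal
          (average_sq_scoreDefect_resid_le S _ (fun i => mh i (obs μ ε ω)) ω)).trans ?_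
        refine ENNReal.ofReal_add_le.trans_eq ?_
        rw [ENNReal.ofReal_mul zero_le_two, ENNReal.ofReal_mul zero_le_two,
          ENNReal.ofReal_mul (inv_nonneg.2 (Nat.cast_nonneg n)), ENNReal.ofReal_ofNat, hinv]
    _ ≤ _ := by
        rw [lintegral_add_right _ (((Finset.measurable_sum S fun i _ =>
            hR i).const_mul _).ennreal_ofReal.const_mul 2),
          lintegral_const_mul' _ _ ENNReal.ofNat_ne_top,
          lintegral_const_mul' _ _ (hinv ▸ ENNReal.ofReal_ne_top),
          lintegral_const_mul' _ _ ENNReal.ofNat_ne_top]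
        gcongr
        exact lintegral_average_le hR hR0 hB

end Score

section StatErr

lemma measurable_average_sq_scoreDefect (hm : IsSignalPlusNoise P μ ε)
    (hmt : ∀ i, Measurable (mt i)) (hα : Measurable α) (S : Finset (Fin n)) :
    Measurable fun ω => (n : ℝ)⁻¹ * ∑ i ∈ S,
      scoreDefect (centred μ ε mt ω) (α (obs μ ε ω)) (resid μ ε mt ω i) ^ 2 :=
  (Finset.measurable_sum S fun i _ => (measurable_scoreDefect.comp
    ((measurable_centred hm hmt).prodMk ((hα.comp (measurable_obs hm)).prodMk
      ((measurable_pi_apply i).comp (measurable_resid hm hmt))))).pow_const 2).const_mul _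

variable {K η : ℝ}

lemma measurable_quadGap_regScore_regId (hm : IsSignalPlusNoise P μ ε)
    (hmt : ∀ i, Measurable (mt i)) (hK : 0 ≤ K) (hη : 0 < η) (hη1 : η ≤ 1)
    (S : Finset (Fin n)) :
    Measurable fun ω => quadGap S (regScore K η) (regId K η) (centred μ ε mt ω)
      (resid μ ε mt ω) := by
  have hgap := ((isMeanFieldLipschitz_regScore hK hη hη1).measurable_quadGap
    (isMeanFieldLipschitz_regId hK hη hη1) S).comp
      ((measurable_centred hm hmt).prodMk (measurable_resid hm hmt))
  simpa only [Function.comp_def] using hgap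

lemma measurable_integral_one_sub_cutoff_mul_mixDensity (hm : IsSignalPlusNoise P μ ε)
    (hmt : ∀ i, Measurable (mt i)) (K : ℝ) :
    Measurable fun ω => ∫ z, (1 - cutoff K z) * mixDensity (centred μ ε mt ω) z :=
  (measurable_integral_mul_mixOn (continuous_const.sub (continuous_cutoff K)) Finset.univ).comp
    (measurable_centred hm hmt)

lemma measurable_statErr (hm : IsSignalPlusNoise P μ ε) (hmt : ∀ i, Measurable (mt i))
    (hα : Measurable α) (hK : 0 ≤ K) (hη : 0 < η) (hη1 : η ≤ 1) (S : Finset (Fin n)) :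
    Measurable fun ω =>
      statErr S K η (centred μ ε mt ω) (α (obs μ ε ω)) (resid μ ε mt ω) :=
  ((measurable_average_sq_scoreDefect hm hmt hα S).add
    (measurable_quadGap_regScore_regId hm hmt hK hη hη1 S)).add
      (measurable_integral_one_sub_cutoff_mul_mixDensity hm hmt K)

lemma lintegral_statErr_le [IsProbabilityMeasure P] {r : Fin n → Fin n → ℝ} {T : ℝ}
    (hm : IsSignalPlusNoise P μ ε) (hn : 0 < n) (hmt : ∀ i, Measurable (mt i))
    (hV : ∀ m, HasInfluence (centredOf mt m) r T) (hT : 0 ≤ T) (hmh : ∀ i, Measurable (mh i))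
    (hα : Measurable α) {B : ℝ≥0∞}
    (hB : ∀ i ∈ S, ∫⁻ ω, ENNReal.ofReal ((mh i (obs μ ε ω) -
      (α (obs μ ε ω) * mt i (obs μ ε ω) + (1 - α (obs μ ε ω)) * obs μ ε ω i)) ^ 2) ∂P ≤ B)
    (hK : 0 ≤ K) (hη : 0 < η) (hη1 : η ≤ 1) :
    ∫⁻ ω, ENNReal.ofReal
        (statErr S K η (centred μ ε mt ω) (α (obs μ ε ω)) (resid μ ε mt ω)) ∂P ≤
      2 * ((n : ℝ≥0∞)⁻¹ * ∫⁻ ω, ENNReal.ofReal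
        (∑ i, (improved μ ε mt ω i - mh i (obs μ ε ω)) ^ 2) ∂P) + 2 * B +
      ENNReal.ofReal (16 * (4 * (K + 2) * η⁻¹ ^ 2) ^ 2 * (√((1 + 4 * T) / n) + T / n)) +
      ENNReal.ofReal (1 / (n : ℝ) * ∑ i, P.real {ω | K < |resid μ ε mt ω i|}) := by
  refine (lintegral_mono fun ω => ENNReal.ofReal_add_le.trans
    (add_le_add_left ENNReal.ofReal_add_le _)).trans ?_
  rw [lintegral_add_right _
      (measurable_integral_one_sub_cutoff_mul_mixDensity hm hmt K).ennreal_ofReal,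
    lintegral_add_right _ (measurable_quadGap_regScore_regId hm hmt hK hη hη1 S).ennreal_ofReal]
  exact add_le_add (add_le_add (lintegral_average_sq_scoreDefect_le hm hmt hmh hα hB)
    (lintegral_quadGap_le hm hn hmt hV hT (isMeanFieldLipschitz_regScore hK hη hη1)
      (isMeanFieldLipschitz_regId hK hη hη1)))
    (lintegral_integral_one_sub_cutoff_mul_mixDensity_le hm hn hmt hV K)

end StatErr

end Model

section Middle

/-- The indices with `c * n ≤ i ≤ (1 - c) * n`, in the numbering `1, …, n` of the paper. -/
noncomputable def middle (c : ℝ) (n : ℕ) : Finset (Fin n) :=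
  open Classical in
  {i | c * (n : ℝ) ≤ ((i : ℕ) : ℝ) + 1 ∧ ((i : ℕ) : ℝ) + 1 ≤ (1 - c) * (n : ℝ)}

lemma mem_middle {c : ℝ} {n : ℕ} {i : Fin n} : i ∈ middle c n ↔
    c * (n : ℝ) ≤ ((i : ℕ) : ℝ) + 1 ∧ ((i : ℕ) : ℝ) + 1 ≤ (1 - c) * (n : ℝ) := by
  simp [middle]

lemma card_compl_middle_le {c : ℝ} (n : ℕ) :
    (middle c n)ᶜ.card ≤ 2 * ⌈c * n⌉₊ := by
  set m := ⌈c * n⌉₊ with hm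
  have hcover : (middle c n)ᶜ ⊆ (Finset.univ.filter fun i : Fin n => (i : ℕ) < m) ∪
      Finset.univ.filter fun i : Fin n => (i.rev : ℕ) < m := by
    intro i hi
    rw [Finset.mem_compl, mem_middle, not_and_or, not_le, not_le] at hi
    simp only [Finset.mem_union, Finset.mem_filter_univ, hm, Nat.lt_ceil, Fin.val_rev]
    refine hi.imp (fun h => by linarith) fun h => ?_
    rw [Nat.cast_sub i.2]
    push_cast
    linarith
  have hcard : ∀ f : Fin n → Fin n, f.Injective →
      (Finset.univ.filter fun i => (f i : ℕ) < m).card ≤ m := fun f hf => by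
    rw [← Finset.card_range m]
    exact Finset.card_le_card_of_injOn (fun i => (f i : ℕ)) (fun i hi => by simpa using hi)
      fun i _ j _ h => hf (Fin.ext h)
  calc (middle c n)ᶜ.card ≤ _ := (Finset.card_le_card hcover).trans (Finset.card_union_le _ _)
    _ ≤ m + m := add_le_add (hcard id Function.injective_id) (hcard _ Fin.rev_injective)
    _ = 2 * m := (two_mul m).symm

lemma inv_mul_card_compl_middle_le {c : ℝ} (hc : 0 ≤ c) {n : ℕ} (hn : 0 < n) :
    (n : ℝ)⁻¹ * (middle c n)ᶜ.card ≤ 2 * c + 2 / n := by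
  have hcard : ((middle c n)ᶜ.card : ℝ) ≤ 2 * ⌈c * n⌉₊ := mod_cast card_compl_middle_le n
  have hceil := (Nat.ceil_lt_add_one (mul_nonneg hc n.cast_nonneg)).le
  calc (n : ℝ)⁻¹ * (middle c n)ᶜ.card ≤ (n : ℝ)⁻¹ * (2 * (c * n + 1)) := by
        gcongr
        linarith
    _ = 2 * c + 2 / n := by field_simp

end Middle

section Rates

lemma tendsto_log_natCast : Tendsto (fun n : ℕ => Real.log n) atTop atTop :=
  Real.tendsto_log_atTop.comp tendsto_natCast_atTop_atTop

lemma tendsto_log_pow_div (k : ℕ) :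
    Tendsto (fun n : ℕ => Real.log n ^ k / (n : ℝ)) atTop (𝓝 0) :=
  (Real.isLittleO_pow_log_id_atTop (n := k)).tendsto_div_nhds_zero.comp
    tendsto_natCast_atTop_atTop

lemma tendsto_inv_log_pow {k : ℕ} (hk : k ≠ 0) :
    Tendsto (fun n : ℕ => (Real.log n ^ k)⁻¹) atTop (𝓝 0) :=
  tendsto_inv_atTop_zero.comp ((tendsto_pow_atTop hk).comp tendsto_log_natCast)

lemma influence_rate_le {K T x : ℝ} (hK : 1 ≤ K) (hT : 0 ≤ T) (hx : 0 < x) :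
    16 * (4 * (K + 2) * ((K ^ 2)⁻¹)⁻¹ ^ 2) ^ 2 * (√((1 + 4 * T) / x) + T / x) ≤
      2304 * (√((1 + 4 * T) * (K ^ 20 / x)) + T * (K ^ 10 / x)) := by
  have : 0 < K := zero_lt_one.trans_le hK
  have hsqrt : √((1 + 4 * T) * (K ^ 20 / x)) = K ^ 10 * √((1 + 4 * T) / x) := by
    rw [show (1 + 4 * T) * (K ^ 20 / x) = (K ^ 10) ^ 2 * ((1 + 4 * T) / x) by ring,
      Real.sqrt_mul (sq_nonneg _), Real.sqrt_sq (by positivity)]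
  calc 16 * (4 * (K + 2) * ((K ^ 2)⁻¹)⁻¹ ^ 2) ^ 2 * (√((1 + 4 * T) / x) + T / x)
      ≤ 16 * (4 * (K + 2 * K) * ((K ^ 2)⁻¹)⁻¹ ^ 2) ^ 2 * (√((1 + 4 * T) / x) + T / x) := by
        gcongr
        linarith
    _ = 2304 * (√((1 + 4 * T) * (K ^ 20 / x)) + T * (K ^ 10 / x)) := by
        rw [hsqrt, inv_inv]
        ring

lemma tendsto_influence_rate {T : ℝ} (hT : 0 ≤ T) :
    Tendsto (fun n : ℕ => ENNReal.ofReal (16 * (4 * (Real.log n + 2) *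
      ((Real.log n ^ 2)⁻¹)⁻¹ ^ 2) ^ 2 * (√((1 + 4 * T) / n) + T / n))) atTop (𝓝 0) := by
  have hlim : Tendsto (fun n : ℕ => 2304 * (√((1 + 4 * T) * (Real.log n ^ 20 / n)) +
      T * (Real.log n ^ 10 / n))) atTop (𝓝 0) := by
    simpa using ((((tendsto_log_pow_div 20).const_mul (1 + 4 * T)).sqrt).add
      ((tendsto_log_pow_div 10).const_mul T)).const_mul 2304
  rw [← ENNReal.ofReal_zero]
  refine ENNReal.tendsto_ofReal (squeeze_zero' (Eventually.of_forall fun n => by positivity) ?_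
    hlim)
  filter_upwards [tendsto_log_natCast.eventually_ge_atTop 1, eventually_gt_atTop 0] with n hK hn
  exact influence_rate_le hK hT (Nat.cast_pos.2 hn)

lemma eventually_mass_loss_le {c : ℝ} (hc : 0 < c) :
    ∀ᶠ n : ℕ in atTop, (n : ℝ)⁻¹ * (middle c n)ᶜ.card +
      2 * (Real.log n + 1) * (Real.log n ^ 2)⁻¹ ≤ 4 * c := by
  have hlim : Tendsto (fun n : ℕ => 2 / (n : ℝ) + 4 * (Real.log n)⁻¹) atTop (𝓝 0) := by
    simpa using (tendsto_const_div_atTop_nhds_zero_nat 2).add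
      ((tendsto_inv_atTop_zero.comp tendsto_log_natCast).const_mul 4)
  filter_upwards [hlim.eventually_le_const (by positivity : 0 < 2 * c), eventually_gt_atTop 0,
    tendsto_log_natCast.eventually_ge_atTop 1] with n hsmall hn hK
  have : 0 < Real.log n := zero_lt_one.trans_le hK
  have hlog : 2 * (Real.log n + 1) * (Real.log n ^ 2)⁻¹ ≤ 4 * (Real.log n)⁻¹ :=
    calc 2 * (Real.log n + 1) * (Real.log n ^ 2)⁻¹
        ≤ 2 * (Real.log n + Real.log n) * (Real.log n ^ 2)⁻¹ := by gcongr
      _ = 4 * (Real.log n)⁻¹ := by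
        field_simp
        norm_num
  linarith [inv_mul_card_compl_middle_le hc.le hn]

end Rates

section Probability

lemma tendsto_measure_ge_of_tendsto_lintegral {Ω : ℕ → Type*} [∀ n, MeasurableSpace (Ω n)]
    {P : ∀ n, Measure (Ω n)} {X : ∀ n, Ω n → ℝ}
    (hX : ∀ᶠ n in atTop, AEMeasurable (X n) (P n))
    (hlim : Tendsto (fun n => ∫⁻ ω, ENNReal.ofReal (X n ω) ∂P n) atTop (𝓝 0)) {c : ℝ}
    (hc : 0 < c) : Tendsto (fun n => P n {ω | c ≤ X n ω}) atTop (𝓝 0) := by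
  have hc' := (ENNReal.ofReal_pos.2 hc).ne'
  have hdiv := ENNReal.Tendsto.div_const hlim (Or.inr hc')
  rw [ENNReal.zero_div] at hdiv
  refine tendsto_of_tendsto_of_tendsto_of_le_of_le' tendsto_const_nhds hdiv
    (Eventually.of_forall fun n => zero_le) ?_
  filter_upwards [hX] with n hn
  exact (measure_mono fun ω hω => ENNReal.ofReal_le_ofReal hω).trans
    (meas_ge_le_lintegral_div hn.ennreal_ofReal hc' ENNReal.ofReal_ne_top)

lemma BoundedBelowInProb.tendstoZeroInProb {Ω : ℕ → Type*} [∀ n, MeasurableSpace (Ω n)]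
    {P : ∀ n, Measure (Ω n)} [∀ n, IsFiniteMeasure (P n)] {X Y : ∀ n, Ω n → ℝ}
    (hY : BoundedBelowInProb P Y)
    (hXY : ∀ A e : ℝ, 0 < A → 0 < e →
      Tendsto (fun n => P n ({ω | A ≤ Y n ω} ∩ {ω | e ≤ |X n ω|})) atTop (𝓝 0)) :
    TendstoZeroInProb P X := by
  intro e he
  rw [ENNReal.tendsto_nhds_zero]
  intro d hd
  obtain ⟨r, -, hr, hrd⟩ := ENNReal.lt_iff_exists_real_btwn.1 (ENNReal.half_pos hd.ne')
  obtain ⟨A, hA, hsmall⟩ := hY r (ENNReal.ofReal_pos.1 hr)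
  filter_upwards [hsmall, ENNReal.tendsto_nhds_zero.1 (hXY A e hA he) _ (ENNReal.half_pos hd.ne')]
    with n hbelow habove
  have hbelow' : P n {ω | Y n ω < A} ≤ d / 2 := by
    rw [← ofReal_measureReal]
    exact (ENNReal.ofReal_le_ofReal hbelow).trans hrd.le
  calc P n {ω | e ≤ |X n ω|}
      ≤ P n ({ω | Y n ω < A} ∪ {ω | A ≤ Y n ω} ∩ {ω | e ≤ |X n ω|}) :=
        measure_mono fun ω hω => (lt_or_ge (Y n ω) A).imp_right fun h => ⟨h, hω⟩
    _ ≤ d / 2 + d / 2 := (measure_union_le _ _).trans (add_le_add hbelow' habove)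
    _ = d := ENNReal.add_halves d

end Probability

section Limit

variable {Ω : ℕ → Type*} [∀ n, MeasurableSpace (Ω n)] {P : ∀ n, Measure (Ω n)}
  {μ ε : ∀ n, Fin n → Ω n → ℝ} {mt mh : ∀ n, Fin n → (Fin n → ℝ) → ℝ}
  {α : ∀ n, (Fin n → ℝ) → ℝ}

lemma HasLogTails.tendsto_average (h : HasLogTails P μ ε mt) :
    Tendsto (fun n : ℕ => 1 / (n : ℝ) *
      ∑ i, (P n).real {ω | Real.log n < |resid (μ n) (ε n) (mt n) ω i|}) atTop (𝓝 0) :=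
  squeeze_zero' (Eventually.of_forall fun n => by positivity) h
    (by simpa only [one_div] using tendsto_inv_log_pow (k := 8) (by norm_num))

/-- `statErr` over the middle indices, with cut-off level `log n` and regularisation
`(log n)⁻²`. -/
noncomputable def logStatErr (c : ℝ) (μ ε : ∀ n, Fin n → Ω n → ℝ)
    (mt : ∀ n, Fin n → (Fin n → ℝ) → ℝ) (α : ∀ n, (Fin n → ℝ) → ℝ) (n : ℕ) (ω : Ω n) : ℝ :=
  statErr (middle c n) (Real.log n) (Real.log n ^ 2)⁻¹ (centred (μ n) (ε n) (mt n) ω)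
    (α n (obs (μ n) (ε n) ω)) (resid (μ n) (ε n) (mt n) ω)

lemma measurable_logStatErr (hmodel : ∀ n, IsSignalPlusNoise (P n) (μ n) (ε n))
    (hmt : ∀ n i, Measurable (mt n i)) (hα : ∀ n, Measurable (α n)) (c : ℝ) {n : ℕ}
    (hn : 1 ≤ Real.log n) : Measurable (logStatErr c μ ε mt α n) :=
  measurable_statErr (hmodel n) (hmt n) (hα n) (zero_le_one.trans hn)
    (by positivity) (inv_le_one_of_one_le₀ (one_le_pow₀ hn)) _

lemma tendsto_lintegral_logStatErr [∀ n, IsProbabilityMeasure (P n)]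
    (hmodel : ∀ n, IsSignalPlusNoise (P n) (μ n) (ε n))
    (hmt : ∀ n i, Measurable (mt n i)) {r : ∀ n, Fin n → Fin n → ℝ} {T : ℝ} (hT : 0 ≤ T)
    (hV : ∀ n m, HasInfluence (centredOf (mt n) m) (r n) T)
    (hmh : ∀ n i, Measurable (mh n i)) (hα : ∀ n, Measurable (α n)) {c : ℝ}
    (hrem : Tendsto (fun n : ℕ => ⨆ (i : Fin n)
        (_ : c * (n : ℝ) ≤ ((i : ℕ) : ℝ) + 1 ∧ ((i : ℕ) : ℝ) + 1 ≤ (1 - c) * (n : ℝ)),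
        ∫⁻ ω, ENNReal.ofReal
          ((mh n i (obs (μ n) (ε n) ω)
            - (α n (obs (μ n) (ε n) ω) * mt n i (obs (μ n) (ε n) ω)
              + (1 - α n (obs (μ n) (ε n) ω)) * obs (μ n) (ε n) ω i)) ^ 2) ∂P n)
      atTop (𝓝 0))
    (htail : Tendsto (fun n : ℕ => 1 / (n : ℝ) *
      ∑ i, (P n).real {ω | Real.log n < |resid (μ n) (ε n) (mt n) ω i|}) atTop (𝓝 0))
    (hequiv : Tendsto (fun n : ℕ => (n : ℝ≥0∞)⁻¹ *
        ∫⁻ ω, ENNReal.ofReal (∑ i, (improved (μ n) (ε n) (mt n) ω i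
          - mh n i (obs (μ n) (ε n) ω)) ^ 2) ∂P n) atTop (𝓝 0)) :
    Tendsto (fun n => ∫⁻ ω, ENNReal.ofReal (logStatErr c μ ε mt α n ω) ∂P n) atTop (𝓝 0) := by
  have hlim := (((ENNReal.Tendsto.const_mul (a := 2) hequiv (Or.inr (by simp))).add
    (ENNReal.Tendsto.const_mul (a := 2) hrem (Or.inr (by simp)))).add
      (tendsto_influence_rate hT)).add (ENNReal.tendsto_ofReal htail)
  simp only [mul_zero, add_zero, ENNReal.ofReal_zero] at hlim
  refine tendsto_of_tendsto_of_tendsto_of_le_of_le' tendsto_const_nhds hlim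
    (Eventually.of_forall fun n => zero_le) ?_
  filter_upwards [tendsto_log_natCast.eventually_ge_atTop 1, eventually_gt_atTop 0] with n hK hn
  exact lintegral_statErr_le (hmodel n) hn (hmt n) (hV n) hT (hmh n) (hα n)
    (fun i hi => le_iSup₂_of_le i (mem_middle.1 hi) le_rfl) (zero_le_one.trans hK)
    (by positivity) (inv_le_one_of_one_le₀ (one_le_pow₀ hK))

lemma IsScoreMargin.tendsto_measure_discrepancy_ge {g : ℝ → ℝ} {I : Set ℝ} {e δ : ℝ}
    (h : IsScoreMargin g I e δ) (hδ : 0 < δ) (hI : I ⊆ Set.Icc 0 1)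
    (hmeas : ∀ c, ∀ᶠ n in atTop, AEMeasurable (logStatErr c μ ε mt α n) (P n))
    (herr : ∀ c, 0 < c → Tendsto (fun n => ∫⁻ ω, ENNReal.ofReal (logStatErr c μ ε mt α n ω) ∂P n)
      atTop (𝓝 0)) {E : ∀ n, Set (Ω n)}
    (hE : ∀ n, ∀ᵐ ω ∂P n, ω ∈ E n → α n (obs (μ n) (ε n) ω) ∈ I) :
    Tendsto (fun n => P n (E n ∩ {ω | e ≤ |discrepancy (μ n) (ε n) (mt n) (α n) g ω|})) atTop
      (𝓝 0) := by
  have hc : 0 < δ / 8 := by positivity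
  refine tendsto_of_tendsto_of_tendsto_of_le_of_le' tendsto_const_nhds
    (tendsto_measure_ge_of_tendsto_lintegral (hmeas _) (herr _ hc)
      (by positivity : 0 < min (δ ^ 2) (δ / 2))) (Eventually.of_forall fun n => zero_le) ?_
  filter_upwards [eventually_mass_loss_le hc, tendsto_log_natCast.eventually_ge_atTop 1,
    eventually_gt_atTop 0] with n hloss hK hn
  refine measure_mono_ae ((hE n).mono fun ω hEI ⟨hωE, hω⟩ => ?_)
  by_contra hlt
  replace hlt : logStatErr (δ / 8) μ ε mt α n ω < min (δ ^ 2) (δ / 2) := not_le.1 hlt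
  refine (show e ≤ _ from hω).not_gt ?_
  exact h.abs_integral_sub_lt hδ hI hn (zero_le_one.trans hK) (by positivity)
    (inv_le_one_of_one_le₀ (one_le_pow₀ hK)) (hEI hωE) (hloss.trans_eq (by ring)) hlt

end Limit

section Local

lemma sum_erase_dist_le {f : ℕ → ℝ} (hf0 : ∀ M, 0 ≤ f M) (hf : Summable f) {n : ℕ} (i : Fin n) :
    ∑ j ∈ Finset.univ.erase i, f (Nat.dist i j) ≤ 2 * ∑' M, f M := by
  have hsub : Finset.univ.erase i ⊆ Finset.Iio i ∪ Finset.Ioi i := fun j hj => by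
    simpa using lt_or_gt_of_ne (Finset.ne_of_mem_erase hj)
  have hinj : ∀ s : Finset (Fin n), Set.InjOn (fun j : Fin n => Nat.dist i j) s →
      ∑ j ∈ s, f (Nat.dist i j) ≤ ∑' M, f M := fun s hs => by
    rw [← Finset.sum_image (f := f) hs]
    exact hf.sum_le_tsum _ fun M _ => hf0 M
  refine (Finset.sum_le_sum_of_subset_of_nonneg hsub fun _ _ _ => hf0 _).trans ?_
  rw [Finset.sum_union (Finset.disjoint_left.2 fun j hj hj' =>
    lt_asymm (Finset.mem_Iio.1 hj) (Finset.mem_Ioi.1 hj')), two_mul]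
  refine add_le_add (hinj _ ?_) (hinj _ ?_) <;>
  · intro j hj k hk hjk
    simp only [Finset.coe_Iio, Finset.coe_Ioi, Set.mem_Iio, Set.mem_Ioi, Fin.lt_def] at hj hk
    simp only [Nat.dist] at hjk
    exact Fin.ext (by lia)

lemma IsLocalPredictor.summable_posPart {mt : ∀ n, Fin n → (Fin n → ℝ) → ℝ} {ρ : ℕ → ℝ}
    (h : IsLocalPredictor mt ρ) : Summable fun M => max (ρ M) 0 := by
  have hs : Summable fun M : ℕ => 1 / (M : ℝ) ^ 2 := Real.summable_one_div_nat_pow.2 one_lt_two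
  refine hs.of_norm_bounded_eventually_nat ?_
  filter_upwards [eventually_lt_of_limsup_lt h.limsup_lt, eventually_gt_atTop 0] with M hM hM0
  have hlt : (M : ℝ) ^ 2 * ρ M < 1 := mod_cast hM
  rw [Real.norm_of_nonneg (le_max_right _ _)]
  refine max_le ?_ (by positivity)
  rw [le_div_iff₀' (by positivity)]
  exact hlt.le

lemma IsLocalPredictor.abs_update_sub_le {mt : ∀ n, Fin n → (Fin n → ℝ) → ℝ} {ρ : ℕ → ℝ}
    (h : IsLocalPredictor mt ρ) (n : ℕ) (i j : Fin n) (hj : j ≠ i) (y : Fin n → ℝ) (d : ℝ) :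
    |mt n i (Function.update y j (y j + d)) - mt n i y| ≤ max (ρ (Nat.dist j i)) 0 * |d| := by
  rw [Nat.dist_comm]
  exact (h.lipschitz n i j hj y d).trans (by gcongr; exact le_max_left _ _)

end Local

end KalmanEB

theorem proposition1_general {Ω : ℕ → Type*} [∀ n, MeasurableSpace (Ω n)]
    (P : ∀ n, Measure (Ω n)) [∀ n, IsProbabilityMeasure (P n)]
    (μ ε : ∀ n, Fin n → Ω n → ℝ)
    (hmodel : ∀ n, KalmanEB.IsSignalPlusNoise (P n) (μ n) (ε n))
    (mt mh : ∀ n, Fin n → (Fin n → ℝ) → ℝ)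
    (hmt : ∀ n i, Measurable (mt n i)) (hmh : ∀ n i, Measurable (mh n i))
    (hdep : ∀ n i, DependsOn (mt n i) {j | j ≠ i})
    (r : ∀ n, Fin n → Fin n → ℝ) (T : ℝ)
    (hlip : ∀ (n : ℕ) (i j : Fin n), j ≠ i → ∀ (y : Fin n → ℝ) (d : ℝ),
      |mt n i (Function.update y j (y j + d)) - mt n i y| ≤ r n i j * |d|)
    (hsum : ∀ (n : ℕ) (j : Fin n), ∑ i ∈ Finset.univ.erase j, r n i j ≤ T)
    (α : ∀ n, (Fin n → ℝ) → ℝ) (hα : ∀ n, Measurable (α n))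
    (hα01 : ∀ n, ∀ᵐ ω ∂P n, α n (KalmanEB.obs (μ n) (ε n) ω) ∈ Set.Ioo (0 : ℝ) 1)
    (hrem : ∀ c : ℝ, 0 < c → Tendsto (fun n : ℕ => ⨆ (i : Fin n)
        (_ : c * (n : ℝ) ≤ ((i : ℕ) : ℝ) + 1 ∧ ((i : ℕ) : ℝ) + 1 ≤ (1 - c) * (n : ℝ)),
        ∫⁻ ω, ENNReal.ofReal
          ((mh n i (KalmanEB.obs (μ n) (ε n) ω)
            - (α n (KalmanEB.obs (μ n) (ε n) ω) * mt n i (KalmanEB.obs (μ n) (ε n) ω)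
              + (1 - α n (KalmanEB.obs (μ n) (ε n) ω))
                * KalmanEB.obs (μ n) (ε n) ω i)) ^ 2) ∂P n)
      atTop (𝓝 0))
    (htail : Tendsto (fun n : ℕ => 1 / (n : ℝ) * ∑ i,
      (P n).real {ω | Real.log n < |KalmanEB.resid (μ n) (ε n) (mt n) ω i|}) atTop (𝓝 0))
    (hequiv : Tendsto (fun n : ℕ => (n : ℝ≥0∞)⁻¹ *
        ∫⁻ ω, ENNReal.ofReal (∑ i, (KalmanEB.improved (μ n) (ε n) (mt n) ω i
          - mh n i (KalmanEB.obs (μ n) (ε n) ω)) ^ 2) ∂P n) atTop (𝓝 0)) :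
    (KalmanEB.BoundedBelowInProb P (fun n ω => α n (KalmanEB.obs (μ n) (ε n) ω)) →
      ∀ g : ℝ → ℝ, Continuous g → (∃ C : ℝ, ∀ x, |g x| ≤ C) →
        KalmanEB.TendstoZeroInProb P
          (fun n => KalmanEB.discrepancy (μ n) (ε n) (mt n) (α n) g)) ∧
    (∀ g : ℝ → ℝ, Continuous g → Tendsto g (cocompact ℝ) (𝓝 0) →
        KalmanEB.TendstoZeroInProb P
          (fun n => KalmanEB.discrepancy (μ n) (ε n) (mt n) (α n) g)) := by
  have hT : 0 ≤ T := by simpa using hsum 1 0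
  have hV := fun n m => KalmanEB.hasInfluence_centredOf (hmt n) (hdep n) (hlip n) (hsum n) m
  have hmeas : ∀ c, ∀ᶠ n in atTop,
      AEMeasurable (KalmanEB.logStatErr c μ ε mt α n) (P n) := fun c =>
    (KalmanEB.tendsto_log_natCast.eventually_ge_atTop 1).mono fun n hn =>
      (KalmanEB.measurable_logStatErr hmodel hmt hα c hn).aemeasurable
  have herr := fun c hc => KalmanEB.tendsto_lintegral_logStatErr hmodel hmt hT hV hmh hα
    (hrem c hc) htail hequiv
  refine ⟨fun hbelow g hg ⟨C, hC⟩ => hbelow.tendstoZeroInProb fun A e hA he => ?_,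
    fun g hg hg0 e he => ?_⟩
  · obtain ⟨δ, hδ, hmargin⟩ := KalmanEB.exists_isScoreMargin_Ico hg hC hA he
    exact hmargin.tendsto_measure_discrepancy_ge hδ
      (Set.Ico_subset_Icc_self.trans (Set.Icc_subset_Icc_left hA.le)) hmeas herr
      fun n => (hα01 n).mono fun ω hω hA' => ⟨hA', hω.2⟩
  · obtain ⟨δ, hδ, hmargin⟩ := KalmanEB.exists_isScoreMargin_Ioo hg hg0 he
    simpa only [Set.univ_inter] using hmargin.tendsto_measure_discrepancy_ge hδ
      Set.Ioo_subset_Icc_self hmeas herr (E := fun _ => Set.univ)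
      fun n => (hα01 n).mono fun ω hω _ => hω

theorem proposition1 {Ω : ℕ → Type*} [∀ n, MeasurableSpace (Ω n)]
    (P : ∀ n, Measure (Ω n)) [∀ n, IsProbabilityMeasure (P n)]
    (μ ε : ∀ n, Fin n → Ω n → ℝ)
    (hmodel : ∀ n, KalmanEB.IsSignalPlusNoise (P n) (μ n) (ε n))
    (mt mh : ∀ n, Fin n → (Fin n → ℝ) → ℝ)
    (hmh : ∀ n i, Measurable (mh n i))
    (ρ : ℕ → ℝ) (h1 : KalmanEB.IsLocalPredictor mt ρ)
    (α : ∀ n, (Fin n → ℝ) → ℝ)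
    (h2 : KalmanEB.IsAsymptoticAverage P μ ε mt mh α)
    (h3 : KalmanEB.HasLogTails P μ ε mt)
    (hequiv : Tendsto (fun n : ℕ => (n : ℝ≥0∞)⁻¹ *
        ∫⁻ ω, ENNReal.ofReal (∑ i, (KalmanEB.improved (μ n) (ε n) (mt n) ω i
          - mh n i (KalmanEB.obs (μ n) (ε n) ω)) ^ 2) ∂P n) atTop (𝓝 0)) :
    (KalmanEB.BoundedBelowInProb P (fun n ω => α n (KalmanEB.obs (μ n) (ε n) ω)) →
      ∀ g : ℝ → ℝ, Continuous g → (∃ C : ℝ, ∀ x, |g x| ≤ C) →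
        KalmanEB.TendstoZeroInProb P
          (fun n => KalmanEB.discrepancy (μ n) (ε n) (mt n) (α n) g)) ∧
    (∀ g : ℝ → ℝ, Continuous g → Tendsto g (cocompact ℝ) (𝓝 0) →
        KalmanEB.TendstoZeroInProb P
          (fun n => KalmanEB.discrepancy (μ n) (ε n) (mt n) (α n) g)) :=
  proposition1_general P μ ε hmodel mt mh h1.measurable hmh h1.dependsOn _ _
    h1.abs_update_sub_le
    (fun _ j => KalmanEB.sum_erase_dist_le (fun _ => le_max_right _ _) h1.summable_posPart j)
    α h2.measurable h2.mem_Ioo h2.remainder h3.tendsto_average hequiv
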